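/- **Setting.** An instance $\mathcal I=(N,M,\mathcal V)$ consists of a finite nonempty set $N$ of $n$ agents, a finite set $M$ of goods and, for each agent $i$, an additive valuation $v_i(S)=\sum_{g\in S}v_i(g)$, $v_i(g)\ge 0$. For $d\ge 1$ let $\mathrm{MMS}_v^d(M)$ be the maximum, over all partitions of $M$ into $d$ (possibly empty) bundles, of the value under $v$ of the worst bundle; a partition attaining it is an MMS partition. Put $\mathrm{MMS}_i(\mathcal I)=\mathrm{MMS}_{v_i}^{|N|}(M)$. For $\alpha>0$, an $\alpha$-MMS allocation gives pairwise disjoint bundles $A_i\subseteq M$ to the agents such that $v_i(A_i)\ge\alpha\cdot\mathrm{MMS}_i(\mathcal I)$ for all $i\in N$. **Ingredients.** $\mathtt{order}(\mathcal I)$ replaces $v_i(j)$ by the $j$-th largest value of agent $i$, for all $i,j$. $\mathtt{normalize}(\mathcal I)$ chooses for each agent $i$ an MMS partition and divides the value for $i$ of each good by the value for $i$ of the bundle of this partition that contains it. In an ordered instance, "good $k$" is the $k$-th good among the current ones; positions beyond the number of goods stand for dummy goods of value $0$. With $n$ the current number of agents, rule $R_k^\beta$ is applicable if some agent values the set $S_k$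 at least $\beta$; applying it gives $S_k$ to such an agent and removes both, where $S_1=\{1\}$, $S_2=\{2n-1,2n,2n+1\}$, $S_3=\{3n-2,3n-1,3n,3n+1\}$, $S_4=\{1,2n+1\}$, $S_5=\{1,2\}$. "Priority with $P$" means that a bundle is given to an agent of $P$ whenever a remaining agent of $P$ values it at least $\beta$. All choices left open below are arbitrary. **Algorithm $\mathtt{mainApproxMMS}(\mathcal I,\alpha)$.** Let $\delta=3/956$ and $\beta=3/4+\delta$. 1. (*reduce*) Agents with $\mathrm{MMS}_i(\mathcal I)=0$ get the empty bundle and leave. Order the instance and scale every valuation so that every maximin share is $1$. While one of $R_1^\alpha,\dots,R_4^\alpha$ is applicable, apply $R_k^\alpha$ for the smallest such $k$. 2. Normalize, then order, the remaining instance. Let $n$ be its number of agents, $B_k=\{k,2n-k+1\}$ for $1\le k\le n$, and $N^1_1$ the set of agents $i$ with $v_i(B_k)\le 1$ for all $k$ and $v_i(2n+1)\ge\frac14-5\delta$. 3. If $|N_1^1|\le n(\frac14-\delta)/(\frac14+\frac\delta3)$: with priority with $N^1_1$, as long as a remaining bag $B_k$ is worth at least $\beta$ to a remaining agent, give it to such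 an agent. Then process the remaining bags one after another, in any order: add goods that are in no bag, one at a time, until some remaining agent values the bag at least $\beta$, and give it to such an agent. 4. Otherwise, with priority with the agents outside $N^1_1$: as long as a remaining bag $B_k$ is worth at least $\beta$ to a remaining agent, give it to such an agent; then apply $R_5^\beta$ as long as it is applicable; then, as long as $R_2^\beta$ or $R_3^\beta$ is applicable, apply the first applicable one. With $n$ now the number of remaining agents, form $C_k=\{k,2n-k+1,2n+k\}$ for $1\le k\le n$ and, for $k=1,\dots,n$, add goods beyond good $3n$ to $C_k$, one at a time, until some remaining agent values it at least $\beta$, and give it to such an agent. 5. The allocation found in step 3 or 4 is translated back to the instance before the second ordering: the positions $1,2,\dots$ are processed in turn, and the owner of the current position (if any) picks a good she likes best among those not yet picked. The bundles given by the rules in step 1 are added, and the result is translated back in the same way through the first ordering to $\mathcal I$. **Theorem.** For every instance $\mathcal I$ with additive valuations and every $0<\alpha\le\frac34+\frac{3}{3836}$, $\mathtt{mainApproxMMS}(\mathcal I,\alpha)$ returns an $\alpha$-MMS allocation of $\mathcal I$: however its choices are resolved, the algorithm terminates, never runs out of goods in step 3 or 4, and its output is an $\alpha$-MMS allocation. In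 particular, every such instance has a $\left(\frac34+\frac{3}{3836}\right)$-MMS allocation, even one in which all goods are allocated. -/

import Mathlib

namespace FairDivision

/-- A fair-division instance `(N, M, V)` with additive valuations. Agents are labelled by `Fin n`,
goods by `Fin m`; `agents` and `goods` are the agents and goods present. The valuation of agent `i`
is the additive function determined by the values `val i g` of the single goods. -/
structure Instance (n m : ℕ) where
  agents : Finset (Fin n)
  goods : Finset (Fin m)
  val : Fin n → Fin m → ℝ

/-- An assignment of a bundle of goods to every agent. -/
abbrev Alloc (n m : ℕ) := Fin n → Finset (Fin m)

/-- The additive value of a bundle. -/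
noncomputable def value {m : ℕ} (u : Fin m → ℝ) (S : Finset (Fin m)) : ℝ := ∑ g ∈ S, u g

/-- Bundle `j` of the partition of `M` into `d` (possibly empty) bundles encoded by `P`. -/
def bundle {m d : ℕ} (M : Finset (Fin m)) (P : Fin m → Fin d) (j : Fin d) : Finset (Fin m) :=
  M.filter (fun g => P g = j)

/-- The value of the worst bundle of a partition of `M`. -/
noncomputable def minBundle {m d : ℕ} (u : Fin m → ℝ) (M : Finset (Fin m)) (P : Fin m → Fin d) :
    ℝ :=
  ⨅ j, value u (bundle M P j)

/-- The maximin share: the maximum of `minBundle` over the (finitely many) partitions of `M` into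
`d` bundles. Only used for `d ≥ 1`. -/
noncomputable def mms {m : ℕ} (u : Fin m → ℝ) (d : ℕ) (M : Finset (Fin m)) : ℝ :=
  ⨆ P : Fin m → Fin d, minBundle u M P

/-- The position (from 1) of a good of `M` when `M` is listed by increasing label. -/
def rank {m : ℕ} (M : Finset (Fin m)) (g : Fin m) : ℕ := (M.filter (fun h => h ≤ g)).card

/-- The goods of `M` whose positions lie in `R`. Positions beyond the number of goods
contribute nothing, as dummy goods of value `0` would. -/
def goodsAt {m : ℕ} (M : Finset (Fin m)) (R : Finset ℕ) : Finset (Fin m) :=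
  M.filter (fun g => rank M g ∈ R)

/-- Agent `i` of `N` may receive the bundle `S`: she values it at least `β`, and if an agent of
the priority set `P` is also satisfied by `S`, then `i` is one of those. `P = ∅` means no
priority. -/
def MayReceive {n m : ℕ} (u : Fin n → Fin m → ℝ) (N : Finset (Fin n)) (β : ℝ)
    (P : Finset (Fin n)) (S : Finset (Fin m)) (i : Fin n) : Prop :=
  i ∈ N ∧ β ≤ value (u i) S ∧ (i ∈ P ∨ ∀ j ∈ N, j ∈ P → value (u j) S < β)

namespace Instance

variable {n m : ℕ}

/-- The maximin share of agent `i` in the instance. -/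
noncomputable def share (I : Instance n m) (i : Fin n) : ℝ :=
  mms (I.val i) I.agents.card I.goods

/-- `A` gives disjoint bundles to the agents, each worth at least `α` times her maximin share
to the agent receiving it. -/
def IsApproxMMS (I : Instance n m) (α : ℝ) (A : Alloc n m) : Prop :=
  (∀ i ∈ I.agents, A i ⊆ I.goods) ∧
  (∀ i ∈ I.agents, ∀ j ∈ I.agents, i ≠ j → Disjoint (A i) (A j)) ∧
  (∀ i ∈ I.agents, α * I.share i ≤ value (I.val i) (A i))

/-- Keep only the agents whose maximin share is positive. -/
noncomputable def dropZero (I : Instance n m) : Instance n m :=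
  { I with agents := I.agents.filter (fun i => 0 < I.share i) }

/-- `order`: the good in position `j` gets as value for agent `i` the `j`-th largest number in the
multiset of the values of `i` for the goods. -/
noncomputable def order (I : Instance n m) : Instance n m :=
  { I with
    val := fun i g =>
      ((I.goods.val.map (I.val i)).sort (fun a b => a ≥ b)).getD (rank I.goods g - 1) 0 }

/-- Scale every valuation by the maximin share. -/
noncomputable def scale (I : Instance n m) : Instance n m :=
  { I with val := fun i g => I.val i g / I.share i }

/-- `J` is a possible result of `normalize`: every agent of `I` divides the value of each good by
the value of the bundle that contains it in one of her maximin-share partitions. -/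
def IsNormalization (I J : Instance n m) : Prop :=
  J.agents = I.agents ∧ J.goods = I.goods ∧
  (∀ i ∈ I.agents, ∃ P : Fin m → Fin I.agents.card,
    minBundle (I.val i) I.goods P = I.share i ∧
    ∀ g, J.val i g = I.val i g / value (I.val i) (bundle I.goods P (P g))) ∧
  (∀ i, i ∉ I.agents → J.val i = I.val i)

/-- Agent `i` leaves with the goods `S`. -/
def remove (I : Instance n m) (i : Fin n) (S : Finset (Fin m)) : Instance n m :=
  { I with agents := I.agents.erase i, goods := I.goods \ S }

/-- The goods allocated by the reduction rules `R₁, …, R₅` in an ordered instance. -/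
def ruleGoods (I : Instance n m) : ℕ → Finset (Fin m)
  | 1 => goodsAt I.goods {1}
  | 2 => goodsAt I.goods {2 * I.agents.card - 1, 2 * I.agents.card, 2 * I.agents.card + 1}
  | 3 => goodsAt I.goods {3 * I.agents.card - 2, 3 * I.agents.card - 1, 3 * I.agents.card,
      3 * I.agents.card + 1}
  | 4 => goodsAt I.goods {1, 2 * I.agents.card + 1}
  | 5 => goodsAt I.goods {1, 2}
  | _ => ∅

/-- Rule `R_k` with threshold `β` is applicable. -/
def Applicable (I : Instance n m) (β : ℝ) (k : ℕ) : Prop :=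
  ∃ i ∈ I.agents, β ≤ value (I.val i) (I.ruleGoods k)

/-- `R_k` can be applied by giving its goods to agent `i`, under the priority set `P`. -/
def CanApply (I : Instance n m) (β : ℝ) (P : Finset (Fin n)) (k : ℕ) (i : Fin n) : Prop :=
  MayReceive I.val I.agents β P (I.ruleGoods k) i

/-- The initial bags `B_k = {k, 2n - k + 1}`, for `1 ≤ k ≤ n`. -/
def bagB (I : Instance n m) (k : ℕ) : Finset (Fin m) :=
  goodsAt I.goods {k, 2 * I.agents.card - k + 1}

/-- The initial bags `C_k = {k, 2n - k + 1, 2n + k}`, for `1 ≤ k ≤ n`. -/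
def bagC (I : Instance n m) (k : ℕ) : Finset (Fin m) :=
  goodsAt I.goods {k, 2 * I.agents.card - k + 1, 2 * I.agents.card + k}

/-- The agents for whom every `B_k` is worth at most `1` and good `2n + 1` at least
`1/4 - 5δ`. -/
noncomputable def N11 (I : Instance n m) (δ : ℝ) : Finset (Fin n) :=
  open Classical in
  I.agents.filter (fun i =>
    (∀ k ∈ Finset.Icc 1 I.agents.card, value (I.val i) (I.bagB k) ≤ 1) ∧
    1 / 4 - 5 * δ ≤ value (I.val i) (goodsAt I.goods {2 * I.agents.card + 1}))

/-- The test that decides between the two bag-filling algorithms. -/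
def FewN11 (I : Instance n m) (δ : ℝ) : Prop :=
  ((I.N11 δ).card : ℝ) ≤ (I.agents.card : ℝ) * (1 / 4 - δ) / (1 / 4 + δ / 3)

/-- Translation of an allocation `A` of `I.order` to an allocation `B` of `I`: the positions
assigned by `A` are processed in order, and at each of them the owner picks a good that she likes
best among those not yet picked; `pick g` is the good picked at the position of `g`. -/
def IsPicking (I : Instance n m) (A B : Alloc n m) : Prop :=
  ∃ pick : Fin m → Fin m,
    (∀ i ∈ I.agents, ∀ g ∈ A i,
      let free := I.goods \
        ((I.agents.biUnion A).filter (fun h => h < g)).image pick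
      pick g ∈ free ∧ ∀ h ∈ free, I.val i h ≤ I.val i (pick g)) ∧
    ∀ i, B i = if i ∈ I.agents then (A i).image pick else ∅

end Instance

/-- What the algorithm remembers once `reduce` and `normalize` have run: the normalized instance,
and the bundles given to the agents that `reduce` removed. -/
structure Memory (n m : ℕ) where
  base : Instance n m
  given : Alloc n m

namespace Memory

variable {n m : ℕ}

/-- The ordered normalized instance `order (normalize (reduce I))`. -/
noncomputable def hat (c : Memory n m) : Instance n m := c.base.order

/-- Priority set under the parameter `δ`: `N¹₁` in the first case, all other agents in the
second. -/
noncomputable def priority (c : Memory n m) (δ : ℝ) : Finset (Fin n) :=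
  open Classical in
  if c.hat.FewN11 δ then c.hat.N11 δ else c.hat.agents \ c.hat.N11 δ

/-- The bundles held by the agents when `A` has been translated into `B`. -/
def combine (c : Memory n m) (B : Alloc n m) : Alloc n m :=
  fun i => if i ∈ c.base.agents then B i else c.given i

end Memory

/-- Configurations of `mainApproxMMS`. In each of them `A` records the bundles given so far in the
current part of the algorithm. -/
inductive Config (n m : ℕ) where
  /-- The loop of `reduce`, with current instance `J`. -/
  | reduce (J : Instance n m) (A : Alloc n m)
  /-- The loop that gives away initial bags; `K` holds the indices of the remaining bags. -/
  | bags (c : Memory n m) (J : Instance n m) (K : Finset ℕ) (A : Alloc n m)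
  /-- The loop that applies `R₅` (second case only). -/
  | pairs (c : Memory n m) (J : Instance n m) (A : Alloc n m)
  /-- The loop that applies `R₂` and `R₃` (second case only). -/
  | rules (c : Memory n m) (J : Instance n m) (A : Alloc n m)
  /-- Bag filling: `N` are the remaining agents, `Q` the remaining bags (the first one is being
  processed), and `F` the goods that may still be added to bags. -/
  | fill (c : Memory n m) (N : Finset (Fin n)) (Q : List (Finset (Fin m)))
      (F : Finset (Fin m)) (A : Alloc n m)
  /-- The algorithm has returned `A`. -/
  | done (A : Alloc n m)

variable {n m : ℕ}

/-- The constant `δ` of the algorithm. -/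
noncomputable def delta : ℝ := 3 / 956

/-- The threshold `3/4 + δ` of the two bag-filling algorithms. -/
noncomputable def beta : ℝ := 3 / 4 + delta

/-- The configuration in which `mainApproxMMS` enters the loop of `reduce`: agents with maximin
share `0` have left with the empty bundle, the instance has been ordered, and the valuations have
been scaled so that every maximin share is `1`. -/
noncomputable def start (I : Instance n m) : Config n m :=
  .reduce I.dropZero.order.scale (fun _ => ∅)

/-- One step of `mainApproxMMS (I, α)`. Every choice that the algorithm leaves open can be
resolved in every possible way. -/
inductive Step (I : Instance n m) (α : ℝ) : Config n m → Config n m → Prop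
  /-- `reduce` applies the first applicable one of the rules `R₁, …, R₄` with threshold `α`. -/
  | reduceRule {J : Instance n m} {A : Alloc n m} (k : ℕ) (i : Fin n)
      (hk : k ∈ Finset.Icc 1 4) (hmin : ∀ l ∈ Finset.Ico 1 k, ¬ J.Applicable α l)
      (hi : J.CanApply α ∅ k i) :
      Step I α (.reduce J A)
        (.reduce (J.remove i (J.ruleGoods k)) (Function.update A i (J.ruleGoods k)))
  /-- `reduce` ends; the instance is normalized and ordered, and the bags `B₁, …, Bₙ` are
  formed. -/
  | reduceExit {J : Instance n m} {A : Alloc n m} (B : Instance n m)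
      (hexit : ∀ k ∈ Finset.Icc 1 4, ¬ J.Applicable α k) (hB : J.IsNormalization B) :
      Step I α (.reduce J A)
        (.bags ⟨B, A⟩ B.order (Finset.Icc 1 B.agents.card) (fun _ => ∅))
  /-- A remaining initial bag is given to an agent who values it at least `3/4 + δ`. -/
  | bagGive {c : Memory n m} {J : Instance n m} {K : Finset ℕ} {A : Alloc n m}
      (k : ℕ) (i : Fin n) (hk : k ∈ K)
      (hi : MayReceive J.val J.agents beta (c.priority delta) (c.hat.bagB k) i) :
      Step I α (.bags c J K A)
        (.bags c (J.remove i (c.hat.bagB k)) (K.erase k) (Function.update A i (c.hat.bagB k)))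
  /-- First case: no remaining bag satisfies a remaining agent; the remaining bags are going to be
  filled in an arbitrary order, with the goods that are in no bag. -/
  | bagExitFew {c : Memory n m} {J : Instance n m} {K : Finset ℕ} {A : Alloc n m} (L : List ℕ)
      (hfew : c.hat.FewN11 delta)
      (hexit : ∀ k ∈ K, ∀ i ∈ J.agents, value (J.val i) (c.hat.bagB k) < beta)
      (hL : L.Nodup ∧ L.toFinset = K) :
      Step I α (.bags c J K A)
        (.fill c J.agents (L.map c.hat.bagB) (J.goods \ K.biUnion c.hat.bagB) A)
  /-- Second case: no remaining bag satisfies a remaining agent. -/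
  | bagExitMany {c : Memory n m} {J : Instance n m} {K : Finset ℕ} {A : Alloc n m}
      (hmany : ¬ c.hat.FewN11 delta)
      (hexit : ∀ k ∈ K, ∀ i ∈ J.agents, value (J.val i) (c.hat.bagB k) < beta) :
      Step I α (.bags c J K A) (.pairs c J A)
  /-- `R₅` is applied. -/
  | pairGive {c : Memory n m} {J : Instance n m} {A : Alloc n m} (i : Fin n)
      (hi : J.CanApply beta (c.priority delta) 5 i) :
      Step I α (.pairs c J A)
        (.pairs c (J.remove i (J.ruleGoods 5)) (Function.update A i (J.ruleGoods 5)))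
  /-- `R₅` is not applicable any more. -/
  | pairExit {c : Memory n m} {J : Instance n m} {A : Alloc n m}
      (hexit : ¬ J.Applicable beta 5) :
      Step I α (.pairs c J A) (.rules c J A)
  /-- The first applicable one of the rules `R₂`, `R₃` is applied. -/
  | ruleGive {c : Memory n m} {J : Instance n m} {A : Alloc n m} (k : ℕ) (i : Fin n)
      (hk : k ∈ Finset.Icc 2 3) (hmin : ∀ l ∈ Finset.Ico 2 k, ¬ J.Applicable beta l)
      (hi : J.CanApply beta (c.priority delta) k i) :
      Step I α (.rules c J A)
        (.rules c (J.remove i (J.ruleGoods k)) (Function.update A i (J.ruleGoods k)))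
  /-- Neither `R₂` nor `R₃` is applicable any more; the bags `C₁, …, Cₙ` are formed, and are going
  to be filled in this order, with the goods beyond position `3n`. -/
  | ruleExit {c : Memory n m} {J : Instance n m} {A : Alloc n m}
      (hexit : ∀ k ∈ Finset.Icc 2 3, ¬ J.Applicable beta k) :
      Step I α (.rules c J A)
        (.fill c J.agents ((List.range J.agents.card).map (fun k => J.bagC (k + 1)))
          (J.goods.filter (fun g => 3 * J.agents.card < rank J.goods g)) A)
  /-- The current bag satisfies no remaining agent and an arbitrary good is added to it. -/
  | fillAdd {c : Memory n m} {N : Finset (Fin n)} {C : Finset (Fin m)}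
      {Q : List (Finset (Fin m))} {F : Finset (Fin m)} {A : Alloc n m} (g : Fin m)
      (hlow : ∀ i ∈ N, value (c.hat.val i) C < beta) (hg : g ∈ F) :
      Step I α (.fill c N (C :: Q) F A) (.fill c N (insert g C :: Q) (F.erase g) A)
  /-- The current bag is given to an agent who values it at least `3/4 + δ`. -/
  | fillGive {c : Memory n m} {N : Finset (Fin n)} {C : Finset (Fin m)}
      {Q : List (Finset (Fin m))} {F : Finset (Fin m)} {A : Alloc n m} (i : Fin n)
      (hi : MayReceive c.hat.val N beta (c.priority delta) C i) :
      Step I α (.fill c N (C :: Q) F A) (.fill c (N.erase i) Q F (Function.update A i C))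
  /-- All bags have been processed. The allocation is translated back through `order` (and
  `normalize`, which does not change bundles), joined with the bundles given by `reduce`, and
  translated back through the `order` with which `reduce` begins. -/
  | fillExit {c : Memory n m} {N : Finset (Fin n)} {F : Finset (Fin m)} {A : Alloc n m}
      (B E : Alloc n m) (hB : c.base.IsPicking A B) (hE : I.IsPicking (c.combine B) E) :
      Step I α (.fill c N [] F A) (.done E)

/-- `mainApproxMMS (I, α)` always returns an allocation with property `Q`: there is no infinite
run, and every run that cannot be continued has ended by returning an allocation with
property `Q`. In particular no run gets stuck for lack of goods. -/
def MainApproxMMSReturns (I : Instance n m) (α : ℝ) (Q : Alloc n m → Prop) : Prop :=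
  (¬ ∃ r : ℕ → Config n m, r 0 = start I ∧ ∀ t, Step I α (r t) (r (t + 1))) ∧
  ∀ x, Relation.ReflTransGen (Step I α) (start I) x → (∀ y, ¬ Step I α x y) →
    ∃ A, x = Config.done A ∧ Q A

end FairDivision

/-! The run is watched through the eyes of one remaining agent at a time. She keeps a budget: what
is left is worth at least the sum of allotments of the remaining agents, and a bundle that leaves
costs her at most the allotment of its recipient. Were her current bag too small with no good left
to add, the budget would be violated (`FillInv.nonempty`); hence no run gets stuck. Termination is
lexicographic (`stepMeasure_lt`), and picking transfers bundles to unordered instances without loss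
(`IsPicking.isAllocOf`).

The reduction costs a factor 956/959. Rounding with `trunc` takes a bundle of value 1 to at least
956/959, and all four rules preserve bundles of rounded value 956/959 (`HasParts.remove_ruleGoods`).
Since 956/959 times `beta` is 720/959 = 3/4 + 3/3836, it then suffices to give every agent `beta` in
the normalized instance. There every agent has n bundles of value exactly 1, and good 1, the goods
around position 2n and the pair of goods 1 and 2n+1 are bounded by `beta` (`IsONI`).

An agent with some B_k above 1 is handled by counting how her unit bundles meet the large goods
(`UnitBundles.sum_bags_le`): goods beyond 2n are worth at most 1/12 + `delta`, and an allotment of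
5/6 + 2 `delta` per remaining agent is available. If no B_k exceeds 1 and good 2n+1 is below 1/4 - 5
`delta`, the allotment 1 works. The hard agents are those of `N11`: a filled bag may cost them up to
4/3 `beta`, which is more than 1.

If at most 59/60 of the agents are hard, priority for them suffices: bags given to the others are
worth less than `beta` to them, and the average cost is at most 1. Otherwise the other agents are
fewer than 1/60 of all; with priority for these, crude bounds are enough (`priority_fillInv`). The
hard agents then have no control over what is given away, so values are replaced by bounded weights
(`Weights`, `exists_weights`): pairs of goods and filled bags weigh at most `θ`, and rules R₂ and R₃
keep the budget up to bounded errors that occur only once (`RulesInv.two`, `RulesInv.three`,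
`RulesInv.exit`). -/

namespace FairDivision

/-! ### Positions in a list of goods, and values by position. -/

section Positions

variable {m : ℕ}

theorem rank_mono (M : Finset (Fin m)) {g h : Fin m} (hgh : g ≤ h) : rank M g ≤ rank M h :=
  Finset.card_le_card fun _ ha => by
    rw [Finset.mem_filter] at ha ⊢
    exact ⟨ha.1, ha.2.trans hgh⟩

theorem rank_lt_rank {M : Finset (Fin m)} {g h : Fin m} (hh : h ∈ M) (hgh : g < h) :
    rank M g < rank M h := by
  refine Finset.card_lt_card ⟨fun a ha => ?_, fun hsub => ?_⟩
  · rw [Finset.mem_filter] at ha ⊢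
    exact ⟨ha.1, ha.2.trans hgh.le⟩
  · have := hsub (Finset.mem_filter.2 ⟨hh, le_rfl⟩)
    exact absurd (Finset.mem_filter.1 this).2 (not_le.2 hgh)

theorem rank_le_rank_iff {M : Finset (Fin m)} {g h : Fin m} (hg : g ∈ M) :
    rank M g ≤ rank M h ↔ g ≤ h :=
  ⟨fun hr => not_lt.1 fun hlt => absurd (rank_lt_rank hg hlt) (not_lt.2 hr), rank_mono M⟩

theorem rank_injOn (M : Finset (Fin m)) : Set.InjOn (rank M) M := fun _ hg _ hh h =>
  le_antisymm ((rank_le_rank_iff hg).1 h.le) ((rank_le_rank_iff hh).1 h.ge)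

theorem one_le_rank {M : Finset (Fin m)} {g : Fin m} (hg : g ∈ M) : 1 ≤ rank M g :=
  Finset.card_pos.2 ⟨g, Finset.mem_filter.2 ⟨hg, le_rfl⟩⟩

theorem rank_le_card (M : Finset (Fin m)) (g : Fin m) : rank M g ≤ M.card :=
  Finset.card_le_card (Finset.filter_subset _ _)

theorem image_rank (M : Finset (Fin m)) : M.image (rank M) = Finset.Icc 1 M.card := by
  refine Finset.eq_of_subset_of_card_le (fun p hp => ?_) ?_
  · obtain ⟨g, hg, rfl⟩ := Finset.mem_image.1 hp
    exact Finset.mem_Icc.2 ⟨one_le_rank hg, rank_le_card M g⟩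
  · rw [Finset.card_image_of_injOn (rank_injOn M), Nat.card_Icc]; omega

theorem exists_rank_eq {M : Finset (Fin m)} {p : ℕ} (hp : 1 ≤ p) (hp' : p ≤ M.card) :
    ∃ g ∈ M, rank M g = p := by
  have : p ∈ M.image (rank M) := by rw [image_rank]; exact Finset.mem_Icc.2 ⟨hp, hp'⟩
  simpa using this

theorem goodsAt_subset (M : Finset (Fin m)) (R : Finset ℕ) : goodsAt M R ⊆ M :=
  Finset.filter_subset _ _

theorem mem_goodsAt {M : Finset (Fin m)} {R : Finset ℕ} {g : Fin m} :
    g ∈ goodsAt M R ↔ g ∈ M ∧ rank M g ∈ R := Finset.mem_filter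

theorem card_goodsAt_le (M : Finset (Fin m)) (R : Finset ℕ) : (goodsAt M R).card ≤ R.card := by
  rw [← Finset.card_image_of_injOn ((rank_injOn M).mono (goodsAt_subset M R))]
  refine Finset.card_le_card fun p hp => ?_
  obtain ⟨g, hg, rfl⟩ := Finset.mem_image.1 hp
  exact (mem_goodsAt.1 hg).2

theorem goodsAt_disjoint {M : Finset (Fin m)} {R R' : Finset ℕ} (h : Disjoint R R') :
    Disjoint (goodsAt M R) (goodsAt M R') :=
  Finset.disjoint_left.2 fun _ hg hg' =>
    Finset.disjoint_left.1 h (mem_goodsAt.1 hg).2 (mem_goodsAt.1 hg').2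

theorem card_goodsAt {M : Finset (Fin m)} {R : Finset ℕ} (hR : R ⊆ Finset.Icc 1 M.card) :
    (goodsAt M R).card = R.card := by
  rw [← Finset.card_image_of_injOn ((rank_injOn M).mono (goodsAt_subset M R))]
  congr 1
  ext p
  simp only [Finset.mem_image, mem_goodsAt]
  constructor
  · rintro ⟨g, hg, rfl⟩; exact hg.2
  · intro hp
    obtain ⟨h1, h2⟩ := Finset.mem_Icc.1 (hR hp)
    obtain ⟨g, hg, rfl⟩ := exists_rank_eq h1 h2
    exact ⟨g, ⟨hg, hp⟩, rfl⟩

/-- The value of the good in position `p`; it is `0` if there is no such good. -/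
noncomputable def posVal (u : Fin m → ℝ) (M : Finset (Fin m)) (p : ℕ) : ℝ :=
  value u (goodsAt M {p})

theorem goodsAt_rank {M : Finset (Fin m)} {g : Fin m} (hg : g ∈ M) :
    goodsAt M {rank M g} = {g} := by
  ext h
  simp only [mem_goodsAt, Finset.mem_singleton]
  exact ⟨fun hh => rank_injOn M hh.1 hg hh.2, fun hh => by subst hh; exact ⟨hg, rfl⟩⟩

theorem posVal_rank (u : Fin m → ℝ) {M : Finset (Fin m)} {g : Fin m} (hg : g ∈ M) :
    posVal u M (rank M g) = u g := by
  rw [posVal, goodsAt_rank hg, value, Finset.sum_singleton]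

theorem goodsAt_singleton_of_lt {M : Finset (Fin m)} {p : ℕ} (hp : M.card < p) :
    goodsAt M {p} = ∅ := by
  refine Finset.filter_eq_empty_iff.2 fun g _ h => ?_
  have := rank_le_card M g
  rw [Finset.mem_singleton] at h
  omega

theorem posVal_of_card_lt (u : Fin m → ℝ) {M : Finset (Fin m)} {p : ℕ} (hp : M.card < p) :
    posVal u M p = 0 := by
  rw [posVal, goodsAt_singleton_of_lt hp, value, Finset.sum_empty]

theorem value_goodsAt (u : Fin m → ℝ) (M : Finset (Fin m)) (R : Finset ℕ) :
    value u (goodsAt M R) = ∑ p ∈ R, posVal u M p := by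
  have : goodsAt M R = R.biUnion fun p => goodsAt M {p} := by
    ext g
    simp only [mem_goodsAt, Finset.mem_biUnion, Finset.mem_singleton]
    exact ⟨fun h => ⟨_, h.2, h.1, rfl⟩, by rintro ⟨p, hp, hg, rfl⟩; exact ⟨hg, hp⟩⟩
  rw [this, value, Finset.sum_biUnion]
  · rfl
  · intro p _ q _ hpq
    exact goodsAt_disjoint (by simpa using hpq)

theorem value_nonneg {u : Fin m → ℝ} {M : Finset (Fin m)} (h : ∀ g ∈ M, 0 ≤ u g) :
    0 ≤ value u M := Finset.sum_nonneg h

theorem value_mono {u : Fin m → ℝ} {M S : Finset (Fin m)} (h : ∀ g ∈ M, 0 ≤ u g) (hS : S ⊆ M) :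
    value u S ≤ value u M :=
  Finset.sum_le_sum_of_subset_of_nonneg hS fun g hg _ => h g hg

theorem value_sdiff (u : Fin m → ℝ) {M S : Finset (Fin m)} (hS : S ⊆ M) :
    value u (M \ S) = value u M - value u S :=
  eq_sub_of_add_eq (Finset.sum_sdiff hS)

theorem value_union (u : Fin m → ℝ) {S T : Finset (Fin m)} (h : Disjoint S T) :
    value u (S ∪ T) = value u S + value u T := Finset.sum_union h

/-- `u` is nonnegative and weakly decreasing on `M`. -/
structure OrderedOn (u : Fin m → ℝ) (M : Finset (Fin m)) : Prop where
  anti : AntitoneOn u M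
  nonneg : ∀ g ∈ M, 0 ≤ u g

theorem OrderedOn.mono {u : Fin m → ℝ} {M S : Finset (Fin m)} (h : OrderedOn u M) (hS : S ⊆ M) :
    OrderedOn u S :=
  ⟨h.anti.mono (by exact_mod_cast hS), fun g hg => h.nonneg g (hS hg)⟩

theorem OrderedOn.comp {u : Fin m → ℝ} {M : Finset (Fin m)} (h : OrderedOn u M) {w : ℝ → ℝ}
    (hw : MonotoneOn w (Set.Ici 0)) (hw0 : ∀ v, 0 ≤ v → 0 ≤ w v) : OrderedOn (fun g => w (u g)) M :=
  ⟨fun _ ha _ hb hab => hw (h.nonneg _ hb) (h.nonneg _ ha) (h.anti ha hb hab),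
    fun g hg => hw0 _ (h.nonneg g hg)⟩

theorem posVal_comp {u : Fin m → ℝ} {M : Finset (Fin m)} {w : ℝ → ℝ} (hw : w 0 = 0) {p : ℕ}
    (hp : 1 ≤ p) : posVal (fun g => w (u g)) M p = w (posVal u M p) := by
  by_cases hpc : p ≤ M.card
  · obtain ⟨g, hg, rfl⟩ := exists_rank_eq hp hpc
    rw [posVal_rank _ hg, posVal_rank _ hg]
  · rw [posVal_of_card_lt _ (not_le.1 hpc), posVal_of_card_lt _ (not_le.1 hpc), hw]

variable {u : Fin m → ℝ} {M : Finset (Fin m)}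

theorem OrderedOn.posVal_nonneg (h : OrderedOn u M) (p : ℕ) : 0 ≤ posVal u M p :=
  value_nonneg fun g hg => h.nonneg g (goodsAt_subset _ _ hg)

theorem OrderedOn.posVal_anti (h : OrderedOn u M) {p q : ℕ} (hp : 1 ≤ p) (hpq : p ≤ q) :
    posVal u M q ≤ posVal u M p := by
  by_cases hq : q ≤ M.card
  · obtain ⟨a, ha, rfl⟩ := exists_rank_eq hp (hpq.trans hq)
    obtain ⟨b, hb, rfl⟩ := exists_rank_eq (hp.trans hpq) hq
    rw [posVal_rank _ ha, posVal_rank _ hb]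
    exact h.anti ha hb ((rank_le_rank_iff ha).1 hpq)
  · rw [posVal_of_card_lt _ (not_le.1 hq)]; exact h.posVal_nonneg p

theorem OrderedOn.le_posVal (h : OrderedOn u M) {g : Fin m} (hg : g ∈ M) {p : ℕ} (hp : 1 ≤ p)
    (hr : p ≤ rank M g) : u g ≤ posVal u M p := by
  rw [← posVal_rank u hg]; exact h.posVal_anti hp hr

theorem OrderedOn.posVal_le (h : OrderedOn u M) {g : Fin m} (hg : g ∈ M) {p : ℕ}
    (hr : rank M g ≤ p) : posVal u M p ≤ u g := by
  rw [← posVal_rank u hg]; exact h.posVal_anti (one_le_rank hg) hr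

theorem rank_le_of_subset {S : Finset (Fin m)} (hS : S ⊆ M) (g : Fin m) : rank S g ≤ rank M g :=
  Finset.card_le_card (Finset.filter_subset_filter _ hS)

theorem OrderedOn.posVal_subset (h : OrderedOn u M) {S : Finset (Fin m)} (hS : S ⊆ M) {p : ℕ}
    (hp : 1 ≤ p) : posVal u S p ≤ posVal u M p := by
  by_cases hpc : p ≤ S.card
  · obtain ⟨g, hg, rfl⟩ := exists_rank_eq hp hpc
    rw [posVal_rank _ hg]
    exact h.le_posVal (hS hg) hp (rank_le_of_subset hS g)
  · rw [posVal_of_card_lt _ (not_le.1 hpc)]; exact h.posVal_nonneg p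

/-- The good in position `p` is worth at least `t > 0` iff `p` goods are. -/
theorem OrderedOn.le_posVal_iff (h : OrderedOn u M) {t : ℝ} (ht : 0 < t) {p : ℕ} (hp : 1 ≤ p) :
    t ≤ posVal u M p ↔ p ≤ (M.filter fun g => t ≤ u g).card := by
  constructor
  · intro hle
    have hpc : p ≤ M.card := by
      by_contra hc
      rw [posVal_of_card_lt _ (not_le.1 hc)] at hle
      linarith
    rw [← Nat.add_sub_cancel (n := p) (m := 1), ← Nat.card_Icc 1 p,
      ← card_goodsAt (M := M) (Finset.Icc_subset_Icc_right hpc)]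
    refine Finset.card_le_card fun g hg => Finset.mem_filter.2 ⟨goodsAt_subset _ _ hg, ?_⟩
    exact hle.trans (h.posVal_le (goodsAt_subset _ _ hg) (Finset.mem_Icc.1 (mem_goodsAt.1 hg).2).2)
  · intro hle
    by_contra hlt
    have : M.filter (fun g => t ≤ u g) ⊆ goodsAt M (Finset.Icc 1 (p - 1)) := by
      intro g hg
      obtain ⟨hgM, htg⟩ := Finset.mem_filter.1 hg
      refine mem_goodsAt.2 ⟨hgM, Finset.mem_Icc.2 ⟨one_le_rank hgM, ?_⟩⟩
      by_contra hr
      exact hlt (htg.trans (h.le_posVal hgM hp (by omega)))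
    have := (Finset.card_le_card this).trans (card_goodsAt_le _ _)
    rw [Nat.card_Icc] at this
    omega

/-- Removing goods beyond position `r` does not move the first `r` goods. -/
theorem rank_sdiff_of_le {S : Finset (Fin m)} {r : ℕ} (hS : ∀ g ∈ S, g ∈ M → r < rank M g)
    {g : Fin m} (hr : rank M g ≤ r) : rank (M \ S) g = rank M g := by
  refine congrArg Finset.card (Finset.ext fun h => ?_)
  simp only [Finset.mem_filter, Finset.mem_sdiff]
  refine ⟨fun hh => ⟨hh.1.1, hh.2⟩, fun hh => ⟨⟨hh.1, fun hhS => ?_⟩, hh.2⟩⟩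
  have h1 := hS h hhS hh.1
  have h2 := rank_mono M hh.2
  omega

theorem lt_rank_sdiff {S : Finset (Fin m)} {r : ℕ} (hS : ∀ g ∈ S, g ∈ M → r < rank M g)
    {g : Fin m} (hg : g ∈ M) (hr : r < rank M g) : r < rank (M \ S) g ∨ g ∈ S := by
  by_cases hgS : g ∈ S
  · exact Or.inr hgS
  left
  have hrc : r ≤ M.card := hr.le.trans (rank_le_card M g)
  rcases Nat.eq_zero_or_pos r with rfl | hr0
  · exact one_le_rank (Finset.mem_sdiff.2 ⟨hg, hgS⟩)
  · obtain ⟨a, ha, har⟩ := exists_rank_eq hr0 hrc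
    have : a < g := by
      by_contra hc
      have := rank_mono M (not_lt.1 hc); omega
    rw [← har, ← rank_sdiff_of_le hS har.le]
    exact rank_lt_rank (Finset.mem_sdiff.2 ⟨hg, hgS⟩) this

theorem goodsAt_sdiff_of_le {S : Finset (Fin m)} {r : ℕ} (hS : ∀ g ∈ S, g ∈ M → r < rank M g)
    {R : Finset ℕ} (hR : ∀ p ∈ R, p ≤ r) : goodsAt (M \ S) R = goodsAt M R := by
  ext g
  simp only [mem_goodsAt, Finset.mem_sdiff]
  constructor
  · rintro ⟨⟨hg, hgS⟩, hgR⟩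
    have hle := hR _ hgR
    by_cases hr : rank M g ≤ r
    · rw [rank_sdiff_of_le hS hr] at hgR; exact ⟨hg, hgR⟩
    · rcases lt_rank_sdiff hS hg (not_le.1 hr) with h | h
      · omega
      · exact absurd h hgS
  · rintro ⟨hg, hgR⟩
    have hle := hR _ hgR
    refine ⟨⟨hg, fun hgS => ?_⟩, by rwa [rank_sdiff_of_le hS hle]⟩
    have := hS g hgS hg; omega

/-- Removing the first `r` goods moves the others by `r` positions. -/
theorem rank_sdiff_prefix {r : ℕ} (hr : r ≤ M.card) {g : Fin m}
    (hg : r < rank M g) : rank (M \ goodsAt M (Finset.Icc 1 r)) g + r = rank M g := by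
  have hsub : goodsAt M (Finset.Icc 1 r) ⊆ M.filter (· ≤ g) := by
    intro h hh
    obtain ⟨hM, hR⟩ := mem_goodsAt.1 hh
    refine Finset.mem_filter.2 ⟨hM, ?_⟩
    refine (rank_le_rank_iff hM).1 ?_
    have := (Finset.mem_Icc.1 hR).2; omega
  have h1 : (M \ goodsAt M (Finset.Icc 1 r)).filter (· ≤ g)
      = M.filter (· ≤ g) \ goodsAt M (Finset.Icc 1 r) := by
    ext h; simp only [Finset.mem_filter, Finset.mem_sdiff]; tauto
  have h2 := Finset.card_sdiff_add_card_eq_card hsub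
  rw [card_goodsAt (Finset.Icc_subset_Icc_right hr), Nat.card_Icc, ← h1] at h2
  simpa [rank] using h2

theorem goodsAt_eq_of_subset_singleton {p : ℕ} (hp : 1 ≤ p) (hpc : p ≤ M.card) :
    ∃ g ∈ M, rank M g = p ∧ goodsAt M {p} = {g} := by
  obtain ⟨g, hg, rfl⟩ := exists_rank_eq hp hpc
  exact ⟨g, hg, rfl, goodsAt_rank hg⟩

theorem posVal_sdiff_prefix (u : Fin m → ℝ) {r : ℕ} (hr : r ≤ M.card) {p : ℕ} (hp : 1 ≤ p) :
    posVal u (M \ goodsAt M (Finset.Icc 1 r)) p = posVal u M (p + r) := by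
  have hcard : (M \ goodsAt M (Finset.Icc 1 r)).card + r = M.card := by
    have := Finset.card_sdiff_add_card_eq_card (goodsAt_subset M (Finset.Icc 1 r))
    rwa [card_goodsAt (Finset.Icc_subset_Icc_right hr), Nat.card_Icc, Nat.add_sub_cancel] at this
  by_cases hpc : p + r ≤ M.card
  · obtain ⟨g, hg, hgr⟩ := exists_rank_eq (M := M) (show 1 ≤ p + r by omega) hpc
    have hg' : g ∈ M \ goodsAt M (Finset.Icc 1 r) :=
      Finset.mem_sdiff.2 ⟨hg, fun h => by
        have := (Finset.mem_Icc.1 (mem_goodsAt.1 h).2).2; omega⟩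
    have h1 := rank_sdiff_prefix hr (show r < rank M g by omega)
    have h2 : rank (M \ goodsAt M (Finset.Icc 1 r)) g = p := by omega
    rw [← h2, posVal_rank _ hg', ← posVal_rank u hg, hgr, h2]
  · rw [posVal_of_card_lt _ (not_le.1 hpc), posVal_of_card_lt]
    omega

theorem value_eq_sum_posVal (u : Fin m → ℝ) (M : Finset (Fin m)) :
    value u M = ∑ p ∈ Finset.Icc 1 M.card, posVal u M p := by
  rw [← value_goodsAt]
  congr 1
  ext g
  rw [mem_goodsAt, Finset.mem_Icc]
  exact ⟨fun h => ⟨h, one_le_rank h, rank_le_card M g⟩, fun h => h.1⟩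

end Positions


/-! ### Maximin shares as families of bundles above a threshold. -/

section MaximinShare

variable {m : ℕ}

/-- `d` of the bundles of some partition of goods of `M` are worth at least `θ`. -/
def HasParts (u : Fin m → ℝ) (M : Finset (Fin m)) (d : ℕ) (θ : ℝ) : Prop :=
  ∃ (P : Fin m → ℕ) (K : Finset ℕ), K.card = d ∧
    ∀ j ∈ K, θ ≤ value u (M.filter fun g => P g = j)

theorem HasParts.mono_card {u : Fin m → ℝ} {M : Finset (Fin m)} {d d' : ℕ} {θ : ℝ}
    (h : HasParts u M d θ) (hd : d' ≤ d) : HasParts u M d' θ := by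
  obtain ⟨P, K, hK, hP⟩ := h
  obtain ⟨K', hK', hcard⟩ := Finset.exists_subset_card_eq (hK ▸ hd)
  exact ⟨P, K', hcard, fun j hj => hP j (hK' hj)⟩

theorem HasParts.mono_value {u u' : Fin m → ℝ} {M : Finset (Fin m)} {d : ℕ} {θ : ℝ}
    (h : HasParts u M d θ) (hu : ∀ g ∈ M, u g ≤ u' g) : HasParts u' M d θ := by
  obtain ⟨P, K, hK, hP⟩ := h
  exact ⟨P, K, hK, fun j hj => (hP j hj).trans
    (Finset.sum_le_sum fun g hg => hu g (Finset.mem_filter.1 hg).1)⟩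

theorem minBundle_le {d : ℕ} (u : Fin m → ℝ) (M : Finset (Fin m)) (P : Fin m → Fin d)
    (j : Fin d) : minBundle u M P ≤ value u (bundle M P j) :=
  ciInf_le (Set.finite_range _).bddBelow j

theorem exists_minBundle_eq_mms (u : Fin m → ℝ) {d : ℕ} (hd : 0 < d) (M : Finset (Fin m)) :
    ∃ P : Fin m → Fin d, minBundle u M P = mms u d M := by
  have : Nonempty (Fin d) := ⟨⟨0, hd⟩⟩
  exact exists_eq_ciSup_of_finite

theorem hasParts_mms (u : Fin m → ℝ) {d : ℕ} (hd : 0 < d) (M : Finset (Fin m)) :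
    HasParts u M d (mms u d M) := by
  obtain ⟨P, hP⟩ := exists_minBundle_eq_mms u hd M
  refine ⟨fun g => P g, Finset.range d, Finset.card_range d, fun j hj => ?_⟩
  rw [← hP]
  convert minBundle_le u M P ⟨j, Finset.mem_range.1 hj⟩ using 2
  ext g
  simp only [bundle, Finset.mem_filter, Fin.ext_iff]

/-- Goods with a label outside `K` are put into bundle 0, which does no harm as values are
nonnegative. This turns the flexible labels of `HasParts` back into an honest partition. -/
theorem HasParts.le_mms {u : Fin m → ℝ} {d : ℕ} (hd : 0 < d) {M : Finset (Fin m)} {θ : ℝ}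
    (hu : ∀ g ∈ M, 0 ≤ u g) (h : HasParts u M d θ) : θ ≤ mms u d M := by
  obtain ⟨P, K, hK, hP⟩ := h
  have : Nonempty (Fin d) := ⟨⟨0, hd⟩⟩
  let e : K ≃ Fin d := K.equivFinOfCardEq hK
  let P' : Fin m → Fin d := fun g => if h : P g ∈ K then e ⟨P g, h⟩ else ⟨0, hd⟩
  refine le_trans ?_ (le_ciSup (Set.finite_range _).bddAbove P')
  refine le_ciInf fun j => (hP (e.symm j) (e.symm j).2).trans ?_
  refine value_mono (fun g hg => hu g (Finset.mem_filter.1 hg).1) fun g hg => ?_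
  obtain ⟨hgM, hgP⟩ := Finset.mem_filter.1 hg
  refine Finset.mem_filter.2 ⟨hgM, ?_⟩
  have hmem : P g ∈ K := hgP ▸ (e.symm j).2
  have : (⟨P g, hmem⟩ : K) = e.symm j := Subtype.ext hgP
  simp only [P', dif_pos hmem, this, Equiv.apply_symm_apply]

theorem value_comp_perm {u u' : Fin m → ℝ} {M : Finset (Fin m)} {σ : Fin m → Fin m}
    (hσ : Set.BijOn σ M M) (hu : ∀ g ∈ M, u' g = u (σ g)) (p : Fin m → Prop) [DecidablePred p] :
    value u' (M.filter fun g => p (σ g)) = value u (M.filter p) := by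
  refine Finset.sum_nbij σ (fun g hg => ?_) (fun a ha b hb h => ?_) (fun b hb => ?_) fun g hg => ?_
  · obtain ⟨h1, h2⟩ := Finset.mem_filter.1 hg
    exact Finset.mem_filter.2 ⟨hσ.mapsTo h1, h2⟩
  · exact hσ.injOn (Finset.mem_filter.1 (Finset.mem_coe.1 ha)).1
      (Finset.mem_filter.1 (Finset.mem_coe.1 hb)).1 h
  · obtain ⟨h1, h2⟩ := Finset.mem_filter.1 (Finset.mem_coe.1 hb)
    obtain ⟨a, ha, rfl⟩ := hσ.surjOn h1
    exact ⟨a, Finset.mem_coe.2 (Finset.mem_filter.2 ⟨ha, h2⟩), rfl⟩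
  · exact hu g (Finset.mem_filter.1 hg).1

theorem HasParts.comp_perm {u u' : Fin m → ℝ} {M : Finset (Fin m)} {σ : Fin m → Fin m}
    (hσ : Set.BijOn σ M M) (hu : ∀ g ∈ M, u' g = u (σ g)) {d : ℕ} {θ : ℝ}
    (h : HasParts u M d θ) : HasParts u' M d θ := by
  obtain ⟨P, K, hK, hP⟩ := h
  refine ⟨fun g => P (σ g), K, hK, fun j hj => ?_⟩
  rw [value_comp_perm hσ hu fun g => P g = j]
  exact hP j hj

end MaximinShare

/-! ### Ordering an instance, and translating allocations back by picking. -/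

namespace Instance

variable {n m : ℕ} (I : Instance n m)

/-- Ordering permutes the values of every agent. -/
theorem exists_perm_order (i : Fin n) : ∃ σ : Fin m → Fin m, Set.BijOn σ I.goods I.goods ∧
    (∀ g ∈ I.goods, I.order.val i g = I.val i (σ g)) ∧
    AntitoneOn (I.order.val i) (I.goods : Set (Fin m)) := by
  classical
  let r : Fin m → Fin m → Prop := fun a b => I.val i a ≥ I.val i b
  have : Std.Total r := ⟨fun a b => le_total _ _⟩
  have : IsTrans (Fin m) r := ⟨fun a b c hab hbc => le_trans hbc hab⟩
  let l := I.goods.toList.insertionSort r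
  have hlp : l.Perm I.goods.toList := List.perm_insertionSort r _
  have hl : l.Pairwise r := List.pairwise_insertionSort r _
  -- Both lists are sorted and are permutations of each other, hence equal, however ties between
  -- goods were broken in `l`.
  have hlm : ((I.goods.val.map (I.val i)).sort (fun a b => a ≥ b)) = l.map (I.val i) := by
    refine List.Perm.eq_of_pairwise' (r := fun a b : ℝ => a ≥ b) (Multiset.pairwise_sort _ _)
      (List.pairwise_map.2 hl) ?_
    rw [← Multiset.coe_eq_coe, Multiset.sort_eq, ← Multiset.map_coe, Multiset.coe_eq_coe.2 hlp,
      Finset.coe_toList]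
  have hlen : l.length = I.goods.card := by rw [hlp.length_eq, Finset.length_toList]
  have hnd : l.Nodup := hlp.nodup_iff.2 I.goods.nodup_toList
  have hlt : ∀ {g}, g ∈ I.goods → rank I.goods g - 1 < l.length := fun {g} hg => by
    have := one_le_rank hg; have := rank_le_card I.goods g; omega
  have hval : ∀ g (hg : g ∈ I.goods), I.order.val i g = I.val i (l[rank I.goods g - 1]'(hlt hg)) := by
    intro g hg
    change ((I.goods.val.map (I.val i)).sort (fun a b => a ≥ b)).getD (rank I.goods g - 1) 0 = _
    rw [hlm, List.getD_eq_getElem _ _ (by rw [List.length_map]; exact hlt hg), List.getElem_map]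
  let σ : Fin m → Fin m := fun g => if hg : g ∈ I.goods then l[rank I.goods g - 1]'(hlt hg) else g
  have hσ : ∀ g (hg : g ∈ I.goods), σ g = l[rank I.goods g - 1]'(hlt hg) := fun g hg => dif_pos hg
  have hmaps : Set.MapsTo σ I.goods I.goods := by
    intro g hg
    rw [hσ g hg]
    exact Finset.mem_toList.1 (hlp.mem_iff.1 (List.getElem_mem _))
  have hinj : Set.InjOn σ I.goods := by
    intro a ha b hb hab
    rw [hσ a ha, hσ b hb, hnd.getElem_inj_iff] at hab
    refine rank_injOn _ ha hb ?_
    have := one_le_rank ha; have := one_le_rank hb; omega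
  refine ⟨σ, ⟨hmaps, hinj, Finset.surjOn_of_injOn_of_card_le σ hmaps hinj le_rfl⟩,
    fun g hg => by rw [hval g hg, hσ g hg], ?_⟩
  intro a ha b hb hab
  rw [hval a ha, hval b hb]
  rcases (rank_mono I.goods hab).eq_or_lt with h | h
  · simp only [h, le_refl]
  · have := one_le_rank ha
    exact List.pairwise_iff_getElem.1 hl _ _ (hlt ha) (hlt hb) (by omega)

theorem order_orderedOn {i : Fin n} (h : ∀ g ∈ I.goods, 0 ≤ I.val i g) :
    OrderedOn (I.order.val i) I.goods := by
  obtain ⟨σ, hσ, hval, hanti⟩ := I.exists_perm_order i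
  exact ⟨hanti, fun g hg => hval g hg ▸ h _ (hσ.mapsTo hg)⟩

theorem hasParts_order {i : Fin n} {d : ℕ} {θ : ℝ} (h : HasParts (I.val i) I.goods d θ) :
    HasParts (I.order.val i) I.goods d θ := by
  obtain ⟨σ, hσ, hval, -⟩ := I.exists_perm_order i
  exact h.comp_perm hσ hval

/-- In the ordered instance, position `p` is worth at most as much as in any ordered valuation
that dominates the original one. -/
theorem posVal_order_le {i : Fin n} (h : ∀ g ∈ I.goods, 0 ≤ I.val i g) {u : Fin m → ℝ}
    (hu : OrderedOn u I.goods) (hle : ∀ g ∈ I.goods, I.val i g ≤ u g) {p : ℕ} (hp : 1 ≤ p) :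
    posVal (I.order.val i) I.goods p ≤ posVal u I.goods p := by
  obtain ⟨σ, hσ, hval, hanti⟩ := I.exists_perm_order i
  have ho := I.order_orderedOn h
  rcases (ho.posVal_nonneg p).eq_or_lt with h0 | h0
  · rw [← h0]; exact hu.posVal_nonneg p
  -- Positions are compared by counting: `σ` injects the goods above the threshold in the ordered
  -- valuation into those above it for `u`.
  refine (hu.le_posVal_iff h0 hp).2 (((ho.le_posVal_iff h0 hp).1 le_rfl).trans ?_)
  refine Finset.card_le_card_of_injOn σ (fun g hg => ?_) fun a ha b hb hab => ?_
  · obtain ⟨h1, h2⟩ := Finset.mem_filter.1 hg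
    exact Finset.mem_coe.2 (Finset.mem_filter.2
      ⟨hσ.mapsTo h1, (hval g h1 ▸ h2).trans (hle _ (hσ.mapsTo h1))⟩)
  · exact hσ.injOn (Finset.mem_filter.1 (Finset.mem_coe.1 ha)).1
      (Finset.mem_filter.1 (Finset.mem_coe.1 hb)).1 hab

section Picking

variable {I} {A B : Alloc n m}

/-- The bundles of `A` are disjoint sets of goods of `M`. -/
structure _root_.FairDivision.IsAllocOf (N : Finset (Fin n)) (M : Finset (Fin m))
    (A : Alloc n m) : Prop where
  subset : ∀ i ∈ N, A i ⊆ M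
  disjoint : ∀ i ∈ N, ∀ j ∈ N, i ≠ j → Disjoint (A i) (A j)

/-- The strict inequality is what keeps picking alive: some good is free at every position, and even
one of the owner's `rank I.goods g` best ones. -/
theorem card_earlier_lt (hA : IsAllocOf I.agents I.goods A) {g : Fin m} (hg : g ∈ I.goods)
    (pick : Fin m → Fin m) :
    (((I.agents.biUnion A).filter (fun h => h < g)).image pick).card < rank I.goods g := by
  refine Finset.card_image_le.trans_lt (Finset.card_lt_card ⟨fun h hh => ?_, fun hsub => ?_⟩)
  · obtain ⟨h1, h2⟩ := Finset.mem_filter.1 hh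
    obtain ⟨i, hi, hiA⟩ := Finset.mem_biUnion.1 h1
    exact Finset.mem_filter.2 ⟨hA.subset i hi hiA, h2.le⟩
  · have := hsub (Finset.mem_filter.2 ⟨hg, le_rfl⟩)
    exact lt_irrefl _ (Finset.mem_filter.1 this).2

theorem exists_isPicking (hA : IsAllocOf I.agents I.goods A) : ∃ B, I.IsPicking A B := by
  classical
  have key : ∀ k : ℕ, ∃ pick : Fin m → Fin m, ∀ i ∈ I.agents, ∀ g ∈ A i, g.val < k →
      let free := I.goods \ ((I.agents.biUnion A).filter (fun h => h < g)).image pick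
      pick g ∈ free ∧ ∀ h ∈ free, I.val i h ≤ I.val i (pick g) := by
    intro k
    induction k with
    | zero => exact ⟨id, fun i _ g _ hg => absurd hg (Nat.not_lt_zero _)⟩
    | succ k ih =>
      obtain ⟨pick, hpick⟩ := ih
      by_cases hex : ∃ i ∈ I.agents, ∃ g ∈ A i, g.val = k
      · obtain ⟨i, hi, g, hg, hgk⟩ := hex
        have hgG := hA.subset i hi hg
        have hne : (I.goods \ ((I.agents.biUnion A).filter (fun h => h < g)).image pick).Nonempty := by
          rw [← Finset.card_pos]
          have h1 := card_earlier_lt hA hgG pick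
          have h2 := rank_le_card I.goods g
          have h3 := Finset.le_card_sdiff
            (((I.agents.biUnion A).filter (fun h => h < g)).image pick) I.goods
          omega
        obtain ⟨x, hx, hmax⟩ := Finset.exists_max_image _ (I.val i) hne
        -- Only picks at positions before `g'` matter for what is free at `g'`, so redefining `pick`
        -- at `g` leaves all positions up to `g` unaffected.
        have himg : ∀ g' : Fin m, g'.val ≤ k →
            ((I.agents.biUnion A).filter (fun h => h < g')).image (Function.update pick g x)
              = ((I.agents.biUnion A).filter (fun h => h < g')).image pick := by
          intro g' hg'
          refine Finset.image_congr fun h hh => Function.update_of_ne ?_ _ _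
          have : h < g' := (Finset.mem_filter.1 (Finset.mem_coe.1 hh)).2
          rintro rfl
          have := Fin.lt_def.1 this; omega
        refine ⟨Function.update pick g x, fun j hj g' hg' hlt => ?_⟩
        simp only [himg g' (by omega)]
        rcases Nat.lt_succ_iff_lt_or_eq.1 hlt with h | h
        · rw [Function.update_of_ne (by rintro rfl; omega)]
          exact hpick j hj g' hg' h
        · obtain rfl : g' = g := Fin.ext (by omega)
          obtain rfl : i = j := by
            by_contra hij
            exact Finset.disjoint_left.1 (hA.disjoint i hi j hj hij) hg hg'
          rw [Function.update_self]
          exact ⟨hx, hmax⟩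
      · refine ⟨pick, fun i hi g hg hlt => hpick i hi g hg ?_⟩
        rcases Nat.lt_succ_iff_lt_or_eq.1 hlt with h | h
        · exact h
        · exact absurd ⟨i, hi, g, hg, h⟩ hex
  obtain ⟨pick, hpick⟩ := key m
  exact ⟨fun i => if i ∈ I.agents then (A i).image pick else ∅, pick,
    fun i hi g hg => hpick i hi g hg g.2, fun i => rfl⟩

/-- When the position of `g` is reached, fewer than `rank I.goods g` goods are gone. So one of the
owner's `rank I.goods g` best goods is free, and her pick is at least as good as that one, hence
worth at least the ordered value at `g`. -/
theorem IsPicking.isAllocOf (h : I.IsPicking A B) (hA : IsAllocOf I.agents I.goods A) :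
    IsAllocOf I.agents I.goods B ∧
      ∀ i ∈ I.agents, value (I.order.val i) (A i) ≤ value (I.val i) (B i) := by
  classical
  obtain ⟨pick, hpick, hB⟩ := h
  have hmem : ∀ i ∈ I.agents, ∀ g ∈ A i, pick g ∈ I.goods := fun i hi g hg =>
    (Finset.mem_sdiff.1 (hpick i hi g hg).1).1
  have hlt : ∀ i ∈ I.agents, ∀ j ∈ I.agents, ∀ a ∈ A i, ∀ b ∈ A j, a < b → pick a ≠ pick b := by
    intro i hi j hj a ha b hb hab heq
    refine (Finset.mem_sdiff.1 (hpick j hj b hb).1).2 (Finset.mem_image.2 ⟨a, ?_, heq⟩)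
    exact Finset.mem_filter.2 ⟨Finset.mem_biUnion.2 ⟨i, hi, ha⟩, hab⟩
  have hinj : ∀ i ∈ I.agents, ∀ j ∈ I.agents, ∀ a ∈ A i, ∀ b ∈ A j, pick a = pick b → a = b := by
    intro i hi j hj a ha b hb heq
    rcases lt_trichotomy a b with hab | hab | hab
    · exact absurd heq (hlt i hi j hj a ha b hb hab)
    · exact hab
    · exact absurd heq.symm (hlt j hj i hi b hb a ha hab)
  refine ⟨⟨fun i hi => ?_, fun i hi j hj hij => ?_⟩, fun i hi => ?_⟩
  · rw [hB i, if_pos hi]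
    exact Finset.image_subset_iff.2 (hmem i hi)
  · rw [hB i, if_pos hi, hB j, if_pos hj, Finset.disjoint_left]
    intro x hx hx'
    obtain ⟨a, ha, rfl⟩ := Finset.mem_image.1 hx
    obtain ⟨b, hb, hba⟩ := Finset.mem_image.1 hx'
    have := hinj j hj i hi b hb a ha hba
    exact Finset.disjoint_left.1 (hA.disjoint i hi j hj hij) ha (this ▸ hb)
  · rw [hB i, if_pos hi, value, value, Finset.sum_image fun a ha b hb => hinj i hi i hi a ha b hb]
    refine Finset.sum_le_sum fun g hg => ?_
    obtain ⟨σ, hσ, hval, hanti⟩ := I.exists_perm_order i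
    have hgG := hA.subset i hi hg
    have hcard := card_earlier_lt hA hgG pick
    rw [rank, ← Finset.card_image_of_injOn (f := σ) (s := I.goods.filter (· ≤ g))
      (hσ.injOn.mono fun x hx => (Finset.mem_filter.1 (Finset.mem_coe.1 hx)).1)] at hcard
    obtain ⟨x, hx, hx'⟩ := Finset.exists_mem_notMem_of_card_lt_card hcard
    obtain ⟨h, hh, rfl⟩ := Finset.mem_image.1 hx
    obtain ⟨hhG, hhg⟩ := Finset.mem_filter.1 hh
    calc I.order.val i g ≤ I.order.val i h := hanti hhG hgG hhg
      _ = I.val i (σ h) := hval h hhG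
      _ ≤ I.val i (pick g) := (hpick i hi g hg).2 _
          (Finset.mem_sdiff.2 ⟨hσ.mapsTo hhG, hx'⟩)

end Picking

end Instance


/-! ### Removing goods while preserving bundles, and the rounding of values. -/

section Reductions

variable {m : ℕ} {u : Fin m → ℝ} {M : Finset (Fin m)} {d : ℕ} {θ : ℝ}

/-- Spare goods join one of the counted bundles, so that pigeonhole arguments over `K` see every
good. -/
theorem HasParts.exists_total (h : HasParts u M d θ) (hd : 0 < d) (hu : ∀ g ∈ M, 0 ≤ u g) :
    ∃ (P : Fin m → ℕ) (K : Finset ℕ), K.card = d ∧ (∀ g, P g ∈ K) ∧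
      ∀ j ∈ K, θ ≤ value u (M.filter fun g => P g = j) := by
  obtain ⟨P, K, hK, hP⟩ := h
  obtain ⟨k, hk⟩ : K.Nonempty := Finset.card_pos.1 (hK ▸ hd)
  refine ⟨fun g => if P g ∈ K then P g else k, K, hK, fun g => ?_, fun j hj => ?_⟩
  · dsimp only; split_ifs with h
    · exact h
    · exact hk
  · refine (hP j hj).trans (value_mono (fun g hg => hu g (Finset.mem_filter.1 hg).1) fun g hg => ?_)
    obtain ⟨h1, h2⟩ := Finset.mem_filter.1 hg
    refine Finset.mem_filter.2 ⟨h1, ?_⟩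
    dsimp only
    rw [if_pos (h2 ▸ hj), h2]

/-- Removing an agent together with `j + 1` consecutive goods around position `j d` keeps the
bundles of the other agents at their values. -/
theorem HasParts.remove_block (h : HasParts u M d θ) (hu : OrderedOn u M) (hd : 0 < d) (j : ℕ) :
    HasParts u (M \ goodsAt M (Finset.Icc (j * (d - 1) + 1) (j * d + 1))) (d - 1) θ := by
  classical
  set S := goodsAt M (Finset.Icc (j * (d - 1) + 1) (j * d + 1)) with hS
  have hSM : S ⊆ M := goodsAt_subset _ _
  rcases S.eq_empty_or_nonempty with hS0 | hSne
  · rw [hS0, Finset.sdiff_empty]; exact h.mono_card (Nat.sub_le _ _)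
  obtain ⟨P, K, hK, hPK, hP⟩ := h.exists_total hd hu.nonneg
  have hjd : j * d = j * (d - 1) + j := by
    obtain ⟨e, rfl⟩ : ∃ e, d = e + 1 := ⟨d - 1, by omega⟩
    simp [Nat.mul_add]
  set T := goodsAt M (Finset.Icc 1 (j * (d - 1))) with hT
  have hTS : Disjoint T S := goodsAt_disjoint (Finset.disjoint_left.2 fun p hp hp' => by
    have := (Finset.mem_Icc.1 hp).2; have := (Finset.mem_Icc.1 hp').1; omega)
  have hTcard : T.card = j * (d - 1) := by
    obtain ⟨g, hg⟩ := hSne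
    have h1 := (Finset.mem_Icc.1 (mem_goodsAt.1 hg).2).1
    have h2 := rank_le_card M g
    rw [hT, card_goodsAt (Finset.Icc_subset_Icc_right (by omega)), Nat.card_Icc, Nat.add_sub_cancel]
  have hScard : S.card ≤ j + 1 := (card_goodsAt_le _ _).trans (by rw [Nat.card_Icc]; omega)
  -- Pigeonhole: if every bundle met `T ∪ S` in at most |S| - 1 goods, then |T| + |S| ≤ d(|S| - 1),
  -- impossible because |T| = j(d - 1) and |S| ≤ j + 1. The block `S` may be shorter than j + 1 when
  -- goods run out.
  obtain ⟨k, hk, hkc⟩ : ∃ k ∈ K, S.card ≤ ((T ∪ S).filter fun g => P g = k).card := by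
    by_contra hcon
    push Not at hcon
    have h1 : (T ∪ S).card = ∑ k ∈ K, ((T ∪ S).filter fun g => P g = k).card :=
      Finset.card_eq_sum_card_fiberwise fun g _ => hPK g
    have h2 : ∑ k ∈ K, ((T ∪ S).filter fun g => P g = k).card ≤ ∑ k ∈ K, (S.card - 1) :=
      Finset.sum_le_sum fun k hk => Nat.le_sub_one_of_lt (hcon k hk)
    rw [Finset.sum_const, hK, smul_eq_mul] at h2
    rw [Finset.card_union_of_disjoint hTS, hTcard] at h1
    have h3 : 0 < S.card := hSne.card_pos
    have h4 : d * (S.card - 1) ≤ (d - 1) * j + (S.card - 1) := by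
      obtain ⟨e, rfl⟩ : ∃ e, d = e + 1 := ⟨d - 1, by omega⟩
      rw [Nat.add_sub_cancel, Nat.add_mul, Nat.one_mul]
      exact Nat.add_le_add_right (Nat.mul_le_mul_left _ (by omega)) _
    rw [Nat.mul_comm (d - 1) j] at h4
    omega
  set B := (T ∪ S).filter fun g => P g = k with hB
  have hcardle : Fintype.card ↥(S \ B) ≤ Fintype.card ↥(B \ S) := by
    rw [Fintype.card_coe, Fintype.card_coe]
    have h1 := Finset.card_sdiff_add_card_inter S B
    have h2 := Finset.card_sdiff_add_card_inter B S
    rw [Finset.inter_comm] at h2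
    omega
  -- Bundle `k` is sacrificed: each good of `S` in another bundle is replaced by its own good of `T`
  -- from bundle `k`, which is worth at least as much since `T` precedes `S`.
  obtain ⟨e⟩ := Function.Embedding.nonempty_of_card_le hcardle
  have heB : ∀ s, (e s : Fin m) ∈ B ∧ (e s : Fin m) ∉ S := fun s => Finset.mem_sdiff.1 (e s).2
  have heT : ∀ s, (e s : Fin m) ∈ T := fun s =>
    (Finset.mem_union.1 (Finset.mem_filter.1 (heB s).1).1).resolve_right (heB s).2
  have heP : ∀ s, P (e s) = k := fun s => (Finset.mem_filter.1 (heB s).1).2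
  have hue : ∀ s : ↥(S \ B), u s ≤ u (e s) := fun s => by
    have h1 := mem_goodsAt.1 (heT s)
    have h2 := mem_goodsAt.1 (Finset.mem_sdiff.1 s.2).1
    refine hu.anti h1.1 h2.1 ((rank_le_rank_iff h1.1).1 ?_)
    have := (Finset.mem_Icc.1 h1.2).2; have := (Finset.mem_Icc.1 h2.2).1; omega
  refine ⟨fun g => if h : ∃ s : ↥(S \ B), (e s : Fin m) = g then
    P ((Classical.choose h : ↥(S \ B)) : Fin m) else P g, K.erase k,
    by rw [Finset.card_erase_of_mem hk, hK], fun l hl => ?_⟩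
  obtain ⟨hlk, hlK⟩ := Finset.mem_erase.1 hl
  have hsplit : M.filter (fun g => P g = l)
      = ((M \ S).filter fun g => P g = l) ∪ S.filter fun g => P g = l := by
    ext g
    simp only [Finset.mem_filter, Finset.mem_union, Finset.mem_sdiff]
    constructor
    · rintro ⟨h1, h2⟩
      by_cases hgS : g ∈ S
      · exact Or.inr ⟨hgS, h2⟩
      · exact Or.inl ⟨⟨h1, hgS⟩, h2⟩
    · rintro (⟨⟨h1, -⟩, h2⟩ | ⟨h1, h2⟩)
      · exact ⟨h1, h2⟩
      · exact ⟨hSM h1, h2⟩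
  have hSB : ∀ g ∈ S.filter (fun g => P g = l), g ∈ S \ B := fun g hg => by
    obtain ⟨h1, h2⟩ := Finset.mem_filter.1 hg
    exact Finset.mem_sdiff.2 ⟨h1, fun hgB => hlk (h2 ▸ (Finset.mem_filter.1 hgB).2)⟩
  let f : ↥(S.filter fun g => P g = l) → Fin m := fun g => e ⟨g, hSB g g.2⟩
  have hf : Function.Injective f := fun a b hab => by
    have := e.injective (Subtype.ext hab)
    exact Subtype.ext (by simpa using this)
  have hfP : ∀ a, P (f a) = k := fun a => heP _
  calc θ ≤ value u (M.filter fun g => P g = l) := hP l hlK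
    _ = value u ((M \ S).filter fun g => P g = l) + value u (S.filter fun g => P g = l) := by
      rw [hsplit, value_union]
      exact Finset.disjoint_left.2 fun g hg hg' =>
        (Finset.mem_sdiff.1 (Finset.mem_filter.1 hg).1).2 (Finset.mem_filter.1 hg').1
    _ ≤ value u ((M \ S).filter fun g => P g = l) + value u (Finset.univ.image f) := by
      gcongr
      rw [value, value, Finset.sum_image fun a _ b _ hab => hf hab, ← Finset.sum_coe_sort]
      exact Finset.sum_le_sum fun a _ => hue ⟨a, hSB a a.2⟩
    _ = value u (((M \ S).filter fun g => P g = l) ∪ Finset.univ.image f) := by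
      rw [value_union]
      refine Finset.disjoint_left.2 fun g hg hg' => ?_
      obtain ⟨a, -, rfl⟩ := Finset.mem_image.1 hg'
      exact hlk ((Finset.mem_filter.1 hg).2.symm.trans (hfP a))
    _ ≤ _ := by
      refine value_mono (fun g hg => hu.nonneg g (Finset.mem_sdiff.1 (Finset.mem_filter.1 hg).1).1) ?_
      intro g hg
      rcases Finset.mem_union.1 hg with hg | hg
      · obtain ⟨h1, h2⟩ := Finset.mem_filter.1 hg
        refine Finset.mem_filter.2 ⟨h1, ?_⟩
        dsimp only
        rw [dif_neg, h2]
        rintro ⟨s, rfl⟩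
        exact hlk (h2.symm.trans (heP s))
      · obtain ⟨a, -, rfl⟩ := Finset.mem_image.1 hg
        have hex : ∃ s : ↥(S \ B), (e s : Fin m) = f a := ⟨_, rfl⟩
        refine Finset.mem_filter.2 ⟨Finset.mem_sdiff.2
          ⟨goodsAt_subset _ _ (heT ⟨a, hSB a a.2⟩), (heB ⟨a, hSB a a.2⟩).2⟩, ?_⟩
        dsimp only
        rw [dif_pos hex]
        have h1 : Classical.choose hex = ⟨a, hSB a a.2⟩ :=
          e.injective (Subtype.ext (Classical.choose_spec hex))
        rw [h1]
        exact (Finset.mem_filter.1 a.2).2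

/-- If the goods lie in two different counted bundles, merging these leaves at least 2θ - θ = θ.
Otherwise at most one counted bundle is damaged, and it is dropped. -/
theorem HasParts.remove_pair (h : HasParts u M d θ) (hu : ∀ g ∈ M, 0 ≤ u g)
    {a b : Fin m} (haM : a ∈ M) (hbM : b ∈ M) (hab : u a + u b ≤ θ) :
    HasParts u (M \ {a, b}) (d - 1) θ := by
  obtain ⟨P, K, hK, hP⟩ := h
  by_cases hmerge : P a ∈ K ∧ P b ∈ K ∧ P a ≠ P b
  · obtain ⟨ha, hb, hne⟩ := hmerge
    refine ⟨fun g => if P g = P a then P b else P g, K.erase (P a),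
      by rw [Finset.card_erase_of_mem ha, hK], fun l hl => ?_⟩
    obtain ⟨hla, hlK⟩ := Finset.mem_erase.1 hl
    by_cases hlb : l = P b
    · subst hlb
      have hset : (M \ {a, b}).filter (fun g => (if P g = P a then P b else P g) = P b)
          = ((M.filter fun g => P g = P a) ∪ (M.filter fun g => P g = P b)) \ {a, b} := by
        ext g
        simp only [Finset.mem_filter, Finset.mem_sdiff, Finset.mem_union]
        split_ifs with h1 <;> simp_all <;> tauto
      have hdis : Disjoint (M.filter fun g => P g = P a) (M.filter fun g => P g = P b) :=
        Finset.disjoint_left.2 fun g h1 h2 =>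
          hne ((Finset.mem_filter.1 h1).2.symm.trans (Finset.mem_filter.1 h2).2)
      have h1 := value_union u hdis
      have h2 := hP _ ha
      have h3 := hP _ hlK
      set X := (M.filter fun g => P g = P a) ∪ (M.filter fun g => P g = P b) with hX
      have hab' : a ≠ b := fun h => hne (h ▸ rfl)
      have h4 : {a, b} ⊆ X := Finset.insert_subset_iff.2
        ⟨Finset.mem_union_left _ (Finset.mem_filter.2 ⟨haM, rfl⟩),
          Finset.singleton_subset_iff.2 (Finset.mem_union_right _ (Finset.mem_filter.2 ⟨hbM, rfl⟩))⟩
      have h5 := value_sdiff u h4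
      have h6 : value u {a, b} = u a + u b := Finset.sum_pair hab'
      rw [hset]; linarith
    · refine (hP l hlK).trans (value_mono
        (fun g hg => hu g (Finset.mem_sdiff.1 (Finset.mem_filter.1 hg).1).1) fun g hg => ?_)
      obtain ⟨h1, h2⟩ := Finset.mem_filter.1 hg
      refine Finset.mem_filter.2 ⟨Finset.mem_sdiff.2 ⟨h1, ?_⟩, ?_⟩
      · intro h
        rcases Finset.mem_insert.1 h with rfl | h
        · exact hla h2.symm
        · rw [Finset.mem_singleton] at h; subst h; exact hlb h2.symm
      · dsimp only
        rw [if_neg (by rw [h2]; exact hla), h2]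
  · have hcard : d - 1 ≤ (K \ {P a, P b}).card := by
      have h1 := Finset.card_sdiff_add_card_inter K {P a, P b}
      have h2 : (K ∩ {P a, P b}).card ≤ 1 := by
        rw [Finset.card_le_one]
        intro x hx y hy
        simp only [Finset.mem_inter, Finset.mem_insert, Finset.mem_singleton] at hx hy
        grind
      omega
    refine HasParts.mono_card ⟨P, K \ {P a, P b}, rfl, fun l hl => ?_⟩ hcard
    obtain ⟨hlK, hl2⟩ := Finset.mem_sdiff.1 hl
    refine (hP l hlK).trans (value_mono
        (fun g hg => hu g (Finset.mem_sdiff.1 (Finset.mem_filter.1 hg).1).1) fun g hg => ?_)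
    obtain ⟨h1, h2⟩ := Finset.mem_filter.1 hg
    refine Finset.mem_filter.2 ⟨Finset.mem_sdiff.2 ⟨h1, fun h => hl2 ?_⟩, h2⟩
    simp only [Finset.mem_insert, Finset.mem_singleton] at h ⊢
    rcases h with rfl | rfl
    · exact Or.inl h2.symm
    · exact Or.inr h2.symm

/-- The rounding of values that makes the rules `R₁, …, R₄` valid. -/
noncomputable def trunc (v : ℝ) : ℝ :=
  if v ≤ 239 / 959 then v else if v ≤ 240 / 959 then 239 / 959 else if v < 717 / 959 then v else
    if v < 720 / 959 then 717 / 959 else 956 / 959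

theorem trunc_monotone : Monotone trunc := by
  intro a b hab
  unfold trunc
  split_ifs <;> linarith

theorem trunc_zero : trunc 0 = 0 := by norm_num [trunc]

theorem trunc_nonneg {v : ℝ} (hv : 0 ≤ v) : 0 ≤ trunc v := by
  rw [← trunc_zero]; exact trunc_monotone hv

theorem trunc_le {v : ℝ} (hv : v < 720 / 959) : trunc v ≤ v := by
  unfold trunc
  split_ifs <;> linarith

/-- The numbers 239/959 and 717/959 are one and three quarters of 956/959, while 240/959 and 720/959
are one third of and the whole of the largest admissible `α`. A good of value at least 720/959 is
rounded up to the full 956/959. A good between 717/959 and 720/959 keeps 717/959, and the rest of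
the bundle is worth more than 239/959 and keeps that much. In all other cases only the goods between
239/959 and 240/959 lose anything. -/
theorem le_sum_trunc {S : Finset (Fin m)} (hu : ∀ g ∈ S, 0 ≤ u g) (h1 : 1 ≤ value u S) :
    956 / 959 ≤ value (fun g => trunc (u g)) S := by
  have hnn : ∀ g ∈ S, 0 ≤ trunc (u g) := fun g hg => trunc_nonneg (hu g hg)
  by_cases hbig : ∃ g ∈ S, 717 / 959 ≤ u g
  · obtain ⟨g, hg, hug⟩ := hbig
    by_cases hvb : 720 / 959 ≤ u g
    · refine le_trans (le_of_eq ?_) (Finset.single_le_sum hnn hg)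
      unfold trunc
      rw [if_neg (by linarith), if_neg (by linarith), if_neg (by linarith), if_neg (by linarith)]
    · have h2 : trunc (u g) = 717 / 959 := by
        unfold trunc
        rw [if_neg (by linarith), if_neg (by linarith), if_neg (by linarith), if_pos (by linarith)]
      rw [value, ← Finset.add_sum_erase S _ hg, h2]
      rw [value, ← Finset.add_sum_erase S _ hg] at h1
      have h3 : 239 / 959 ≤ ∑ x ∈ S.erase g, trunc (u x) := by
        by_cases hmid : ∃ a ∈ S.erase g, 239 / 959 ≤ u a
        · obtain ⟨a, ha, hua⟩ := hmid
          refine le_trans ?_ (Finset.single_le_sum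
            (fun x hx => hnn x (Finset.mem_of_mem_erase hx)) ha)
          have : trunc (239 / 959) = 239 / 959 := by norm_num [trunc]
          exact this ▸ trunc_monotone hua
        · push Not at hmid
          have : ∑ x ∈ S.erase g, trunc (u x) = ∑ x ∈ S.erase g, u x :=
            Finset.sum_congr rfl fun x hx => if_pos (hmid x hx).le
          rw [this]; linarith
      linarith
  · push Not at hbig
    -- Each good of `C` loses at most 1/959. Up to three of them lose at most 3/959, and four of
    -- them already keep 4 · 239/959 = 956/959.
    set C := S.filter fun g => 239 / 959 < u g ∧ u g ≤ 240 / 959 with hC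
    by_cases hc : 4 ≤ C.card
    · have h2 : ∀ g ∈ C, 239 / 959 ≤ trunc (u g) := fun g hg => by
        obtain ⟨-, h3, h4⟩ := Finset.mem_filter.1 hg
        unfold trunc
        rw [if_neg (by linarith), if_pos h4]
      have h3 := Finset.card_nsmul_le_sum C _ _ h2
      have h4 : ∑ g ∈ C, trunc (u g) ≤ value (fun g => trunc (u g)) S :=
        value_mono hnn (Finset.filter_subset _ _)
      have h5 : (4 : ℝ) ≤ C.card := by exact_mod_cast hc
      rw [nsmul_eq_mul] at h3
      linarith
    · have h2 : ∀ g ∈ S, u g ≤ trunc (u g) + if g ∈ C then 1 / 959 else 0 := fun g hg => by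
        have h3 := hbig g hg
        unfold trunc
        split_ifs
        all_goals first
          | linarith
          | exact absurd (Finset.mem_filter.2 ⟨hg, lt_of_not_ge ‹_›, ‹_›⟩ : g ∈ C) ‹g ∉ C›
      have h3 := Finset.sum_le_sum h2
      rw [Finset.sum_add_distrib, Finset.sum_ite_mem, Finset.sum_const, nsmul_eq_mul,
        Finset.inter_eq_right.2 (Finset.filter_subset _ _)] at h3
      have h5 : (C.card : ℝ) ≤ 3 := by exact_mod_cast (by omega : C.card ≤ 3)
      change value u S ≤ value (fun g => trunc (u g)) S + _ at h3
      linarith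

end Reductions

/-! ### Extending a partial allocation by one bundle. -/

section Allocations

variable {n m : ℕ}

theorem IsAllocOf.update {N₀ N : Finset (Fin n)} {M₀ M : Finset (Fin m)} {A : Alloc n m}
    (h : IsAllocOf (N₀ \ N) (M₀ \ M) A) {i : Fin n} {S : Finset (Fin m)} (hS : S ⊆ M)
    (hM : M ⊆ M₀) :
    IsAllocOf (N₀ \ N.erase i) (M₀ \ (M \ S)) (Function.update A i S) := by
  have hmem : ∀ a ∈ N₀ \ N.erase i, a ≠ i → a ∈ N₀ \ N := fun a ha hai => by
    simp only [Finset.mem_sdiff, Finset.mem_erase, not_and] at ha ⊢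
    exact ⟨ha.1, fun h' => ha.2 hai h'⟩
  have hdis : ∀ a ∈ N₀ \ N.erase i, a ≠ i → Disjoint (A a) S := fun a ha hai =>
    Finset.disjoint_left.2 fun g hg hgS =>
      (Finset.mem_sdiff.1 (h.subset a (hmem a ha hai) hg)).2 (hS hgS)
  refine ⟨fun a ha => ?_, fun a ha b hb hab => ?_⟩
  · by_cases hai : a = i
    · subst hai
      rw [Function.update_self]
      exact fun g hg => Finset.mem_sdiff.2 ⟨hM (hS hg), fun h' => (Finset.mem_sdiff.1 h').2 hg⟩
    · rw [Function.update_of_ne hai]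
      exact (h.subset a (hmem a ha hai)).trans
        (Finset.sdiff_subset_sdiff le_rfl Finset.sdiff_subset)
  · by_cases hai : a = i
    · subst hai
      rw [Function.update_self, Function.update_of_ne (Ne.symm hab)]
      exact (hdis b hb (Ne.symm hab)).symm
    · rw [Function.update_of_ne hai]
      by_cases hbi : b = i
      · subst hbi
        rw [Function.update_self]; exact hdis a ha hai
      · rw [Function.update_of_ne hbi]
        exact h.disjoint a (hmem a ha hai) b (hmem b hb hbi) hab

theorem worth_update {N₀ N : Finset (Fin n)} {A : Alloc n m} {v : Fin n → Fin m → ℝ} {β : ℝ}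
    (h : ∀ a ∈ N₀ \ N, β ≤ value (v a) (A a)) {i : Fin n} {S : Finset (Fin m)}
    (hi : β ≤ value (v i) S) :
    ∀ a ∈ N₀ \ N.erase i, β ≤ value (v a) (Function.update A i S a) := by
  intro a ha
  by_cases hai : a = i
  · subst hai; rwa [Function.update_self]
  · rw [Function.update_of_ne hai]
    refine h a ?_
    simp only [Finset.mem_sdiff, Finset.mem_erase, not_and] at ha ⊢
    exact ⟨ha.1, fun h' => ha.2 hai h'⟩

end Allocations

/-! ### The reduction rules preserve rounded shares. -/

section Rules

variable {n m : ℕ} (J : Instance n m) (u : Fin m → ℝ)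

theorem value_ruleGoods_one : value u (J.ruleGoods 1) = posVal u J.goods 1 := rfl

theorem value_ruleGoods_two (h : 0 < J.agents.card) :
    value u (J.ruleGoods 2) = posVal u J.goods (2 * J.agents.card - 1)
      + posVal u J.goods (2 * J.agents.card) + posVal u J.goods (2 * J.agents.card + 1) := by
  rw [Instance.ruleGoods, value_goodsAt, Finset.sum_insert, Finset.sum_pair, add_assoc]
  · omega
  · simp only [Finset.mem_insert, Finset.mem_singleton]; omega

theorem value_ruleGoods_three (h : 0 < J.agents.card) :
    value u (J.ruleGoods 3) = posVal u J.goods (3 * J.agents.card - 2)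
      + posVal u J.goods (3 * J.agents.card - 1)
      + posVal u J.goods (3 * J.agents.card) + posVal u J.goods (3 * J.agents.card + 1) := by
  rw [Instance.ruleGoods, value_goodsAt, Finset.sum_insert, Finset.sum_insert, Finset.sum_pair,
    add_assoc, add_assoc]
  · omega
  · simp only [Finset.mem_insert, Finset.mem_singleton]; omega
  · simp only [Finset.mem_insert, Finset.mem_singleton]; omega

theorem value_ruleGoods_four (h : 0 < J.agents.card) :
    value u (J.ruleGoods 4) = posVal u J.goods 1 + posVal u J.goods (2 * J.agents.card + 1) := by
  rw [Instance.ruleGoods, value_goodsAt, Finset.sum_pair]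
  omega

theorem value_ruleGoods_five :
    value u (J.ruleGoods 5) = posVal u J.goods 1 + posVal u J.goods 2 := by
  rw [Instance.ruleGoods, value_goodsAt, Finset.sum_pair]
  omega

theorem ruleGoods_subset (k : ℕ) : J.ruleGoods k ⊆ J.goods := by
  unfold Instance.ruleGoods
  split
  all_goals first | exact goodsAt_subset _ _ | exact Finset.empty_subset _

theorem ruleGoods_two_eq (h : 0 < J.agents.card) : J.ruleGoods 2 =
    goodsAt J.goods (Finset.Icc (2 * (J.agents.card - 1) + 1) (2 * J.agents.card + 1)) := by
  rw [Instance.ruleGoods]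
  congr 1
  ext p
  simp only [Finset.mem_insert, Finset.mem_singleton, Finset.mem_Icc]
  omega

theorem ruleGoods_three_eq (h : 0 < J.agents.card) : J.ruleGoods 3 =
    goodsAt J.goods (Finset.Icc (3 * (J.agents.card - 1) + 1) (3 * J.agents.card + 1)) := by
  rw [Instance.ruleGoods]
  congr 1
  ext p
  simp only [Finset.mem_insert, Finset.mem_singleton, Finset.mem_Icc]
  omega

/-- The rules `R₁, …, R₄`, applied in this order, preserve the rounded maximin shares. -/
theorem HasParts.remove_ruleGoods {k : ℕ} (hk : k ∈ Finset.Icc 1 4) {α : ℝ} (hα : α ≤ 720 / 959)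
    {i : Fin n} (hi : i ∈ J.agents) (hu : OrderedOn (J.val i) J.goods)
    (hmin : ∀ l ∈ Finset.Ico 1 k, ¬ J.Applicable α l)
    (h : HasParts (fun g => trunc (J.val i g)) J.goods J.agents.card (956 / 959)) :
    HasParts (fun g => trunc (J.val i g)) (J.goods \ J.ruleGoods k) (J.agents.card - 1)
      (956 / 959) := by
  have hc : 0 < J.agents.card := Finset.card_pos.2 ⟨i, hi⟩
  have ho : OrderedOn (fun g => trunc (J.val i g)) J.goods :=
    hu.comp (trunc_monotone.monotoneOn _) fun v hv => trunc_nonneg hv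
  obtain ⟨hk1, hk4⟩ := Finset.mem_Icc.1 hk
  have hone : HasParts (fun g => trunc (J.val i g)) (J.goods \ goodsAt J.goods {1})
      (J.agents.card - 1) (956 / 959) := by
    simpa using h.remove_block ho hc 0
  interval_cases k
  · exact hone
  · rw [ruleGoods_two_eq J hc]; exact h.remove_block ho hc 2
  · rw [ruleGoods_three_eq J hc]; exact h.remove_block ho hc 3
  · by_cases hcard : 2 * J.agents.card + 1 ≤ J.goods.card
    · obtain ⟨a, ha, har, hag⟩ := goodsAt_eq_of_subset_singleton (M := J.goods) le_rfl
        (show 1 ≤ J.goods.card by omega)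
      obtain ⟨b, hb, hbr, hbg⟩ := goodsAt_eq_of_subset_singleton (M := J.goods)
        (show 1 ≤ 2 * J.agents.card + 1 by omega) hcard
      have hset : J.ruleGoods 4 = {a, b} := by
        rw [Instance.ruleGoods]
        ext g
        simp only [mem_goodsAt, Finset.mem_insert, Finset.mem_singleton]
        constructor
        · rintro ⟨hg, h1 | h1⟩
          · exact Or.inl (rank_injOn _ hg ha (h1.trans har.symm))
          · exact Or.inr (rank_injOn _ hg hb (h1.trans hbr.symm))
        · rintro (rfl | rfl)
          · exact ⟨ha, Or.inl har⟩
          · exact ⟨hb, Or.inr hbr⟩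
      have h1 : J.val i a < 720 / 959 := by
        have h2 := hmin 1 (by simp)
        simp only [Instance.Applicable, not_exists, not_and, not_le] at h2
        have h3 := h2 i hi
        rw [value_ruleGoods_one, ← har, posVal_rank _ ha] at h3
        linarith
      have h2 : J.val i b ≤ 240 / 959 := by
        have h2 := hmin 2 (by simp)
        simp only [Instance.Applicable, not_exists, not_and, not_le] at h2
        have h3 := h2 i hi
        rw [value_ruleGoods_two _ _ hc] at h3
        have h4 := hu.posVal_anti (show 1 ≤ 2 * J.agents.card - 1 by omega)
          (show 2 * J.agents.card - 1 ≤ 2 * J.agents.card + 1 by omega)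
        have h5 := hu.posVal_anti (show 1 ≤ 2 * J.agents.card by omega)
          (show 2 * J.agents.card ≤ 2 * J.agents.card + 1 by omega)
        rw [← hbr, posVal_rank _ hb] at h3 h4 h5
        linarith
      rw [hset]
      refine h.remove_pair ho.nonneg ha hb ?_
      -- R₁ and R₂ not being applicable bounds the two goods by 720/959 and a third of it. Rounding
      -- brings these bounds down to 717/959 and 239/959, whose sum is exactly the threshold in
      -- `HasParts.remove_pair`.
      have h3 : trunc (J.val i a) ≤ 717 / 959 := by
        unfold trunc; split_ifs <;> linarith
      have h4 : trunc (J.val i b) ≤ 239 / 959 := by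
        unfold trunc; split_ifs <;> linarith
      linarith
    -- Good 2n+1 is a dummy here, so R₄ takes the same goods as R₁.
    · have hset : J.ruleGoods 4 = goodsAt J.goods {1} := by
        rw [Instance.ruleGoods]
        refine Finset.filter_congr fun g _ => ?_
        have := rank_le_card J.goods g
        simp only [Finset.mem_insert, Finset.mem_singleton]
        omega
      rw [hset]; exact hone

end Rules

/-! ### The loop of `reduce`, and normalization. -/

section ReduceInvariant

variable {n m : ℕ}

/-- What holds in the loop of `reduce` when it is started with the instance `I₀`. -/
structure ReduceInv (I₀ : Instance n m) (α : ℝ) (J : Instance n m) (A : Alloc n m) : Prop where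
  agents_subset : J.agents ⊆ I₀.agents
  goods_subset : J.goods ⊆ I₀.goods
  val_eq : J.val = I₀.val
  parts : ∀ i ∈ J.agents,
    HasParts (fun g => trunc (J.val i g)) J.goods J.agents.card (956 / 959)
  alloc : IsAllocOf (I₀.agents \ J.agents) (I₀.goods \ J.goods) A
  worth : ∀ i ∈ I₀.agents \ J.agents, α ≤ value (I₀.val i) (A i)
  empty : ∀ i, i ∉ I₀.agents → A i = ∅

theorem ReduceInv.start {I₀ : Instance n m} (α : ℝ)
    (hord : ∀ i ∈ I₀.agents, OrderedOn (I₀.val i) I₀.goods)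
    (hparts : ∀ i ∈ I₀.agents, HasParts (I₀.val i) I₀.goods I₀.agents.card 1) :
    ReduceInv I₀ α I₀ (fun _ => ∅) where
  agents_subset := le_rfl
  goods_subset := le_rfl
  val_eq := rfl
  parts := fun i hi => by
    obtain ⟨P, K, hK, hP⟩ := hparts i hi
    exact ⟨P, K, hK, fun j hj => le_sum_trunc
      (fun g hg => (hord i hi).nonneg g (Finset.mem_filter.1 hg).1) (hP j hj)⟩
  alloc := ⟨fun i hi => absurd hi (by simp), fun i hi => absurd hi (by simp)⟩
  worth := fun i hi => absurd hi (by simp)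
  empty := fun _ _ => rfl

theorem ReduceInv.rule {I₀ J : Instance n m} {α : ℝ} {A : Alloc n m} (h : ReduceInv I₀ α J A)
    (hord : ∀ i ∈ I₀.agents, OrderedOn (I₀.val i) I₀.goods) (hα : α ≤ 720 / 959) {k : ℕ}
    (hk : k ∈ Finset.Icc 1 4) (hmin : ∀ l ∈ Finset.Ico 1 k, ¬ J.Applicable α l) {i : Fin n}
    (hi : J.CanApply α ∅ k i) :
    ReduceInv I₀ α (J.remove i (J.ruleGoods k)) (Function.update A i (J.ruleGoods k)) where
  agents_subset := (Finset.erase_subset _ _).trans h.agents_subset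
  goods_subset := Finset.sdiff_subset.trans h.goods_subset
  val_eq := h.val_eq
  parts := fun j hj => by
    obtain ⟨-, hjJ⟩ := Finset.mem_erase.1 hj
    change HasParts _ (J.goods \ J.ruleGoods k) (J.agents.erase i).card _
    rw [Finset.card_erase_of_mem hi.1]
    refine HasParts.remove_ruleGoods J hk hα hjJ ?_ hmin (h.parts j hjJ)
    rw [h.val_eq]
    exact (hord j (h.agents_subset hjJ)).mono h.goods_subset
  alloc := h.alloc.update (ruleGoods_subset J k) h.goods_subset
  worth := worth_update h.worth (h.val_eq ▸ hi.2.1)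
  empty := fun j hj => by
    rw [Function.update_of_ne, h.empty j hj]
    rintro rfl
    exact hj (h.agents_subset hi.1)

theorem exists_isNormalization (J : Instance n m) : ∃ B, J.IsNormalization B := by
  classical
  have hP : ∀ i, i ∈ J.agents → ∃ P : Fin m → Fin J.agents.card,
      minBundle (J.val i) J.goods P = J.share i := fun i hi =>
    exists_minBundle_eq_mms _ (Finset.card_pos.2 ⟨i, hi⟩) _
  choose P hP using hP
  refine ⟨⟨J.agents, J.goods, fun i g => if hi : i ∈ J.agents then
    J.val i g / value (J.val i) (bundle J.goods (P i hi) (P i hi g)) else J.val i g⟩, rfl, rfl,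
    fun i hi => ⟨P i hi, hP i hi, fun g => dif_pos hi⟩, fun i hi => ?_⟩
  funext g
  exact dif_neg hi

/-- The properties of the ordered normalized irreducible instance from the point of view of an
agent with values `u`. -/
structure IsONI (u : Fin m → ℝ) (G : Finset (Fin m)) (N : ℕ) : Prop where
  pos : 0 < N
  ordered : OrderedOn u G
  parts : ∃ P : Fin m → ℕ, (∀ g, P g < N) ∧
    ∀ j < N, value u (G.filter fun g => P g = j) = 1
  one : posVal u G 1 < beta
  three : posVal u G (2 * N - 1) + posVal u G (2 * N) + posVal u G (2 * N + 1) < beta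
  pair : posVal u G 1 + posVal u G (2 * N + 1) < beta

theorem IsONI.total {u : Fin m → ℝ} {G : Finset (Fin m)} {N : ℕ} (h : IsONI u G N) :
    value u G = N := by
  obtain ⟨P, hPN, hP⟩ := h.parts
  have h1 : value u G = ∑ j ∈ Finset.range N, value u (G.filter fun g => P g = j) :=
    (Finset.sum_fiberwise_of_maps_to (fun g _ => Finset.mem_range.2 (hPN g)) u).symm
  rw [h1, Finset.sum_congr rfl fun j hj => hP j (Finset.mem_range.1 hj)]
  simp

theorem posVal_const_mul (c : ℝ) (u : Fin m → ℝ) (M : Finset (Fin m)) (p : ℕ) :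
    posVal (fun g => c * u g) M p = c * posVal u M p := by
  rw [posVal, posVal, value, value, Finset.mul_sum]

/-- After the loop every good is below 720/959, where rounding never raises a value, so the true
share is at least 956/959. Dividing by bundle values therefore multiplies by at most 959/956, which
turns the threshold 720/959 into `beta`. Ordering respects such a domination position by position.
-/
theorem ReduceInv.exit {I₀ J B : Instance n m} {α : ℝ} {A : Alloc n m} (h : ReduceInv I₀ α J A)
    (hord : ∀ i ∈ I₀.agents, OrderedOn (I₀.val i) I₀.goods) (hα : α ≤ 720 / 959)
    (hexit : ∀ k ∈ Finset.Icc 1 4, ¬ J.Applicable α k) (hB : J.IsNormalization B)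
    {i : Fin n} (hi : i ∈ B.agents) :
    IsONI (B.order.val i) B.goods B.agents.card ∧
      ∀ S ⊆ B.goods, 956 / 959 * value (B.val i) S ≤ value (I₀.val i) S := by
  obtain ⟨hBa, hBg, hBP, -⟩ := hB
  rw [hBa] at hi
  have hc : 0 < J.agents.card := Finset.card_pos.2 ⟨i, hi⟩
  have ho : OrderedOn (J.val i) J.goods := by
    rw [h.val_eq]; exact (hord i (h.agents_subset hi)).mono h.goods_subset
  have hna : ∀ k ∈ Finset.Icc 1 4, value (J.val i) (J.ruleGoods k) < 720 / 959 := fun k hk => by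
    have h1 := hexit k hk
    simp only [Instance.Applicable, not_exists, not_and, not_le] at h1
    exact (h1 i hi).trans_le hα
  have hlt : ∀ g ∈ J.goods, J.val i g < 720 / 959 := fun g hg =>
    (ho.le_posVal hg le_rfl (one_le_rank hg)).trans_lt (hna 1 (by simp))
  have hshare : 956 / 959 ≤ J.share i :=
    ((h.parts i hi).mono_value fun g hg => trunc_le (hlt g hg)).le_mms hc ho.nonneg
  obtain ⟨P, hPmin, hPval⟩ := hBP i hi
  have hbund : ∀ j, 956 / 959 ≤ value (J.val i) (bundle J.goods P j) := fun j =>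
    (hshare.trans hPmin.ge).trans (minBundle_le _ _ _ _)
  have hBle : ∀ g ∈ J.goods, 0 ≤ B.val i g ∧ B.val i g ≤ 959 / 956 * J.val i g := fun g hg => by
    rw [hPval g]
    have h1 := hbund (P g)
    have h2 := ho.nonneg g hg
    refine ⟨div_nonneg h2 (by linarith), ?_⟩
    rw [div_le_iff₀ (by linarith)]
    nlinarith
  have hBnn : ∀ g ∈ B.goods, 0 ≤ B.val i g := fun g hg => (hBle g (hBg ▸ hg)).1
  have hpos : ∀ p, 1 ≤ p → posVal (B.order.val i) B.goods p
      ≤ 959 / 956 * posVal (J.val i) J.goods p := fun p hp => by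
    rw [← posVal_const_mul]
    have := B.posVal_order_le hBnn (u := fun g => 959 / 956 * J.val i g) ?_
      (fun g hg => (hBle g (hBg ▸ hg)).2) hp
    · rwa [hBg] at this ⊢
    · rw [hBg]
      exact ⟨fun a ha b hb hab => mul_le_mul_of_nonneg_left (ho.anti ha hb hab) (by norm_num),
        fun g hg => mul_nonneg (by norm_num) (ho.nonneg g hg)⟩
  have hbeta : beta = 959 / 956 * (720 / 959) := by norm_num [beta, delta]
  refine ⟨⟨by rwa [hBa], B.order_orderedOn hBnn, ?_, ?_, ?_, ?_⟩, fun S hS => ?_⟩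
  · obtain ⟨σ, hσ, hval, -⟩ := B.exists_perm_order i
    refine ⟨fun g => P (σ g), fun g => by rw [hBa]; exact (P (σ g)).2, fun j hj => ?_⟩
    rw [hBa] at hj
    rw [value_comp_perm hσ hval fun g => (P g : ℕ) = j]
    have h1 : B.goods.filter (fun g => (P g : ℕ) = j) = bundle J.goods P ⟨j, hj⟩ := by
      ext g; simp only [bundle, Finset.mem_filter, Fin.ext_iff, hBg]
    have h2 := hbund ⟨j, hj⟩
    rw [h1, value, Finset.sum_congr rfl (g := fun g =>
      J.val i g / value (J.val i) (bundle J.goods P ⟨j, hj⟩)) fun g hg => by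
        rw [hPval g, (Finset.mem_filter.1 hg).2], ← Finset.sum_div]
    exact div_self (by rw [value] at h2; linarith)
  · have h1 := hna 1 (by simp)
    rw [value_ruleGoods_one] at h1
    have h2 := hpos 1 le_rfl
    linarith
  · have h1 := hna 2 (by simp)
    rw [value_ruleGoods_two _ _ hc] at h1
    rw [hBa]
    have h2 := hpos (2 * J.agents.card - 1) (by omega)
    have h3 := hpos (2 * J.agents.card) (by omega)
    have h4 := hpos (2 * J.agents.card + 1) (by omega)
    linarith
  · have h1 := hna 4 (by simp)
    rw [value_ruleGoods_four _ _ hc] at h1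
    rw [hBa]
    have h2 := hpos 1 (by omega)
    have h4 := hpos (2 * J.agents.card + 1) (by omega)
    linarith
  · rw [value, value, Finset.mul_sum]
    refine Finset.sum_le_sum fun g hg => ?_
    have := (hBle g (hBg ▸ hS hg)).2
    rw [← h.val_eq]
    linarith

end ReduceInvariant


/-! ### Agents with some B_k above 1: counting in unit bundles. -/

section UnitBundles

variable {m : ℕ}

/-- A weakly decreasing sequence of nonnegative values, supported on the positions `1, …, c`, that
`q` splits into `N` bundles of value `1`. -/
structure UnitBundles (v : ℕ → ℝ) (q : ℕ → ℕ) (c N : ℕ) : Prop where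
  lt : ∀ p ∈ Finset.Icc 1 c, q p < N
  sum : ∀ j < N, ∑ p ∈ (Finset.Icc 1 c).filter (fun p => q p = j), v p = 1
  anti : ∀ a b, 1 ≤ a → a ≤ b → v b ≤ v a
  nonneg : ∀ p, 0 ≤ v p
  zero : ∀ p, c < p → v p = 0

theorem IsONI.exists_unitBundles {u : Fin m → ℝ} {G : Finset (Fin m)} {N : ℕ}
    (h : IsONI u G N) : ∃ q, UnitBundles (posVal u G) q G.card N := by
  classical
  obtain ⟨P, hPN, hP⟩ := h.parts
  let q : ℕ → ℕ := fun p => if hp : ∃ g ∈ G, rank G g = p then P hp.choose else 0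
  have hq : ∀ g ∈ G, q (rank G g) = P g := fun g hg => by
    have hp : ∃ g' ∈ G, rank G g' = rank G g := ⟨g, hg, rfl⟩
    have : hp.choose = g := rank_injOn G hp.choose_spec.1 hg hp.choose_spec.2
    simp only [q, dif_pos hp, this]
  refine ⟨q, fun p hp => ?_, fun j hj => ?_, fun a b => h.ordered.posVal_anti,
    h.ordered.posVal_nonneg, fun p => posVal_of_card_lt u⟩
  · rw [Finset.mem_Icc] at hp
    obtain ⟨g, hg, rfl⟩ := exists_rank_eq hp.1 hp.2
    rw [hq g hg]; exact hPN g
  · rw [← hP j hj, value]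
    have himg : (Finset.Icc 1 G.card).filter (fun p => q p = j)
        = (G.filter fun g => P g = j).image (rank G) := by
      ext p
      simp only [Finset.mem_filter, Finset.mem_image]
      constructor
      · rintro ⟨hp, hqp⟩
        rw [Finset.mem_Icc] at hp
        obtain ⟨g, hg, rfl⟩ := exists_rank_eq hp.1 hp.2
        exact ⟨g, ⟨hg, by rw [← hq g hg]; exact hqp⟩, rfl⟩
      · rintro ⟨g, ⟨hg, hgj⟩, rfl⟩
        exact ⟨Finset.mem_Icc.2 ⟨one_le_rank hg, rank_le_card _ _⟩, by rw [hq g hg, hgj]⟩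
    rw [himg, Finset.sum_image ((rank_injOn G).mono (Finset.filter_subset _ _))]
    exact Finset.sum_congr rfl fun g hg => posVal_rank u (Finset.mem_filter.1 hg).1

namespace UnitBundles

variable {v : ℕ → ℝ} {q : ℕ → ℕ} {c N : ℕ}

theorem le_of_pos (h : UnitBundles v q c N) {p : ℕ} (hp : 0 < v p) : p ≤ c := by
  by_contra hc
  exact hp.ne' (h.zero p (not_le.1 hc))

theorem sum_le_card (h : UnitBundles v q c N) {S L : Finset ℕ} (hS : S ⊆ Finset.Icc 1 c)
    (hSL : ∀ p ∈ S, q p ∈ L) (hL : L ⊆ Finset.range N) : ∑ p ∈ S, v p ≤ L.card := by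
  rw [← Finset.sum_fiberwise_of_maps_to hSL, Finset.card_eq_sum_ones, Nat.cast_sum]
  refine Finset.sum_le_sum fun j hj => ?_
  rw [Nat.cast_one, ← h.sum j (Finset.mem_range.1 (hL hj))]
  exact Finset.sum_le_sum_of_subset_of_nonneg (Finset.filter_subset_filter _ hS)
    fun p _ _ => h.nonneg p

theorem sum_le_one (h : UnitBundles v q c N) {S : Finset ℕ} (hS : S ⊆ Finset.Icc 1 c) {j : ℕ}
    (hj : j < N) (hSj : ∀ p ∈ S, q p = j) : ∑ p ∈ S, v p ≤ 1 := by
  have := h.sum_le_card (L := {j}) hS (fun p hp => Finset.mem_singleton.2 (hSj p hp))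
    (by simpa using hj)
  simpa using this

theorem add_le_one (h : UnitBundles v q c N) {a b : ℕ} (ha : a ∈ Finset.Icc 1 c)
    (hb : b ∈ Finset.Icc 1 c) (hab : a ≠ b) (hq : q a = q b) : v a + v b ≤ 1 := by
  have := h.sum_le_one (S := {a, b}) (by
    intro p hp; rw [Finset.mem_insert, Finset.mem_singleton] at hp
    rcases hp with rfl | rfl <;> assumption) (h.lt a ha) (by
    intro p hp; rw [Finset.mem_insert, Finset.mem_singleton] at hp
    rcases hp with rfl | rfl; exacts [rfl, hq.symm])
  rwa [Finset.sum_pair hab] at this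

theorem add_add_le_one (h : UnitBundles v q c N) {a b d : ℕ} (ha : a ∈ Finset.Icc 1 c)
    (hb : b ∈ Finset.Icc 1 c) (hd : d ∈ Finset.Icc 1 c) (hab : a ≠ b) (had : a ≠ d)
    (hbd : b ≠ d) (hq : q a = q b) (hq' : q a = q d) : v a + v b + v d ≤ 1 := by
  have := h.sum_le_one (S := {a, b, d}) (by
    intro p hp; simp only [Finset.mem_insert, Finset.mem_singleton] at hp
    rcases hp with rfl | rfl | rfl <;> assumption) (h.lt a ha) (by
    intro p hp; simp only [Finset.mem_insert, Finset.mem_singleton] at hp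
    rcases hp with rfl | rfl | rfl; exacts [rfl, hq.symm, hq'.symm])
  rw [Finset.sum_insert (by simp [hab, had]), Finset.sum_pair hbd] at this
  linarith

/-- If more than two positions per label are mapped to a set of labels, then three of them share
a label. -/
theorem exists_three {S L : Finset ℕ} (hSL : ∀ p ∈ S, q p ∈ L) (hc : 2 * L.card < S.card) :
    ∃ a ∈ S, ∃ b ∈ S, ∃ d ∈ S, a ≠ b ∧ a ≠ d ∧ b ≠ d ∧ q a = q b ∧ q a = q d := by
  obtain ⟨j, -, hj⟩ := Finset.exists_lt_card_fiber_of_mul_lt_card_of_maps_to hSL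
    (n := 2) (by omega)
  obtain ⟨a, b, d, ha, hb, hd, hab, had, hbd⟩ := Finset.two_lt_card_iff.1 hj
  rw [Finset.mem_filter] at ha hb hd
  exact ⟨a, ha.1, b, hb.1, d, hd.1, hab, had, hbd, ha.2.trans hb.2.symm, ha.2.trans hd.2.symm⟩

/-- The consequences of `v_l + v_{2N-l+1} > 1` for an `l ≤ N`. -/
theorem of_one_lt (h : UnitBundles v q c N) {l : ℕ} (hl1 : 1 ≤ l) (hlN : l ≤ N)
    (hl : 1 < v l + v (2 * N - l + 1)) (hv1 : v 1 < beta) :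
    Set.InjOn q (Finset.Icc 1 l) ∧
    (∀ p ∈ Finset.Icc (l + 1) (2 * N - l + 1), ∀ a ∈ Finset.Icc 1 l, q a ≠ q p) ∧
    v (2 * N - l + 1) ≤ 1 / 3 := by
  have hvl : v l ≤ v 1 := h.anti 1 l le_rfl hl1
  have hpos : 0 < v (2 * N - l + 1) := by
    have : beta < 1 := by norm_num [beta, delta]
    linarith
  have hc := h.le_of_pos hpos
  -- Two such positions in one bundle would be worth at least as much as B_l, that is, more than 1.
  have hdis : ∀ a b, 1 ≤ a → a ≤ l → a < b → b ≤ 2 * N - l + 1 → q a ≠ q b := by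
    intro a b ha hal hab hb hq
    have h1 := h.add_le_one (Finset.mem_Icc.2 ⟨ha, by omega⟩)
      (Finset.mem_Icc.2 ⟨by omega, hb.trans hc⟩) hab.ne hq
    have h2 := h.anti a l ha hal
    have h3 := h.anti b (2 * N - l + 1) (by omega) hb
    linarith
  have hinj : Set.InjOn q (Finset.Icc 1 l) := by
    intro a ha b hb hab
    simp only [Finset.coe_Icc, Set.mem_Icc] at ha hb
    rcases lt_trichotomy a b with hlt | heq | hlt
    · exact absurd hab (hdis a b ha.1 ha.2 hlt (by omega))
    · exact heq
    · exact absurd hab.symm (hdis b a hb.1 hb.2 hlt (by omega))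
  have hsep : ∀ p ∈ Finset.Icc (l + 1) (2 * N - l + 1), ∀ a ∈ Finset.Icc 1 l, q a ≠ q p := by
    intro p hp a ha
    rw [Finset.mem_Icc] at hp ha
    exact hdis a p ha.1 ha.2 (by omega) hp.2
  refine ⟨hinj, hsep, ?_⟩
  have hZ : (Finset.Icc 1 l).image q ⊆ Finset.range N := fun z hz => by
    obtain ⟨a, ha, rfl⟩ := Finset.mem_image.1 hz
    rw [Finset.mem_Icc] at ha
    exact Finset.mem_range.2 (h.lt a (Finset.mem_Icc.2 ⟨ha.1, by omega⟩))
  have hcard : (Finset.range N \ (Finset.Icc 1 l).image q).card = N - l := by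
    rw [Finset.card_sdiff_of_subset hZ, Finset.card_image_of_injOn hinj]; simp
  -- There are 2(N - l) + 1 positions for the N - l bundles that avoid the first l goods.
  obtain ⟨a, ha, b, hb, d, hd, hab, had, hbd, hqb, hqd⟩ := exists_three (q := q)
    (S := Finset.Icc (l + 1) (2 * N - l + 1))
    (L := Finset.range N \ (Finset.Icc 1 l).image q) (fun p hp => by
      refine Finset.mem_sdiff.2 ⟨Finset.mem_range.2 (h.lt p ?_), fun hz => ?_⟩
      · rw [Finset.mem_Icc] at hp ⊢; omega
      · obtain ⟨a, ha, hqa⟩ := Finset.mem_image.1 hz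
        exact hsep p hp a ha hqa)
    (by rw [hcard, Nat.card_Icc]; omega)
  rw [Finset.mem_Icc] at ha hb hd
  have h1 := h.add_add_le_one (Finset.mem_Icc.2 (by omega : 1 ≤ a ∧ a ≤ c))
    (Finset.mem_Icc.2 (by omega : 1 ≤ b ∧ b ≤ c)) (Finset.mem_Icc.2 (by omega : 1 ≤ d ∧ d ≤ c))
    hab had hbd hqb hqd
  have h2 := h.anti a _ (by omega) ha.2
  have h3 := h.anti b _ (by omega) hb.2
  have h4 := h.anti d _ (by omega) hd.2
  linarith

/-- The value of the positions in the range of a `B_k > 1`: `U` collects those positions of the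
second half of these bags whose bundles contain none of the goods `1, …, l`. -/
theorem exists_unhosted (h : UnitBundles v q c N) {s l : ℕ} (hs1 : 1 ≤ s) (hsl : s ≤ l)
    (hlN : l ≤ N) (hs : 1 < v s + v (2 * N - s + 1)) (hl : 1 < v l + v (2 * N - l + 1))
    (hv1 : v 1 < beta) :
    ∃ U ⊆ Finset.Icc (2 * N - l + 1) (2 * N - s + 1),
      (∑ p ∈ Finset.Icc s l, v p) + ∑ p ∈ Finset.Icc (2 * N - l + 1) (2 * N - s + 1) \ U, v p
        ≤ (l + 1 - s - U.card) + U.card * v s ∧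
      (∑ p ∈ Finset.Icc (l + 1) (2 * N - l), v p) + ∑ p ∈ U, v p ≤ N - l := by
  classical
  obtain ⟨hinj, hsep, h13⟩ := h.of_one_lt (hs1.trans hsl) hlN hl hv1
  have hvs : v s ≤ v 1 := h.anti 1 s le_rfl hs1
  have hy : 1 - beta < v (2 * N - s + 1) := by linarith
  have hpos : 0 < v (2 * N - s + 1) := by
    have : beta < 1 := by norm_num [beta, delta]
    linarith
  have hc := h.le_of_pos hpos
  set T := Finset.Icc (2 * N - l + 1) (2 * N - s + 1) with hT
  set Z := (Finset.Icc 1 l).image q with hZdef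
  set H := T.filter fun p => q p ∈ Z with hH
  have hTc : ∀ p ∈ T, p ∈ Finset.Icc 1 c := fun p hp => by
    rw [hT, Finset.mem_Icc] at hp; rw [Finset.mem_Icc]; omega
  have hlc : ∀ a ∈ Finset.Icc 1 l, a ∈ Finset.Icc 1 c := fun a ha => by
    rw [Finset.mem_Icc] at ha ⊢; omega
  have hZ : Z ⊆ Finset.range N := fun z hz => by
    obtain ⟨a, ha, rfl⟩ := Finset.mem_image.1 hz
    exact Finset.mem_range.2 (h.lt a (hlc a ha))
  have hZcard : Z.card = l := by
    rw [hZdef, Finset.card_image_of_injOn hinj]; simp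
  have hTcard : T.card = l - s + 1 := by rw [hT, Nat.card_Icc]; omega
  have hUH : T \ H = T.filter fun p => q p ∉ Z := by
    ext p; simp only [hH, Finset.mem_sdiff, Finset.mem_filter]; tauto
  refine ⟨T \ H, Finset.sdiff_subset, ?_, ?_⟩
  · rw [Finset.sdiff_sdiff_eq_self (Finset.filter_subset _ _)]
    -- A good a ≤ l hosts the goods of `T` in its bundle. The truncation at `v s` makes each a < s
    -- contribute exactly `v s` to the sum of the minima, so that these terms cancel when the
    -- inequality is summed over all hosts.
    have key : ∀ a ∈ Finset.Icc 1 l, min (v a) (v s)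
        + ∑ p ∈ H.filter (fun p => q p = q a), v p
        ≤ v s + ((H.filter (fun p => q p = q a)).card : ℝ) * (1 - v s) := by
      intro a ha
      have hfil : ∀ p ∈ H.filter (fun p => q p = q a), p ∈ Finset.Icc 1 c ∧ a < p ∧ q a = q p ∧
          p ∈ T := by
        intro p hp
        rw [Finset.mem_filter, hH, Finset.mem_filter] at hp
        refine ⟨hTc p hp.1.1, ?_, hp.2.symm, hp.1.1⟩
        have := hp.1.1
        rw [hT, Finset.mem_Icc] at this; rw [Finset.mem_Icc] at ha
        omega
      have hva : v l ≤ v a := h.anti a l (Finset.mem_Icc.1 ha).1 (Finset.mem_Icc.1 ha).2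
      -- A host is worth more than 2/3, because v(2N-l+1) ≤ 1/3. Two goods of `T` are worth more
      -- than 2(1 - β). Together these exceed 1.
      have hcard1 : (H.filter (fun p => q p = q a)).card ≤ 1 := by
        rw [Finset.card_le_one]
        intro b hb d hd
        by_contra hbd
        obtain ⟨hb1, hb2, hb3, hb4⟩ := hfil b hb
        obtain ⟨hd1, hd2, hd3, hd4⟩ := hfil d hd
        have h1 := h.add_add_le_one (hlc a ha) hb1 hd1 hb2.ne hd2.ne hbd hb3 hd3
        rw [hT, Finset.mem_Icc] at hb4 hd4
        have h2 := h.anti b _ (Finset.mem_Icc.1 hb1).1 hb4.2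
        have h3 := h.anti d _ (Finset.mem_Icc.1 hd1).1 hd4.2
        norm_num [beta, delta] at hy
        linarith
      rcases Nat.eq_zero_or_pos (H.filter (fun p => q p = q a)).card with h0 | h0
      · rw [h0, Finset.card_eq_zero.1 h0]; simp
      · obtain ⟨b, hb⟩ := Finset.card_eq_one.1 (le_antisymm hcard1 h0)
        rw [hb, Finset.sum_singleton, Finset.card_singleton]
        obtain ⟨hb1, hb2, hb3, hb4⟩ := hfil b (by rw [hb]; simp)
        have h1 := h.add_le_one (hlc a ha) hb1 hb2.ne hb3
        have h2 := min_le_left (v a) (v s)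
        push_cast
        linarith
    have hHZ : ∀ p ∈ H, q p ∈ Finset.image q (Finset.Icc 1 l) :=
      fun p hp => (Finset.mem_filter.1 hp).2
    have hsum := Finset.sum_le_sum key
    rw [Finset.sum_add_distrib, Finset.sum_add_distrib, ← Finset.sum_mul, ← Nat.cast_sum,
      ← Finset.sum_image (f := fun z => ∑ p ∈ H.filter (fun p => q p = z), v p) hinj,
      ← Finset.sum_image (f := fun z => (H.filter (fun p => q p = z)).card) hinj,
      Finset.sum_fiberwise_of_maps_to hHZ, ← Finset.card_eq_sum_card_fiberwise hHZ] at hsum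
    have hmin : ∑ a ∈ Finset.Icc 1 l, min (v a) (v s)
        = ((s - 1 : ℕ) : ℝ) * v s + ∑ a ∈ Finset.Icc s l, v a := by
      have hun : Finset.Icc 1 l = Finset.Icc 1 (s - 1) ∪ Finset.Icc s l := by
        ext a; simp only [Finset.mem_union, Finset.mem_Icc]; omega
      rw [hun, Finset.sum_union (Finset.disjoint_left.2 fun a ha hb => by
        rw [Finset.mem_Icc] at ha hb; omega)]
      congr 1
      · rw [Finset.sum_congr rfl fun a ha => min_eq_right (h.anti a s (Finset.mem_Icc.1 ha).1
          (by have := (Finset.mem_Icc.1 ha).2; omega))]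
        simp
      · exact Finset.sum_congr rfl fun a ha =>
          min_eq_left (h.anti s a hs1 (Finset.mem_Icc.1 ha).1)
    have hHc : ((T \ H).card : ℝ) = l - s + 1 - H.card := by
      rw [Finset.card_sdiff_of_subset (Finset.filter_subset _ _), Nat.cast_sub
        (Finset.card_le_card (Finset.filter_subset _ _)), hTcard]
      push_cast [hsl]; ring
    rw [hmin, Nat.cast_sub hs1,
      Finset.sum_const, Nat.card_Icc, nsmul_eq_mul] at hsum
    push_cast at hsum
    rw [hHc]
    linarith
  · have hdisj : Disjoint (Finset.Icc (l + 1) (2 * N - l)) (T \ H) :=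
      Finset.disjoint_left.2 fun p hp hp' => by
        have := (Finset.mem_sdiff.1 hp').1
        rw [hT, Finset.mem_Icc] at this; rw [Finset.mem_Icc] at hp; omega
    rw [← Finset.sum_union hdisj]
    have := h.sum_le_card (S := Finset.Icc (l + 1) (2 * N - l) ∪ (T \ H))
      (L := Finset.range N \ Z) (fun p hp => ?_) (fun p hp => ?_) Finset.sdiff_subset
    · rw [Finset.card_sdiff_of_subset hZ, hZcard, Finset.card_range, Nat.cast_sub hlN] at this
      exact this
    · rcases Finset.mem_union.1 hp with hp | hp
      · rw [Finset.mem_Icc] at hp ⊢; omega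
      · exact hTc p (Finset.mem_sdiff.1 hp).1
    · rcases Finset.mem_union.1 hp with hp | hp
      · refine Finset.mem_sdiff.2 ⟨Finset.mem_range.2 (h.lt p ?_), fun hz => ?_⟩
        · rw [Finset.mem_Icc] at hp ⊢; omega
        · obtain ⟨a, ha, hqa⟩ := Finset.mem_image.1 hz
          refine hsep p ?_ a ha hqa
          rw [Finset.mem_Icc] at hp ⊢; omega
      · refine Finset.mem_sdiff.2 ⟨Finset.mem_range.2 (h.lt p (hTc p (Finset.mem_sdiff.1 hp).1)), ?_⟩
        rw [hUH] at hp
        exact (Finset.mem_filter.1 hp).2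

theorem sum_bags (s l N : ℕ) (hl : l ≤ N) (hs1 : 1 ≤ s) (hsN : s ≤ N) (v : ℕ → ℝ) :
    ∑ k ∈ Finset.Icc s l, v (2 * N - k + 1)
      = ∑ p ∈ Finset.Icc (2 * N - l + 1) (2 * N - s + 1), v p := by
  refine Finset.sum_nbij' (fun k => 2 * N - k + 1) (fun p => 2 * N + 1 - p) ?_ ?_ ?_ ?_ ?_
  all_goals
    intro k hk
    try simp only [Finset.mem_Icc] at hk ⊢
    try omega

/-- If some `B_k = v_k + v_{2N-k+1}` exceeds `1`, then the bags outside a set `K` of bags below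
`beta` are worth at most `N - (5/6 + 2 * delta) * |K|`. -/
theorem sum_bags_le (h : UnitBundles v q c N) {k₀ : ℕ} (hk₀ : k₀ ∈ Finset.Icc 1 N)
    (hk₀' : 1 < v k₀ + v (2 * N - k₀ + 1)) (hv1 : v 1 < beta)
    (hpair : v 1 + v (2 * N + 1) < beta) :
    v (2 * N + 1) ≤ 1 / 12 + delta ∧
    ∀ K ⊆ Finset.Icc 1 N, (∀ k ∈ K, v k + v (2 * N - k + 1) < beta) →
      ∑ k ∈ Finset.Icc 1 N \ K, (v k + v (2 * N - k + 1))
        ≤ N - K.card * (5 / 6 + 2 * delta) := by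
  classical
  set S := (Finset.Icc 1 N).filter fun k => 1 < v k + v (2 * N - k + 1) with hS
  have hne : S.Nonempty := ⟨k₀, Finset.mem_filter.2 ⟨hk₀, hk₀'⟩⟩
  obtain ⟨s, l, hsS, hlS, hsmin, hlmax⟩ : ∃ s l, s ∈ S ∧ l ∈ S ∧ (∀ k ∈ S, s ≤ k) ∧ ∀ k ∈ S, k ≤ l :=
    ⟨S.min' hne, S.max' hne, S.min'_mem hne, S.max'_mem hne, fun k hk => S.min'_le k hk,
      fun k hk => S.le_max' k hk⟩
  rw [hS, Finset.mem_filter, Finset.mem_Icc] at hsS hlS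
  obtain ⟨⟨hs1, hsN⟩, hs⟩ := hsS
  obtain ⟨⟨hl1, hlN⟩, hl⟩ := hlS
  have hsl : s ≤ l := hsmin l (Finset.mem_filter.2 ⟨Finset.mem_Icc.2 ⟨hl1, hlN⟩, hl⟩)
  obtain ⟨-, -, h13⟩ := h.of_one_lt hl1 hlN hl hv1
  have hvs : v s ≤ v 1 := h.anti 1 s le_rfl hs1
  have hvl : v l ≤ v 1 := h.anti 1 l le_rfl hl1
  obtain ⟨U, hU, hU1, hU2⟩ := h.exists_unhosted hs1 hsl hlN hs hl hv1
  have hd : delta = 3 / 956 := rfl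
  have hb : beta = 3 / 4 + 3 / 956 := rfl
  -- Since v_l > 2/3, also v_1 > 2/3, so the pair bound leaves less than 3/4 + δ - 2/3 = 1/12 + δ
  -- for good 2N+1.
  refine ⟨by rw [hd]; rw [hb] at hpair; linarith, fun K hK hKb => ?_⟩
  have hle1 : ∀ k ∈ Finset.Icc 1 N, (k < s ∨ l < k) → v k + v (2 * N - k + 1) ≤ 1 := by
    intro k hk hkr
    by_contra hcon
    have hkS : k ∈ S := Finset.mem_filter.2 ⟨hk, not_le.1 hcon⟩
    have := hsmin k hkS; have := hlmax k hkS; omega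
  -- For s ≤ k ≤ l the bag is worth more than 2/3 + (1 - β), which exceeds β.
  have hmid : ∀ k ∈ Finset.Icc s l, k ∉ K := by
    intro k hk hkK
    have := hKb k hkK
    rw [Finset.mem_Icc] at hk
    have h1 := h.anti k l (hs1.trans hk.1) hk.2
    have h2 := h.anti (2 * N - k + 1) (2 * N - s + 1) (by omega) (by omega)
    rw [hb] at this hv1
    linarith
  -- split the bags into three ranges
  set f : ℕ → ℝ := fun k => v k + v (2 * N - k + 1) with hf
  have hsplit : Finset.Icc 1 N \ K
      = (Finset.Icc 1 (s - 1) \ K) ∪ (Finset.Icc s l ∪ (Finset.Icc (l + 1) N \ K)) := by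
    ext k
    simp only [Finset.mem_sdiff, Finset.mem_union, Finset.mem_Icc]
    constructor
    · rintro ⟨hk, hkK⟩
      by_cases h1 : k < s
      · exact Or.inl ⟨by omega, hkK⟩
      · by_cases h2 : k ≤ l
        · exact Or.inr (Or.inl (by omega))
        · exact Or.inr (Or.inr ⟨by omega, hkK⟩)
    · rintro (⟨hk, hkK⟩ | hk | ⟨hk, hkK⟩)
      · exact ⟨by omega, hkK⟩
      · exact ⟨by omega, hmid k (Finset.mem_Icc.2 hk)⟩
      · exact ⟨by omega, hkK⟩
  set Ka := Finset.Icc 1 (s - 1) ∩ K with hKa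
  set Kc := Finset.Icc (l + 1) N ∩ K with hKc
  have hKsplit : (K.card : ℝ) = Ka.card + Kc.card := by
    have : K = Ka ∪ Kc := by
      ext k
      simp only [hKa, hKc, Finset.mem_union, Finset.mem_inter, Finset.mem_Icc]
      constructor
      · intro hk
        have h1 := Finset.mem_Icc.1 (hK hk)
        have h2 : ¬ (s ≤ k ∧ k ≤ l) := fun h2 => hmid k (Finset.mem_Icc.2 h2) hk
        by_cases h3 : k < s
        · exact Or.inl ⟨by omega, hk⟩
        · exact Or.inr ⟨by omega, hk⟩
      · rintro (hk | hk) <;> exact hk.2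
    have hdis : Disjoint Ka Kc := Finset.disjoint_left.2 fun k hk hk' => by
      simp only [hKa, hKc, Finset.mem_inter, Finset.mem_Icc] at hk hk'; omega
    exact_mod_cast this ▸ Finset.card_union_of_disjoint hdis
  have hcardA : ((Finset.Icc 1 (s - 1) \ K).card : ℝ) = s - 1 - Ka.card := by
    have h1 := Finset.card_sdiff_add_card_inter (Finset.Icc 1 (s - 1)) K
    rw [Nat.card_Icc, ← hKa] at h1
    have h2 : (Finset.Icc 1 (s - 1) \ K).card + Ka.card + 1 = s := by omega
    have h3 : (((Finset.Icc 1 (s - 1) \ K).card + Ka.card + 1 : ℕ) : ℝ) = s := by rw [h2]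
    push_cast at h3; linarith
  have hcardC : ((Finset.Icc (l + 1) N \ K).card : ℝ) = N - l - Kc.card := by
    have h1 := Finset.card_sdiff_add_card_inter (Finset.Icc (l + 1) N) K
    rw [Nat.card_Icc, ← hKc] at h1
    have h2 : (Finset.Icc (l + 1) N \ K).card + Kc.card + l = N := by omega
    have h3 : (((Finset.Icc (l + 1) N \ K).card + Kc.card + l : ℕ) : ℝ) = N := by rw [h2]
    push_cast at h3; linarith
  have hA : ∑ k ∈ Finset.Icc 1 (s - 1) \ K, f k ≤ s - 1 - Ka.card := by
    rw [← hcardA, ← nsmul_one, ← Finset.sum_const]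
    refine Finset.sum_le_sum fun k hk => ?_
    have := Finset.mem_Icc.1 (Finset.mem_sdiff.1 hk).1
    exact hle1 k (Finset.mem_Icc.2 (by omega)) (by omega)
  have hC1 : ∑ k ∈ Finset.Icc (l + 1) N \ K, f k ≤ N - l - Kc.card := by
    rw [← hcardC, ← nsmul_one, ← Finset.sum_const]
    refine Finset.sum_le_sum fun k hk => ?_
    have := Finset.mem_Icc.1 (Finset.mem_sdiff.1 hk).1
    exact hle1 k (Finset.mem_Icc.2 (by omega)) (by omega)
  have hM : ∑ k ∈ Finset.Icc s l, f k ≤ (l + 1 - s - U.card) + U.card * v s + ∑ p ∈ U, v p := by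
    rw [hf, Finset.sum_add_distrib, sum_bags s l N hlN hs1 hsN v, ← Finset.sum_sdiff hU]
    linarith
  have hUle : ∑ p ∈ U, v p ≤ U.card * (1 / 3) := by
    rw [← nsmul_eq_mul, ← Finset.sum_const]
    refine Finset.sum_le_sum fun p hp => ?_
    have := Finset.mem_Icc.1 (hU hp)
    exact (h.anti _ p (by omega) this.1).trans h13
  rw [hsplit, Finset.sum_union (Finset.disjoint_left.2 fun k hk hk' => by
    simp only [Finset.mem_union, Finset.mem_sdiff, Finset.mem_Icc] at hk hk'; omega),
    Finset.sum_union (Finset.disjoint_left.2 fun k hk hk' => by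
    simp only [Finset.mem_sdiff, Finset.mem_Icc] at hk hk'; omega), hKsplit]
  have hKa0 : (0 : ℝ) ≤ Ka.card := Nat.cast_nonneg _
  have hKc0 : (0 : ℝ) ≤ Kc.card := Nat.cast_nonneg _
  have hU0 : (0 : ℝ) ≤ U.card := Nat.cast_nonneg _
  have hUs : (U.card : ℝ) * v s ≤ U.card * beta :=
    mul_le_mul_of_nonneg_left (hvs.trans hv1.le) hU0
  rw [hb] at hUs
  rw [hd]
  -- The middle bags exceed their number by at most |U|(1/12 + δ). If |U| ≤ 3/2 |Kc|, the deficit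
  -- |Kc| behind them absorbs this. If |U| is larger, the goods of `U` are charged instead to the
  -- bundles that avoid goods 1, …, l, together with the bags of `Kc`, each worth at least 2(1 - β).
  -- Both cases leave room because δ is small.
  by_cases hcase : (U.card : ℝ) ≤ 3 / 2 * Kc.card
  · linarith
  · have hC2 : ∑ k ∈ Finset.Icc (l + 1) N \ K, f k + Kc.card * (1 / 2 - 2 * (3 / 956))
        + ∑ p ∈ U, v p ≤ N - l := by
      have h1 : Kc.card * (1 / 2 - 2 * (3 / 956)) ≤ ∑ k ∈ Kc, f k := by
        rw [← nsmul_eq_mul, ← Finset.sum_const]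
        refine Finset.sum_le_sum fun k hk => ?_
        have hk' := Finset.mem_Icc.1 (Finset.mem_inter.1 hk).1
        have h2 := h.anti k (2 * N - s + 1) (by omega) (by omega)
        have h3 := h.anti (2 * N - k + 1) (2 * N - s + 1) (by omega) (by omega)
        rw [hb] at hv1
        simp only [hf]
        linarith
      have h2 : ∑ k ∈ Finset.Icc (l + 1) N, f k = ∑ p ∈ Finset.Icc (l + 1) (2 * N - l), v p := by
        rcases hlN.eq_or_lt with rfl | hlt
        · rw [Finset.Icc_eq_empty (by omega), Finset.Icc_eq_empty (by omega)]; simp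
        rw [hf, Finset.sum_add_distrib, sum_bags (l + 1) N N le_rfl (by omega) (by omega) v]
        have : Finset.Icc (l + 1) (2 * N - l) = Finset.Icc (l + 1) N
            ∪ Finset.Icc (2 * N - N + 1) (2 * N - (l + 1) + 1) := by
          ext p; simp only [Finset.mem_union, Finset.mem_Icc]; omega
        rw [this, Finset.sum_union (Finset.disjoint_left.2 fun k hk hk' => by
          simp only [Finset.mem_Icc] at hk hk'; omega)]
      have h3 : ∑ k ∈ Finset.Icc (l + 1) N \ K, f k + ∑ k ∈ Kc, f k
          = ∑ k ∈ Finset.Icc (l + 1) N, f k := by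
        rw [← Finset.sum_sdiff (Finset.inter_subset_left : Kc ⊆ Finset.Icc (l + 1) N), hKc,
          Finset.sdiff_inter_self_left]
      linarith
    linarith

end UnitBundles

end UnitBundles


/-! ### Weights for the agents of `N11`. -/

theorem beta_eq : beta = 180 / 239 := by norm_num [beta, delta]

theorem delta_eq : delta = 3 / 956 := rfl

/-- Weights of the values of goods, for an agent whose good `2n + 1` has value `x`: `w` is used
while pairs of goods are given away, and the smaller `wt` afterwards, with an error of `ex`. -/
structure Weights (x : ℝ) where
  w : ℝ → ℝ
  wt : ℝ → ℝ
  θ : ℝ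
  wE : ℝ
  wQ : ℝ
  wH : ℝ
  κ : ℝ
  lam : ℝ
  κ₁ : ℝ
  ex : ℝ
  w_zero : w 0 = 0
  wt_zero : wt 0 = 0
  -- For the bag and pair loops: any two goods weigh at most `θ`, whatever their values.
  w_le : ∀ v, w v ≤ wH
  two_wH : 2 * wH ≤ θ
  -- For the passage from `w` to `wt`: once the two best goods are worth less than `beta`, at most
  -- one good reaches `beta / 2`, so `ex` is paid at most once.
  w_le_wt : ∀ v, 0 ≤ v → v < beta / 2 → w v ≤ wt v
  w_le_wt_add : ∀ v, 0 ≤ v → w v ≤ wt v + ex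
  wt_mono : MonotoneOn wt (Set.Ici 0)
  -- For bag filling. Every bag C_k contains two goods worth at least `x`, and so weighs at most `κ`
  -- times its value plus 2 `lam`; `lam` is zero or negative. A good of value at most `beta / 4`
  -- added to a bag below `beta` gives the value in `κ_le`.
  wt_le_mul : ∀ v, 0 ≤ v → wt v ≤ κ * v
  wt_le_mul_add : ∀ v, x ≤ v → wt v ≤ κ * v + lam
  κ_nonneg : 0 ≤ κ
  κ_le : κ * (5 * beta / 4) + 2 * lam ≤ θ
  -- For R₂, R₃ and the bags C_k: `wE` bounds every good and `wQ` the goods up to `beta / 3`.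
  wt_le_wE : ∀ v, 0 ≤ v → wt v ≤ wE
  wE_wQ : 2 * wE + wQ ≤ θ
  wt_le_wQ : ∀ v, 0 ≤ v → v ≤ beta / 3 → wt v ≤ wQ
  four_wQ : 4 * wQ ≤ θ
  κ₁_nonneg : 0 ≤ κ₁
  -- For R₃, with a, b, c in positions 2d+1, 2d+2, 2d+3: four late goods leave, and a, b enter the
  -- range where weights are capped at `wQ`. The left side bounds the total loss; `κ₁` is the part
  -- that `θ` does not cover.
  shift : ∀ a b c, x ≤ b → b ≤ a → 0 ≤ c → c ≤ b → a + b + c < beta →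
    3 * wt c + wQ + max 0 (wt a - wQ) + max 0 (wt b - wQ) ≤ θ + κ₁
  shift' : ∀ a b c, 3 / 10 ≤ b → b ≤ a → 0 ≤ c → c ≤ b → a + b + c < beta →
    3 * wt c + wQ + max 0 (wt a - wQ) + max 0 (wt b - wQ) ≤ θ
  -- R₂ can take more than `θ` in uncapped weight only when the second good is so large that
  -- `shift'` applies from then on.
  large : ∀ a b t, x ≤ b → b ≤ a → 0 ≤ t → t ≤ b → θ < wt a + wt b + wt t → 3 / 10 ≤ b
  -- A bag still below `beta` weighs less than `θ` even after all errors are charged.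
  final : ex + κ₁ + κ * beta + 2 * lam < θ

/-- The weight `wt` for `x ≤ 1/4 - delta`. -/
noncomputable def smallWeight (x v : ℝ) : ℝ :=
  if v ≤ x then v else min (3 * x / 2) (max x (v - (beta - 3 * x) / 2))

/-- The weight `wt` for `1/4 - delta < x`. -/
noncomputable def largeWeight (v : ℝ) : ℝ :=
  if v ≤ 60 / 239 then min (11 / 10 * v) (1 / 4)
  else min (3 / 8) (1 / 4 + 11 / 10 * (v - 59 / 239))

/-- Here 90/239 is `beta / 2`, and the flat piece at height x has length (β - 3x)/2. So the weight
trails the value by at most this amount up to β/2, and is capped at 3x/2 afterwards. -/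
theorem smallWeight_cases {x : ℝ} (hx : 56 / 239 ≤ x) (v : ℝ) :
    (v ≤ x ∧ smallWeight x v = v) ∨
    (x < v ∧ v ≤ 90 / 239 - x / 2 ∧ smallWeight x v = x) ∨
    (x < v ∧ 90 / 239 - x / 2 ≤ v ∧ v ≤ 90 / 239 ∧
      smallWeight x v = v - 90 / 239 + 3 * x / 2) ∨
    (90 / 239 ≤ v ∧ smallWeight x v = 3 * x / 2) := by
  rw [smallWeight, beta_eq]
  split_ifs with h
  · exact Or.inl ⟨h, rfl⟩
  right
  rw [not_le] at h
  rcases le_total v (90 / 239 - x / 2) with h1 | h1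
  · left
    rw [max_eq_left (by linarith), min_eq_right (by linarith)]
    exact ⟨h, h1, rfl⟩
  right
  rw [max_eq_right (by linarith)]
  rcases le_total v (90 / 239) with h2 | h2
  · left
    rw [min_eq_right (by linarith)]
    exact ⟨h, h1, h2, by ring⟩
  · right
    rw [min_eq_left (by linarith)]
    exact ⟨h2, rfl⟩

/-- The slope is 11/10; 5/22 is where it reaches 1/4. The weight stays there up to 60/239 = β/3, and
then follows a line of the same slope through 1/4 at 59/239 = 1/4 - δ until it reaches 3/8. -/
theorem largeWeight_cases (v : ℝ) :
    (v ≤ 5 / 22 ∧ largeWeight v = 11 / 10 * v) ∨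
    (5 / 22 ≤ v ∧ v ≤ 60 / 239 ∧ largeWeight v = 1 / 4) ∨
    (60 / 239 < v ∧ v ≤ 59 / 239 + 5 / 44 ∧
      largeWeight v = 1 / 4 + 11 / 10 * (v - 59 / 239)) ∨
    (59 / 239 + 5 / 44 ≤ v ∧ largeWeight v = 3 / 8) := by
  rw [largeWeight]
  split_ifs with h
  · rcases le_total v (5 / 22) with h1 | h1
    · left; rw [min_eq_left (by linarith)]; exact ⟨h1, rfl⟩
    · right; left; rw [min_eq_right (by linarith)]; exact ⟨h1, h, rfl⟩
  · right; right
    rw [not_le] at h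
    rcases le_total v (59 / 239 + 5 / 44) with h1 | h1
    · left; rw [min_eq_right (by linarith)]; exact ⟨h, h1, rfl⟩
    · right; rw [min_eq_left (by linarith)]; exact ⟨h1, rfl⟩

theorem smallWeight_mono {x : ℝ} (hx : 56 / 239 ≤ x) (hx' : x ≤ 59 / 239) :
    Monotone (smallWeight x) := fun a b hab => by
  rcases smallWeight_cases hx a with ⟨h1, h⟩ | ⟨h1, h2, h⟩ | ⟨h1, h2, h3, h⟩ | ⟨h1, h⟩ <;>
  rcases smallWeight_cases hx b with ⟨k1, k⟩ | ⟨k1, k2, k⟩ | ⟨k1, k2, k3, k⟩ | ⟨k1, k⟩ <;>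
  rw [h, k] <;> linarith

theorem largeWeight_mono : Monotone largeWeight := fun a b hab => by
  rcases largeWeight_cases a with ⟨h1, h⟩ | ⟨h1, h2, h⟩ | ⟨h1, h2, h⟩ | ⟨h1, h⟩ <;>
  rcases largeWeight_cases b with ⟨k1, k⟩ | ⟨k1, k2, k⟩ | ⟨k1, k2, k⟩ | ⟨k1, k⟩ <;>
  rw [h, k] <;> linarith

/-- What `smallWeight x` exceeds `x` by. -/
theorem smallWeight_excess {x : ℝ} (hx : 56 / 239 ≤ x) (v : ℝ) :
    max 0 (smallWeight x v - x) = 0 ∨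
    (90 / 239 - x / 2 ≤ v ∧ max 0 (smallWeight x v - x) ≤ v - 90 / 239 + x / 2) := by
  rcases smallWeight_cases hx v with ⟨h1, h⟩ | ⟨h1, h2, h⟩ | ⟨h1, h2, h3, h⟩ | ⟨h1, h⟩ <;> rw [h]
  · exact Or.inl (max_eq_left (by linarith))
  · exact Or.inl (max_eq_left (by linarith))
  · exact Or.inr ⟨h2, max_le (by linarith) (by linarith)⟩
  · exact Or.inr ⟨by linarith, max_le (by linarith) (by linarith)⟩

theorem smallWeight_le {x : ℝ} (hx : 56 / 239 ≤ x) (hx' : x ≤ 59 / 239) (v : ℝ) :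
    smallWeight x v ≤ v ∧ smallWeight x v ≤ 3 * x / 2 ∧
      (v ≤ 60 / 239 → smallWeight x v ≤ x) := by
  rcases smallWeight_cases hx v with ⟨h1, h⟩ | ⟨h1, h2, h⟩ | ⟨h1, h2, h3, h⟩ | ⟨h1, h⟩ <;>
    rw [h] <;> refine ⟨by linarith, by linarith, fun h0 => by linarith⟩

/-- The weights for `x ≤ 1/4 - delta`. -/
noncomputable def smallWeights (x : ℝ) (hx : 56 / 239 ≤ x) (hx' : x ≤ 59 / 239) : Weights x where
  w v := if 90 / 239 ≤ v then 2 * x else smallWeight x v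
  wt := smallWeight x
  -- This is 1 - (β - 3x): a remaining bag B_k loses at most β - 3x when values are replaced by
  -- weights.
  θ := 3 * x + 59 / 239
  wE := 3 * x / 2
  wQ := x
  wH := 2 * x
  κ := 1
  lam := 0
  κ₁ := 90 / 239 - x / 2 - 59 / 239
  ex := x / 2
  w_zero := by
    rw [if_neg (by norm_num), smallWeight, if_pos (by linarith)]
  wt_zero := by rw [smallWeight, if_pos (by linarith)]
  w_le v := by
    have := (smallWeight_le hx hx' v).2.1
    split_ifs <;> linarith
  two_wH := by linarith
  w_le_wt v _ hv := by
    rw [beta_eq] at hv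
    rw [if_neg (by linarith)]
  w_le_wt_add v _ := by
    split_ifs with h
    · rcases smallWeight_cases hx v with ⟨h1, h⟩ | ⟨h1, h2, h⟩ | ⟨h1, h2, h3, h⟩ | ⟨h1, h⟩ <;>
      linarith
    · linarith
  wt_mono := (smallWeight_mono hx hx').monotoneOn _
  wt_le_mul v _ := by have := (smallWeight_le hx hx' v).1; linarith
  wt_le_mul_add v _ := by have := (smallWeight_le hx hx' v).1; linarith
  κ_nonneg := zero_le_one
  κ_le := by rw [beta_eq]; linarith
  wt_le_wE v _ := (smallWeight_le hx hx' v).2.1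
  wE_wQ := by linarith
  wt_le_wQ v _ hv := (smallWeight_le hx hx' v).2.2 (by rw [beta_eq] at hv; linarith)
  four_wQ := by linarith
  κ₁_nonneg := by linarith
  shift a b c hb hab hc hcb h := by
    rw [beta_eq] at h
    obtain ⟨h1, -, h2⟩ := smallWeight_le hx hx' c
    have h2 := h2 (by linarith)
    rcases smallWeight_excess hx a with ha | ⟨ha', ha⟩ <;>
    rcases smallWeight_excess hx b with hb | ⟨hb', hb⟩ <;> linarith
  shift' a b c hb hab hc hcb h := by
    rw [beta_eq] at h
    obtain ⟨h1, -, h2⟩ := smallWeight_le hx hx' c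
    have h2 := h2 (by linarith)
    rcases smallWeight_excess hx a with ha | ⟨ha', ha⟩ <;>
    rcases smallWeight_excess hx b with hb | ⟨hb', hb⟩ <;> linarith
  large a b t hb hab ht htb h := by
    by_contra hcon
    have h1 := (smallWeight_le hx hx' a).2.1
    have h2 := smallWeight_mono hx hx' htb
    have h3 := smallWeight_mono hx hx' (not_le.1 hcon).le
    rcases smallWeight_cases hx (3 / 10) with ⟨k1, k⟩ | ⟨k1, k2, k⟩ | ⟨k1, k2, k3, k⟩ | ⟨k1, k⟩ <;>
    linarith
  final := by rw [beta_eq]; linarith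

theorem largeWeight_excess (v : ℝ) :
    max 0 (largeWeight v - 1 / 4) = 0 ∨
    (60 / 239 ≤ v ∧ max 0 (largeWeight v - 1 / 4) ≤ 11 / 10 * (v - 59 / 239)) := by
  rcases largeWeight_cases v with ⟨h1, h⟩ | ⟨h1, h2, h⟩ | ⟨h1, h2, h⟩ | ⟨h1, h⟩ <;> rw [h]
  · exact Or.inl (max_eq_left (by linarith))
  · exact Or.inl (max_eq_left (by linarith))
  · exact Or.inr ⟨by linarith, max_le (by linarith) (by linarith)⟩
  · exact Or.inr ⟨by linarith, max_le (by linarith) (by linarith)⟩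

theorem largeWeight_le (v : ℝ) :
    largeWeight v ≤ 11 / 10 * v ∧ largeWeight v ≤ 3 / 8 ∧ (v ≤ 60 / 239 → largeWeight v ≤ 1 / 4) ∧
    (59 / 239 < v → largeWeight v ≤ 11 / 10 * v + (1 / 4 - 11 / 10 * (59 / 239))) := by
  rcases largeWeight_cases v with ⟨h1, h⟩ | ⟨h1, h2, h⟩ | ⟨h1, h2, h⟩ | ⟨h1, h⟩ <;>
    rw [h] <;> refine ⟨by linarith, by linarith, fun h0 => by linarith, fun h0 => by linarith⟩

/-- The weights for `1/4 - delta < x`. -/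
noncomputable def largeWeights (x : ℝ) (hx : 59 / 239 < x) : Weights x where
  w v := if 90 / 239 ≤ v then 1 / 2 else largeWeight v
  wt := largeWeight
  θ := 1
  wE := 3 / 8
  wQ := 1 / 4
  wH := 1 / 2
  κ := 11 / 10
  lam := 1 / 4 - 11 / 10 * (59 / 239)
  κ₁ := 36 / 1000
  ex := 1 / 8
  w_zero := by
    rw [if_neg (by norm_num), largeWeight, if_pos (by norm_num)]; norm_num
  wt_zero := by rw [largeWeight, if_pos (by norm_num)]; norm_num
  w_le v := by
    have := (largeWeight_le v).2.1
    split_ifs <;> linarith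
  two_wH := by norm_num
  w_le_wt v _ hv := by
    rw [beta_eq] at hv
    rw [if_neg (by linarith)]
  w_le_wt_add v _ := by
    split_ifs with h
    · rcases largeWeight_cases v with ⟨h1, h⟩ | ⟨h1, h2, h⟩ | ⟨h1, h2, h⟩ | ⟨h1, h⟩ <;> linarith
    · linarith
  wt_mono := largeWeight_mono.monotoneOn _
  wt_le_mul v _ := (largeWeight_le v).1
  wt_le_mul_add v hv := (largeWeight_le v).2.2.2 (hx.trans_le hv)
  κ_nonneg := by norm_num
  κ_le := by rw [beta_eq]; norm_num
  wt_le_wE v _ := (largeWeight_le v).2.1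
  wE_wQ := by norm_num
  wt_le_wQ v _ hv := (largeWeight_le v).2.2.1 (by rw [beta_eq] at hv; linarith)
  four_wQ := by norm_num
  κ₁_nonneg := by norm_num
  shift a b c hb hab hc hcb h := by
    rw [beta_eq] at h
    obtain ⟨h1, -, h2, -⟩ := largeWeight_le c
    have h2 := h2 (by linarith)
    rcases largeWeight_excess a with ha | ⟨ha', ha⟩ <;>
    rcases largeWeight_excess b with hb | ⟨hb', hb⟩ <;> linarith
  shift' a b c hb hab hc hcb h := by
    rw [beta_eq] at h
    obtain ⟨h1, -, h2, -⟩ := largeWeight_le c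
    have h2 := h2 (by linarith)
    rcases largeWeight_excess a with ha | ⟨ha', ha⟩ <;>
    rcases largeWeight_excess b with hb | ⟨hb', hb⟩ <;> linarith
  large a b t hb hab ht htb h := by
    by_contra hcon
    have h1 := (largeWeight_le a).2.1
    have h2 := largeWeight_mono htb
    have h3 := largeWeight_mono (not_le.1 hcon).le
    rcases largeWeight_cases (3 / 10) with ⟨k1, k⟩ | ⟨k1, k2, k⟩ | ⟨k1, k2, k⟩ | ⟨k1, k⟩ <;>
    linarith
  final := by rw [beta_eq]; norm_num

/-- The class k measures the weight in eighths, and each eighth is charged a fixed deduction from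
11/10 of the value. The deduction is exactly what class 4 requires at v = 121/239 = 1/2 + 2δ. -/
theorem exists_class_largeWeights {x : ℝ} (hx : 59 / 239 < x) {v : ℝ} (hv : 0 ≤ v)
    (hv' : v < 121 / 239) : ∃ k : ℕ, (k : ℝ) / 8 ≤ (largeWeights x hx).w v ∧
      11 / 10 * v - k * (1 / 80 + 11 / 20 * (3 / 956)) ≤ (largeWeights x hx).w v := by
  simp only [largeWeights]
  split_ifs with h
  · exact ⟨4, by norm_num, by push_cast; linarith⟩
  rcases largeWeight_cases v with ⟨h1, h⟩ | ⟨h1, h2, h⟩ | ⟨h1, h2, h⟩ | ⟨h1, h⟩ <;> rw [h]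
  · exact ⟨0, by push_cast; linarith, by push_cast; linarith⟩
  · exact ⟨2, by norm_num, by push_cast; linarith⟩
  · exact ⟨2, by push_cast; linarith, by push_cast; linarith⟩
  · exact ⟨3, by norm_num, by push_cast; linarith⟩

/-- If the classes of a unit bundle add up to 8, the eighths alone give weight 1. Otherwise at most
7 deductions are made from 11/10, and 11/10 - 7(1/80 + 11/20 · 3/956) still exceeds 1. -/
theorem one_le_sum_largeWeights {x : ℝ} (hx : 59 / 239 < x) (v : ℕ → ℝ) (S : Finset ℕ)
    (hv : ∀ p ∈ S, 0 ≤ v p ∧ v p < 121 / 239) (hS : ∑ p ∈ S, v p = 1) :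
    1 ≤ ∑ p ∈ S, (largeWeights x hx).w (v p) := by
  choose! k hk hk' using fun p (hp : p ∈ S) => exists_class_largeWeights hx (hv p hp).1 (hv p hp).2
  have h1 := Finset.sum_le_sum hk
  have h2 := Finset.sum_le_sum hk'
  rw [← Finset.sum_div, ← Nat.cast_sum] at h1
  rw [Finset.sum_sub_distrib, ← Finset.mul_sum, ← Finset.sum_mul, ← Nat.cast_sum, hS] at h2
  by_cases h8 : 8 ≤ ∑ p ∈ S, k p
  · have : (8 : ℝ) ≤ ((∑ p ∈ S, k p : ℕ) : ℝ) := by exact_mod_cast h8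
    linarith
  · have : ((∑ p ∈ S, k p : ℕ) : ℝ) ≤ 7 := by exact_mod_cast (by omega : ∑ p ∈ S, k p ≤ 7)
    linarith

theorem sum_pairs (N : ℕ) (f : ℕ → ℝ) :
    ∑ p ∈ Finset.Icc 1 (2 * N), f p = ∑ k ∈ Finset.Icc 1 N, (f k + f (2 * N - k + 1)) := by
  rcases Nat.eq_zero_or_pos N with rfl | hN
  · simp
  rw [Finset.sum_add_distrib, UnitBundles.sum_bags 1 N N le_rfl le_rfl hN f]
  have : Finset.Icc 1 (2 * N) = Finset.Icc 1 N ∪ Finset.Icc (2 * N - N + 1) (2 * N - 1 + 1) := by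
    ext p; simp only [Finset.mem_union, Finset.mem_Icc]; omega
  rw [this, Finset.sum_union (Finset.disjoint_left.2 fun k hk hk' => by
    simp only [Finset.mem_Icc] at hk hk'; omega)]

theorem sum_Icc_pairs {N c : ℕ} (hc : 2 * N ≤ c) {K : Finset ℕ} (hK : K ⊆ Finset.Icc 1 N)
    (f : ℕ → ℝ) : ∑ p ∈ Finset.Icc 1 c, f p =
      (∑ k ∈ Finset.Icc 1 N \ K, (f k + f (2 * N - k + 1)) + ∑ k ∈ K, (f k + f (2 * N - k + 1)))
      + ∑ p ∈ Finset.Icc (2 * N + 1) c, f p := by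
  rw [Finset.sum_sdiff hK, ← sum_pairs]
  have : Finset.Icc 1 c = Finset.Icc 1 (2 * N) ∪ Finset.Icc (2 * N + 1) c := by
    ext p; simp only [Finset.mem_union, Finset.mem_Icc]; omega
  rw [this, Finset.sum_union (Finset.disjoint_left.2 fun k hk hk' => by
    simp only [Finset.mem_Icc] at hk hk'; omega)]

/-- The weights of an agent who values no `B_k` above `1` and good `2N + 1` at least
`1/4 - 5 * delta`, and the weight that she has after the loop over the bags `B_k`. -/
theorem exists_weights {m N : ℕ} {u : Fin m → ℝ} {G : Finset (Fin m)} (h : IsONI u G N)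
    (hB : ∀ k ∈ Finset.Icc 1 N, posVal u G k + posVal u G (2 * N - k + 1) ≤ 1)
    (hx : 1 / 4 - 5 * delta ≤ posVal u G (2 * N + 1)) :
    ∃ W : Weights (posVal u G (2 * N + 1)), ∀ K ⊆ Finset.Icc 1 N,
      (∀ k ∈ K, posVal u G k + posVal u G (2 * N - k + 1) < beta) →
      K.card * W.θ ≤ ∑ k ∈ K, (W.w (posVal u G k) + W.w (posVal u G (2 * N - k + 1)))
        + ∑ p ∈ Finset.Icc (2 * N + 1) G.card, W.w (posVal u G p) := by
  obtain ⟨q, hq⟩ := h.exists_unitBundles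
  have htot := h.total
  rw [value_eq_sum_posVal] at htot
  set v := posVal u G with hv
  set x := v (2 * N + 1) with hxdef
  have hpair := h.pair
  rw [← hv, ← hxdef, beta_eq] at hpair
  have hx' : 56 / 239 ≤ x := by rw [delta_eq] at hx; linarith
  have hc : 2 * N + 1 ≤ G.card := hq.le_of_pos (by rw [← hxdef]; linarith)
  by_cases hxy : x ≤ 59 / 239
  · refine ⟨smallWeights x hx' hxy, fun K hK hKb => ?_⟩
    have h1 : ∑ p ∈ Finset.Icc (2 * N + 1) G.card, (smallWeights x hx' hxy).w (v p)
        = ∑ p ∈ Finset.Icc (2 * N + 1) G.card, v p := by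
      refine Finset.sum_congr rfl fun p hp => ?_
      have h2 : v p ≤ x := hq.anti _ p (by omega) (Finset.mem_Icc.1 hp).1
      simp only [smallWeights]
      rw [if_neg (by linarith), smallWeight, if_pos h2]
    rw [sum_Icc_pairs (by omega) hK] at htot
    have h2 : ∑ k ∈ Finset.Icc 1 N \ K, (v k + v (2 * N - k + 1)) ≤ (N : ℝ) - K.card := by
      have := Finset.sum_le_card_nsmul (Finset.Icc 1 N \ K) _ 1
        fun k hk => hB k (Finset.mem_sdiff.1 hk).1
      rwa [Finset.card_sdiff_of_subset hK, Nat.card_Icc, Nat.add_sub_cancel, nsmul_eq_mul, mul_one,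
        Nat.cast_sub (by simpa using Finset.card_le_card hK)] at this
    -- Both goods of a bag are worth at least x. If the first one reaches β/2, the weights are at
    -- least 2x + x, which suffices as the bag is below β; otherwise each good loses at most (β -
    -- 3x)/2. The bags outside `K` are worth at most 1 each, and goods beyond 2N keep their value as
    -- weight.
    have h3 : ∑ k ∈ K, ((v k + v (2 * N - k + 1)) + (3 * x - 180 / 239))
        ≤ ∑ k ∈ K, ((smallWeights x hx' hxy).w (v k)
          + (smallWeights x hx' hxy).w (v (2 * N - k + 1))) := by
      refine Finset.sum_le_sum fun k hk => ?_
      have hk1 := Finset.mem_Icc.1 (hK hk)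
      have hk2 := hKb k hk
      rw [beta_eq] at hk2
      have h4 : v (2 * N - k + 1) ≤ v k := hq.anti _ _ hk1.1 (by omega)
      have h5 : x ≤ v (2 * N - k + 1) := hq.anti _ _ (by omega) (by omega)
      simp only [smallWeights]
      rcases smallWeight_cases hx' (v k) with ⟨a1, a⟩ | ⟨a1, a2, a⟩ | ⟨a1, a2, a3, a⟩ | ⟨a1, a⟩ <;>
      rcases smallWeight_cases hx' (v (2 * N - k + 1)) with
        ⟨b1, b⟩ | ⟨b1, b2, b⟩ | ⟨b1, b2, b3, b⟩ | ⟨b1, b⟩ <;>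
      rw [a, b] <;> split_ifs <;> linarith
    rw [Finset.sum_add_distrib, Finset.sum_const, nsmul_eq_mul] at h3
    rw [h1]
    have h6 : (smallWeights x hx' hxy).θ = 3 * x + 59 / 239 := rfl
    rw [h6]
    have h7 : (K.card : ℝ) * (3 * x + 59 / 239) = K.card * (3 * x - 180 / 239) + K.card := by ring
    linarith
  · rw [not_le] at hxy
    refine ⟨largeWeights x hxy, fun K hK _ => ?_⟩
    -- The bound on goods 1 and 2N+1 together, with x > 59/239, keeps every good below 180/239 -
    -- 59/239.
    have h1 : ∀ p ∈ Finset.Icc 1 G.card, 0 ≤ v p ∧ v p < 121 / 239 := fun p hp =>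
      ⟨hq.nonneg p, by have := hq.anti 1 p le_rfl (Finset.mem_Icc.1 hp).1; linarith⟩
    have h2 : (N : ℝ) ≤ ∑ p ∈ Finset.Icc 1 G.card, (largeWeights x hxy).w (v p) := by
      rw [← Finset.sum_fiberwise_of_maps_to (fun p hp => Finset.mem_range.2 (hq.lt p hp))]
      have := Finset.card_nsmul_le_sum (Finset.range N)
        (fun j => ∑ p ∈ (Finset.Icc 1 G.card).filter (fun p => q p = j),
          (largeWeights x hxy).w (v p)) 1 fun j hj =>
        one_le_sum_largeWeights hxy v _ (fun p hp => h1 p (Finset.mem_filter.1 hp).1)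
          (hq.sum j (Finset.mem_range.1 hj))
      rwa [Finset.card_range, nsmul_eq_mul, mul_one] at this
    rw [sum_Icc_pairs (by omega) hK fun p => (largeWeights x hxy).w (v p)] at h2
    have h3 : ∑ k ∈ Finset.Icc 1 N \ K, ((largeWeights x hxy).w (v k)
        + (largeWeights x hxy).w (v (2 * N - k + 1))) ≤ (N : ℝ) - K.card := by
      have := Finset.sum_le_card_nsmul (Finset.Icc 1 N \ K) (fun k => (largeWeights x hxy).w (v k)
        + (largeWeights x hxy).w (v (2 * N - k + 1))) 1
        fun k hk => by
          have a := (largeWeights x hxy).w_le (v k)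
          have b := (largeWeights x hxy).w_le (v (2 * N - k + 1))
          have c : 2 * (largeWeights x hxy).wH = 1 := by norm_num [largeWeights]
          linarith
      rwa [Finset.card_sdiff_of_subset hK, Nat.card_Icc, Nat.add_sub_cancel, nsmul_eq_mul, mul_one,
        Nat.cast_sub (by simpa using Finset.card_le_card hK)] at this
    have h4 : (largeWeights x hxy).θ = 1 := rfl
    rw [h4]
    linarith


/-! ### The budget of one agent during bag filling. -/

section Fill

variable {n m : ℕ}

/-- What holds for a remaining agent with valuation `u` in the bag-filling loop. A bag that is given
to another agent `j` costs her at most `τ j` in terms of `f`, and a bag that is too small for her is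
worth less than `σ ≤ τ j`. -/
structure FillInv (u f : Fin m → ℝ) (τ : Fin n → ℝ) (ex σ : ℝ) (S : Finset (Fin m) → Prop)
    (pri : Prop) (P N : Finset (Fin n)) (Q : List (Finset (Fin m))) (F : Finset (Fin m)) :
    Prop where
  total : ∑ j ∈ N, τ j ≤ (Q.map (value f)).sum + value f F + ex
  safe : ∀ D ∈ Q, S D
  safe_insert : ∀ C, S C → value u C < beta → ∀ g ∈ F, g ∉ C → S (insert g C)
  cost : ∀ D, S D → ∀ j, (pri → j ∉ P → value u D < beta) → value f D ≤ τ j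
  tail : Q.Pairwise fun C D => value u C < beta → value f D ≤ σ
  le_cost : ∀ j, σ ≤ τ j
  small : ∀ C, S C → value u C < beta → value f C + ex < σ

variable {u f : Fin m → ℝ} {τ : Fin n → ℝ} {ex σ : ℝ} {S : Finset (Fin m) → Prop}
  {pri : Prop} {P N : Finset (Fin n)} {Q : List (Finset (Fin m))} {F C : Finset (Fin m)}

theorem FillInv.add (h : FillInv u f τ ex σ S pri P N (C :: Q) F) (hu : ∀ g ∈ F, 0 ≤ u g)
    (hC : value u C < beta) {g : Fin m} (hg : g ∈ F) (hgC : g ∉ C) :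
    FillInv u f τ ex σ S pri P N (insert g C :: Q) (F.erase g) where
  total := by
    have h1 := h.total
    rw [List.map_cons, List.sum_cons] at h1 ⊢
    have h2 : value f (insert g C) = f g + value f C := Finset.sum_insert hgC
    have h3 : f g + value f (F.erase g) = value f F := Finset.add_sum_erase F f hg
    linarith
  safe D hD := by
    rcases List.mem_cons.1 hD with rfl | hD
    · exact h.safe_insert C (h.safe C List.mem_cons_self) hC g hg hgC
    · exact h.safe D (List.mem_cons_of_mem _ hD)
  safe_insert C hC hCb a ha := h.safe_insert C hC hCb a (Finset.mem_of_mem_erase ha)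
  cost := h.cost
  tail := by
    have h1 := List.pairwise_cons.1 h.tail
    refine List.pairwise_cons.2 ⟨fun D hD hb => h1.1 D hD (lt_of_le_of_lt ?_ hb), h1.2⟩
    have h2 : value u (insert g C) = u g + value u C := Finset.sum_insert hgC
    have h3 := hu g hg
    linarith
  le_cost := h.le_cost
  small := h.small

theorem FillInv.give (h : FillInv u f τ ex σ S pri P N (C :: Q) F) {j : Fin n} (hj : j ∈ N)
    (hpri : pri → j ∉ P → value u C < beta) :
    FillInv u f τ ex σ S pri P (N.erase j) Q F where
  total := by
    have h1 := h.total
    rw [List.map_cons, List.sum_cons] at h1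
    have h2 := Finset.add_sum_erase N τ hj
    have h3 := h.cost C (h.safe C List.mem_cons_self) j hpri
    linarith
  safe D hD := h.safe D (List.mem_cons_of_mem _ hD)
  safe_insert := h.safe_insert
  cost := h.cost
  tail := (List.pairwise_cons.1 h.tail).2
  le_cost := h.le_cost
  small := h.small

/-- With no goods left, the current bag plus the error `ex` is below `σ`, and the later bags are at
most `σ` each. So the total is below `σ` times the number of remaining agents, whereas their
allotments are at least `σ` each. -/
theorem FillInv.nonempty (h : FillInv u f τ ex σ S pri P N (C :: Q) F)
    (hC : value u C < beta) (hlen : (C :: Q).length = N.card) : F.Nonempty := by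
  rw [Finset.nonempty_iff_ne_empty]
  rintro rfl
  have h1 := h.total
  rw [List.map_cons, List.sum_cons] at h1
  have h2 : (Q.map (value f)).sum ≤ Q.length * σ := by
    have := List.sum_le_card_nsmul (Q.map (value f)) σ fun b hb => by
      obtain ⟨D, hD, rfl⟩ := List.mem_map.1 hb
      exact (List.pairwise_cons.1 h.tail).1 D hD hC
    rwa [List.length_map, nsmul_eq_mul] at this
  have h3 : (N.card : ℝ) * σ ≤ ∑ j ∈ N, τ j := by
    rw [← nsmul_eq_mul]
    exact Finset.card_nsmul_le_sum _ _ _ fun j _ => h.le_cost j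
  have h4 := h.small C (h.safe C List.mem_cons_self) hC
  have h5 : value f (∅ : Finset (Fin m)) = 0 := Finset.sum_empty
  rw [← hlen, List.length_cons] at h3
  push_cast at h3
  linarith

theorem beta_pos : 0 < beta := by norm_num [beta_eq]

/-- The invariant for bags that are all too small for the agent at the beginning. -/
theorem fillInv_of_small (pri : Prop) (P : Finset (Fin n)) (hQ : ∀ D ∈ Q, value u D < beta)
    (htot : ∑ j ∈ N, τ j ≤ (Q.map (value u)).sum + value u F)
    (hτ : ∀ j, beta ≤ τ j ∧ ((∀ g ∈ F, u g ≤ τ j - beta) ∨ (pri ∧ j ∉ P))) :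
    FillInv u u τ 0 beta (fun D => ∀ j, (pri → j ∉ P → value u D < beta) → value u D ≤ τ j)
      pri P N Q F where
  total := by linarith
  safe D hD j _ := (hQ D hD).le.trans (hτ j).1
  safe_insert C _ hCb g hg hgC j hj := by
    rcases (hτ j).2 with h1 | h1
    · have h2 : value u (insert g C) = u g + value u C := Finset.sum_insert hgC
      have h3 := h1 g hg
      linarith
    · exact (hj h1.1 h1.2).le.trans (hτ j).1
  cost D hD := hD
  tail := List.pairwise_of_forall_mem_list fun C _ D hD _ => (hQ D hD).le
  le_cost j := (hτ j).1
  small C _ hCb := by linarith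

/-- The invariant for an agent with priority, with a rough bound for the bags given to agents with
priority. -/
theorem fillInv_of_priority (P : Finset (Fin n)) (hpri : pri) (hQ : ∀ D ∈ Q, value u D ≤ 4 * beta)
    (hF : ∀ g ∈ F, u g ≤ beta)
    (htail : Q.Pairwise fun C D => value u C < beta → value u D ≤ 5 * beta / 4)
    (htot : ∑ j ∈ N, (if j ∈ P then 4 * beta else 5 * beta / 4)
      ≤ (Q.map (value u)).sum + value u F) :
    FillInv u u (fun j => if j ∈ P then 4 * beta else 5 * beta / 4) 0 (5 * beta / 4)
      (fun D => value u D ≤ 4 * beta) pri P N Q F where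
  total := by linarith
  safe := hQ
  safe_insert C _ hCb g hg hgC := by
    have h2 : value u (insert g C) = u g + value u C := Finset.sum_insert hgC
    have h3 := hF g hg
    have h4 := beta_pos
    linarith
  cost D hD j hj := by
    split_ifs with hjP
    · exact hD
    · have h4 := beta_pos
      have := hj hpri hjP
      linarith
  tail := htail
  le_cost j := by
    have h4 := beta_pos
    split_ifs <;> linarith
  small C _ hCb := by
    have h4 := beta_pos
    linarith

/-- The invariant in terms of weights. -/
theorem fillInv_of_weights {x : ℝ} (W : Weights x) {pri : Prop} (P : Finset (Fin n))
    (hQ : ∀ D ∈ Q, value (fun g => W.wt (u g)) D ≤ W.θ ∧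
      value (fun g => W.wt (u g)) D ≤ W.κ * value u D + 2 * W.lam)
    (hF : ∀ g ∈ F, 0 ≤ u g ∧ u g ≤ beta / 4)
    (htot : N.card * W.θ ≤ (Q.map (value fun g => W.wt (u g))).sum
      + value (fun g => W.wt (u g)) F + (W.ex + W.κ₁)) :
    FillInv u (fun g => W.wt (u g)) (fun _ => W.θ) (W.ex + W.κ₁) W.θ
      (fun D => value (fun g => W.wt (u g)) D ≤ W.θ ∧
      value (fun g => W.wt (u g)) D ≤ W.κ * value u D + 2 * W.lam) pri P N Q F where
  total := by rwa [Finset.sum_const, nsmul_eq_mul]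
  safe := hQ
  safe_insert C hC hCb g hg hgC := by
    have h1 : value u (insert g C) = u g + value u C := Finset.sum_insert hgC
    have h2 : value (fun g => W.wt (u g)) (insert g C)
      = W.wt (u g) + value (fun g => W.wt (u g)) C := Finset.sum_insert hgC
    have h3 := W.wt_le_mul _ (hF g hg).1
    have h4 : value (fun g => W.wt (u g)) (insert g C)
        ≤ W.κ * value u (insert g C) + 2 * W.lam := by
      rw [h1, h2, mul_add]; linarith [hC.2]
    -- The bag was below `beta` and the new good is at most `beta / 4`.
    refine ⟨h4.trans (le_trans ?_ W.κ_le), h4⟩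
    have h5 : W.κ * value u (insert g C) ≤ W.κ * (5 * beta / 4) :=
      mul_le_mul_of_nonneg_left (by rw [h1]; linarith [(hF g hg).2]) W.κ_nonneg
    linarith
  cost D hD j _ := hD.1
  tail := List.pairwise_of_forall_mem_list fun C _ D hD _ => (hQ D hD).1
  le_cost j := le_rfl
  small C hC hCb := by
    have h1 : W.κ * value u C ≤ W.κ * beta := mul_le_mul_of_nonneg_left hCb.le W.κ_nonneg
    have h2 := W.final
    linarith [hC.2]

end Fill

/-! ### Weights under R₅, R₂ and R₃. -/

section WeightInvariants

variable {m : ℕ} {x : ℝ}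

theorem Weights.ex_nonneg (W : Weights x) : 0 ≤ W.ex := by
  have := W.w_le_wt_add 0 le_rfl
  rw [W.w_zero, W.wt_zero] at this
  linarith

theorem Weights.wQ_nonneg (W : Weights x) : 0 ≤ W.wQ := by
  have := W.wt_le_wQ 0 le_rfl (by have := beta_pos; linarith)
  rwa [W.wt_zero] at this

/-- The part of the weight above `wQ`. -/
noncomputable def Weights.excess (W : Weights x) (v : ℝ) : ℝ := max 0 (W.wt v - W.wQ)

theorem Weights.min_add_excess (W : Weights x) (v : ℝ) :
    min (W.wt v) W.wQ + W.excess v = W.wt v := by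
  rw [Weights.excess]
  rcases le_total (W.wt v) W.wQ with h | h
  · rw [min_eq_left h, max_eq_left (by linarith), add_zero]
  · rw [min_eq_right h, max_eq_right (by linarith)]; ring

theorem Weights.excess_eq_zero (W : Weights x) {v : ℝ} (h0 : 0 ≤ v) (h : v ≤ beta / 3) :
    W.excess v = 0 := max_eq_left (by linarith [W.wt_le_wQ v h0 h])

/-- The weight of the goods in `G`, in which the goods beyond position `2 * d` count at most
`wQ`. -/
noncomputable def Weights.capped (W : Weights x) (u : Fin m → ℝ) (G : Finset (Fin m)) (d : ℕ) : ℝ :=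
  value (fun g => min (W.wt (u g)) W.wQ) G
    + ∑ p ∈ Finset.Icc 1 (2 * d), W.excess (posVal u G p)

/-- The invariant of the loop that gives away pairs of goods. -/
structure PairsInv (W : Weights x) (u : Fin m → ℝ) (G : Finset (Fin m)) (d : ℕ) : Prop where
  total : d * W.θ ≤ value (fun g => W.w (u g)) G
  low : x ≤ posVal u G (2 * d)
  next : posVal u G (2 * d + 1) < beta / 3

/-- The invariant of the loop that applies `R₂` and `R₃`. -/
structure RulesInv (W : Weights x) (u : Fin m → ℝ) (G : Finset (Fin m)) (d : ℕ) : Prop where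
  low : x ≤ posVal u G (2 * d)
  capped : d * W.θ ≤ W.capped u G d + (W.ex + W.κ₁)
  -- This keeps `κ₁` from being charged twice. Either the uncapped weight has not yet suffered that
  -- error, or the goods up to position 2d are so large that R₃ causes no further one, or no later
  -- rule application leaves an agent to worry about.
  full : d * W.θ ≤ value (fun g => W.wt (u g)) G + W.ex ∨ 3 / 10 ≤ posVal u G (2 * d) ∨ d ≤ 1

variable {W : Weights x} {u : Fin m → ℝ} {G : Finset (Fin m)} {d : ℕ}

theorem le_card_of_posVal_pos {p : ℕ} (h : 0 < posVal u G p) : p ≤ G.card := by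
  by_contra hp
  exact h.ne' (posVal_of_card_lt u (not_le.1 hp))

/-- Dropping the first two goods shifts positions by two, exactly as `2 * d` drops by two, so `low`
and `next` speak of the same goods as before. -/
theorem PairsInv.give (h : PairsInv W u G (d + 1)) (hx : 0 < x) (hd : 0 < d) : PairsInv W u (G \ goodsAt G {1, 2}) d := by
  have hcard : 2 * (d + 1) ≤ G.card := le_card_of_posVal_pos (hx.trans_le h.low)
  have hset : ({1, 2} : Finset ℕ) = Finset.Icc 1 2 := rfl
  refine ⟨?_, ?_, ?_⟩
  · rw [value_sdiff _ (goodsAt_subset _ _), value_goodsAt, Finset.sum_pair (by norm_num),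
      posVal_comp W.w_zero le_rfl, posVal_comp W.w_zero (by norm_num)]
    have h1 := h.total
    push_cast at h1
    have h2 := W.w_le (posVal u G 1)
    have h3 := W.w_le (posVal u G 2)
    have h4 := W.two_wH
    linarith
  · rw [hset, posVal_sdiff_prefix u (by omega) (by omega)]
    exact h.low
  · rw [hset, posVal_sdiff_prefix u (by omega) (by omega)]
    exact h.next

/-- Every good beyond position 2d is worth at most β/3 and has no excess over `wQ`, so capping does
nothing. -/
theorem Weights.capped_eq (W : Weights x) (hu : OrderedOn u G)
    (h : posVal u G (2 * d + 1) ≤ beta / 3) :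
    W.capped u G d = value (fun g => W.wt (u g)) G := by
  have h1 : value (fun g => W.wt (u g)) G = value (fun g => min (W.wt (u g)) W.wQ) G
      + ∑ p ∈ Finset.Icc 1 G.card, W.excess (posVal u G p) := by
    have h0 : W.excess 0 = 0 := W.excess_eq_zero le_rfl (by have := beta_pos; linarith)
    rw [← Finset.sum_congr rfl fun p hp => posVal_comp (u := u) (M := G) h0
      (Finset.mem_Icc.1 hp).1, ← value_eq_sum_posVal, value, value, value, ← Finset.sum_add_distrib]
    exact Finset.sum_congr rfl fun g _ => (W.min_add_excess _).symm
  rw [Weights.capped, h1]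
  congr 1
  have h2 : ∀ a b : ℕ, a ≤ b → (∀ p ∈ Finset.Icc 1 b, p ∉ Finset.Icc 1 a →
      W.excess (posVal u G p) = 0) → ∑ p ∈ Finset.Icc 1 a, W.excess (posVal u G p)
        = ∑ p ∈ Finset.Icc 1 b, W.excess (posVal u G p) := fun a b hab hz =>
    Finset.sum_subset (Finset.Icc_subset_Icc_right hab) hz
  rcases le_total (2 * d) G.card with hle | hle
  · refine h2 _ _ hle fun p hp hp' => W.excess_eq_zero (hu.posVal_nonneg p) (le_trans ?_ h)
    rw [Finset.mem_Icc] at hp hp'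
    exact hu.posVal_anti (by omega) (by omega)
  · refine (h2 _ _ hle fun p hp hp' => ?_).symm
    rw [Finset.mem_Icc] at hp hp'
    rw [posVal_of_card_lt u (by omega)]
    exact W.excess_eq_zero le_rfl (by have := beta_pos; linarith)

/-- Only good 1 can reach β/2; for all others `w` is already below `wt`, so `ex` is paid for one
good. -/
theorem PairsInv.exit (h : PairsInv W u G d) (hu : OrderedOn u G)
    (h12 : posVal u G 1 + posVal u G 2 < beta) : RulesInv W u G d := by
  have key : d * W.θ ≤ value (fun g => W.wt (u g)) G + W.ex := by
    refine h.total.trans ?_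
    rcases G.eq_empty_or_nonempty with rfl | hne
    · have := W.ex_nonneg
      simpa [value] using this
    obtain ⟨a, ha, har⟩ := exists_rank_eq (M := G) le_rfl (Finset.card_pos.2 hne)
    rw [value, value, ← Finset.add_sum_erase _ _ ha, ← Finset.add_sum_erase _ _ ha]
    have h1 := W.w_le_wt_add (u a) (hu.nonneg a ha)
    have h2 : ∑ g ∈ G.erase a, W.w (u g) ≤ ∑ g ∈ G.erase a, W.wt (u g) := by
      refine Finset.sum_le_sum fun g hg => ?_
      obtain ⟨hga, hgG⟩ := Finset.mem_erase.1 hg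
      refine W.w_le_wt _ (hu.nonneg g hgG) ?_
      have h3 : 2 ≤ rank G g := by
        have h4 := one_le_rank hgG
        rcases h4.eq_or_lt with h5 | h5
        · exact absurd (rank_injOn G hgG ha (by rw [har, ← h5])) hga
        · exact h5
      have h6 := hu.le_posVal hgG (by norm_num) h3
      have h7 := hu.posVal_anti (p := 1) (q := 2) le_rfl (by norm_num)
      linarith
    linarith
  refine ⟨h.low, ?_, Or.inl key⟩
  rw [W.capped_eq hu h.next.le]
  linarith [W.κ₁_nonneg]

theorem posVal_sdiff_of_le (u : Fin m → ℝ) {S : Finset (Fin m)} {r : ℕ}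
    (hS : ∀ g ∈ S, g ∈ G → r < rank G g) {p : ℕ} (hp : p ≤ r) :
    posVal u (G \ S) p = posVal u G p := by
  rw [posVal, posVal, goodsAt_sdiff_of_le hS]
  intro q hq
  rw [Finset.mem_singleton] at hq
  omega

theorem lt_rank_of_mem_goodsAt_Icc {a b : ℕ} {r : ℕ} (hr : r < a) :
    ∀ g ∈ goodsAt G (Finset.Icc a b), g ∈ G → r < rank G g := fun g hg _ => by
  have := Finset.mem_Icc.1 (mem_goodsAt.1 hg).2
  omega

/-- Besides the removed goods, the excess of positions 2d+1 and 2d+2 is lost, because the uncapped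
range shrinks by two when an agent leaves. -/
theorem Weights.capped_sdiff (W : Weights x) (u : Fin m → ℝ) {a b : ℕ} (ha : 2 * d < a) :
    W.capped u (G \ goodsAt G (Finset.Icc a b)) d
      = W.capped u G (d + 1) - (∑ p ∈ Finset.Icc a b, min (W.wt (posVal u G p)) W.wQ)
        - W.excess (posVal u G (2 * d + 1)) - W.excess (posVal u G (2 * d + 2)) := by
  have h0 : min (W.wt 0) W.wQ = 0 := by rw [W.wt_zero]; exact min_eq_left W.wQ_nonneg
  have h1 : value (fun g => min (W.wt (u g)) W.wQ) (goodsAt G (Finset.Icc a b))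
      = ∑ p ∈ Finset.Icc a b, min (W.wt (posVal u G p)) W.wQ := by
    rw [value_goodsAt]
    exact Finset.sum_congr rfl fun p hp => posVal_comp (w := fun v => min (W.wt v) W.wQ) h0
      (by have := (Finset.mem_Icc.1 hp).1; omega)
  have h2 : ∑ p ∈ Finset.Icc 1 (2 * d),
      W.excess (posVal u (G \ goodsAt G (Finset.Icc a b)) p)
      = ∑ p ∈ Finset.Icc 1 (2 * d), W.excess (posVal u G p) :=
    Finset.sum_congr rfl fun p hp => by
      rw [posVal_sdiff_of_le u (lt_rank_of_mem_goodsAt_Icc ha) (Finset.mem_Icc.1 hp).2]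
  rw [Weights.capped, Weights.capped, value_sdiff _ (goodsAt_subset _ _), h1, h2,
    show 2 * (d + 1) = 2 * d + 1 + 1 by ring, Finset.sum_Icc_succ_top (by omega),
    Finset.sum_Icc_succ_top (by omega)]
  ring

/-- The excess lost belongs to two of the removed goods themselves, so the capped loss is at most 2
`wE` + `wQ`. This is why capping is needed: three uncapped goods could weigh more than `θ`. When
they do, `W.large` supplies the bound 3/10, which the earlier positions inherit. -/
theorem RulesInv.two (h : RulesInv W u G (d + 1)) (hu : OrderedOn u G) (hd : 0 < d) :
    RulesInv W u (G \ goodsAt G (Finset.Icc (2 * d + 1) (2 * d + 3))) d := by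
  have hlow := hu.posVal_anti (p := 2 * d) (q := 2 * d + 2) (by omega) (by omega)
  have hab := hu.posVal_anti (p := 2 * d + 1) (q := 2 * d + 2) (by omega) (by omega)
  have hbt := hu.posVal_anti (p := 2 * d + 2) (q := 2 * d + 3) (by omega) (by omega)
  have h0 := hu.posVal_nonneg (2 * d + 3)
  have hIcc : Finset.Icc (2 * d + 1) (2 * d + 3) = {2 * d + 1, 2 * d + 2, 2 * d + 3} := by
    ext p; simp only [Finset.mem_Icc, Finset.mem_insert, Finset.mem_singleton]; omega
  have hsum : ∀ f : ℕ → ℝ, ∑ p ∈ Finset.Icc (2 * d + 1) (2 * d + 3), f p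
      = f (2 * d + 1) + f (2 * d + 2) + f (2 * d + 3) := fun f => by
    rw [hIcc, Finset.sum_insert (by simp), Finset.sum_pair (by omega)]; ring
  have hpos : posVal u (G \ goodsAt G (Finset.Icc (2 * d + 1) (2 * d + 3))) (2 * d)
      = posVal u G (2 * d) :=
    posVal_sdiff_of_le u (lt_rank_of_mem_goodsAt_Icc (Nat.lt_succ_self _)) le_rfl
  obtain ⟨h1, h2, h3⟩ := h
  rw [show 2 * (d + 1) = 2 * d + 2 by ring] at h1 h3
  push_cast at h2 h3
  refine ⟨by rw [hpos]; linarith, ?_, ?_⟩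
  · rw [W.capped_sdiff u (Nat.lt_succ_self _), hsum]
    have h4 := W.min_add_excess (posVal u G (2 * d + 1))
    have h5 := W.min_add_excess (posVal u G (2 * d + 2))
    have h6 := W.wt_le_wE _ (hu.posVal_nonneg (2 * d + 1))
    have h7 := W.wt_le_wE _ (hu.posVal_nonneg (2 * d + 2))
    have h8 := min_le_right (W.wt (posVal u G (2 * d + 3))) W.wQ
    have h9 := W.wE_wQ
    linarith
  · rw [hpos]
    rcases h3 with h3 | h3 | h3
    · by_cases hbig : W.θ < W.wt (posVal u G (2 * d + 1)) + W.wt (posVal u G (2 * d + 2))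
          + W.wt (posVal u G (2 * d + 3))
      · right; left
        exact (W.large _ _ _ h1 hab h0 hbt hbig).trans hlow
      · left
        rw [value_sdiff _ (goodsAt_subset _ _), value_goodsAt, hsum,
          posVal_comp W.wt_zero (by omega), posVal_comp W.wt_zero (by omega),
          posVal_comp W.wt_zero (by omega)]
        linarith
    · right; left; linarith
    · exact absurd h3 (by omega)

/-- With R₂ not applicable, goods from position 2d+3 on are at most β/3, so the capped weight equals
the full one. The new capped bound therefore starts from the full bound, and pays `κ₁` by `W.shift`,
or nothing by `W.shift'` when the 3/10 alternative holds. -/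
theorem RulesInv.three (h : RulesInv W u G (d + 1)) (hu : OrderedOn u G) (hd : 0 < d)
    (hR2 : posVal u G (2 * d + 1) + posVal u G (2 * d + 2) + posVal u G (2 * d + 3) < beta) :
    RulesInv W u (G \ goodsAt G (Finset.Icc (3 * d + 1) (3 * d + 4))) d := by
  have hlow := hu.posVal_anti (p := 2 * d) (q := 2 * d + 2) (by omega) (by omega)
  have hab := hu.posVal_anti (p := 2 * d + 1) (q := 2 * d + 2) (by omega) (by omega)
  have hbt := hu.posVal_anti (p := 2 * d + 2) (q := 2 * d + 3) (by omega) (by omega)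
  have h0 := hu.posVal_nonneg (2 * d + 3)
  have hIcc : Finset.Icc (3 * d + 1) (3 * d + 4)
      = {3 * d + 1, 3 * d + 2, 3 * d + 3, 3 * d + 4} := by
    ext p; simp only [Finset.mem_Icc, Finset.mem_insert, Finset.mem_singleton]; omega
  have hsum : ∀ f : ℕ → ℝ, ∑ p ∈ Finset.Icc (3 * d + 1) (3 * d + 4), f p
      = f (3 * d + 1) + f (3 * d + 2) + f (3 * d + 3) + f (3 * d + 4) := fun f => by
    rw [hIcc, Finset.sum_insert (by simp), Finset.sum_insert (by simp),
      Finset.sum_pair (by omega)]; ring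
  have hpos : posVal u (G \ goodsAt G (Finset.Icc (3 * d + 1) (3 * d + 4))) (2 * d)
      = posVal u G (2 * d) :=
    posVal_sdiff_of_le u (lt_rank_of_mem_goodsAt_Icc (by omega)) le_rfl
  have hfull := W.capped_eq (d := d + 1) hu (by
    rw [show 2 * (d + 1) + 1 = 2 * d + 3 by ring]; linarith)
  have hle : ∀ p, 2 * d + 3 ≤ p → W.wt (posVal u G p) ≤ W.wt (posVal u G (2 * d + 3)) :=
    fun p hp => W.wt_mono (hu.posVal_nonneg p) h0 (hu.posVal_anti (by omega) hp)
  have hc : W.wt (posVal u G (2 * d + 3)) ≤ W.wQ := W.wt_le_wQ _ h0 (by linarith)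
  obtain ⟨h1, h2, h3⟩ := h
  rw [show 2 * (d + 1) = 2 * d + 2 by ring] at h1 h3
  push_cast at h2 h3
  refine ⟨by rw [hpos]; linarith, ?_, ?_⟩
  · rw [W.capped_sdiff u (by omega), hsum, hfull]
    rw [hfull] at h2
    have m1 := min_le_right (W.wt (posVal u G (3 * d + 1))) W.wQ
    have m2 := (min_le_left (W.wt (posVal u G (3 * d + 2))) W.wQ).trans (hle _ (by omega))
    have m3 := (min_le_left (W.wt (posVal u G (3 * d + 3))) W.wQ).trans (hle _ (by omega))
    have m4 := (min_le_left (W.wt (posVal u G (3 * d + 4))) W.wQ).trans (hle _ (by omega))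
    rcases h3 with h3 | h3 | h3
    · have := W.shift _ _ _ h1 hab h0 hbt hR2
      simp only [Weights.excess]
      linarith
    · have := W.shift' _ _ _ h3 hab h0 hbt hR2
      simp only [Weights.excess]
      linarith
    · exact absurd h3 (by omega)
  · rw [hpos]
    rcases h3 with h3 | h3 | h3
    · rcases Nat.lt_or_ge 1 d with hd1 | hd1
      · left
        rw [value_sdiff _ (goodsAt_subset _ _), value_goodsAt, hsum,
          posVal_comp W.wt_zero (by omega), posVal_comp W.wt_zero (by omega),
          posVal_comp W.wt_zero (by omega), posVal_comp W.wt_zero (by omega)]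
        have m1 := hle (3 * d + 1) (by omega)
        have m2 := hle (3 * d + 2) (by omega)
        have m3 := hle (3 * d + 3) (by omega)
        have m4 := hle (3 * d + 4) (by omega)
        have := W.four_wQ
        linarith
      · exact Or.inr (Or.inr hd1)
    · right; left; linarith
    · exact absurd h3 (by omega)

end WeightInvariants

/-! ### The bags C_k. -/

section TripleBags

variable {n m : ℕ} (J : Instance n m)

theorem value_bagC (f : Fin m → ℝ) {k : ℕ} (hk : k ∈ Finset.Icc 1 J.agents.card) :
    value f (J.bagC k) = posVal f J.goods k + posVal f J.goods (2 * J.agents.card - k + 1)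
      + posVal f J.goods (2 * J.agents.card + k) := by
  rw [Finset.mem_Icc] at hk
  rw [Instance.bagC, value_goodsAt, Finset.sum_insert, Finset.sum_pair, add_assoc]
  · omega
  · simp only [Finset.mem_insert, Finset.mem_singleton]; omega

/-- The bags `C_k` in the order of their indices. -/
def bagsC : List (Finset (Fin m)) := (List.range J.agents.card).map fun k => J.bagC (k + 1)

/-- The goods beyond position `3 * n`. -/
def laterGoods : Finset (Fin m) :=
  J.goods.filter fun g => 3 * J.agents.card < rank J.goods g

theorem mem_bagsC {D : Finset (Fin m)} :
    D ∈ bagsC J ↔ ∃ k ∈ Finset.Icc 1 J.agents.card, D = J.bagC k := by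
  simp only [bagsC, List.mem_map, List.mem_range, Finset.mem_Icc]
  constructor
  · rintro ⟨k, hk, rfl⟩
    exact ⟨k + 1, by omega, rfl⟩
  · rintro ⟨k, hk, rfl⟩
    exact ⟨k - 1, by omega, by rw [Nat.sub_add_cancel hk.1]⟩

theorem sum_bagsC (f : Fin m → ℝ) :
    ((bagsC J).map (value f)).sum + value f (laterGoods J) = value f J.goods := by
  set d := J.agents.card with hd
  have h1 : ((bagsC J).map (value f)).sum = ∑ k ∈ Finset.Icc 1 d, value f (J.bagC k) := by
    rw [bagsC, List.map_map, Finset.sum_bij' (i := fun k _ => k - 1) (j := fun k _ => k + 1)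
      (t := Finset.range d) (g := fun k => value f (J.bagC (k + 1)))]
    · rfl
    · intro k hk; rw [Finset.mem_Icc] at hk; rw [Finset.mem_range]; omega
    · intro k hk; rw [Finset.mem_range] at hk; rw [Finset.mem_Icc]; omega
    · intro k hk; rw [Finset.mem_Icc] at hk; omega
    · intro k hk; omega
    · intro k hk; rw [Finset.mem_Icc] at hk; rw [Nat.sub_add_cancel hk.1]
  have h2 : ∑ k ∈ Finset.Icc 1 d, value f (J.bagC k)
      = ∑ p ∈ Finset.Icc 1 (3 * d), posVal f J.goods p := by
    rw [Finset.sum_congr rfl fun k hk => value_bagC J f hk, Finset.sum_add_distrib, ← sum_pairs]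
    have h3 : Finset.Icc 1 (3 * d) = Finset.Icc 1 (2 * d) ∪ Finset.Icc (2 * d + 1) (3 * d) := by
      ext p; simp only [Finset.mem_union, Finset.mem_Icc]; omega
    rw [h3, Finset.sum_union (Finset.disjoint_left.2 fun k hk hk' => by
      simp only [Finset.mem_Icc] at hk hk'; omega)]
    congr 1
    refine Finset.sum_nbij' (fun k => 2 * d + k) (fun p => p - 2 * d) ?_ ?_ ?_ ?_ (fun k _ => rfl)
    all_goals
      intro k hk
      try simp only [Finset.mem_Icc] at hk ⊢
      try omega
  have h4 : J.goods \ goodsAt J.goods (Finset.Icc 1 (3 * d)) = laterGoods J := by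
    ext g
    simp only [laterGoods, Finset.mem_sdiff, mem_goodsAt, Finset.mem_filter, Finset.mem_Icc,
      not_and, not_le]
    constructor
    · rintro ⟨hg, h⟩
      exact ⟨hg, h hg (one_le_rank hg)⟩
    · rintro ⟨hg, h⟩
      exact ⟨hg, fun _ _ => h⟩
  rw [h1, h2, ← value_goodsAt, ← h4, value_sdiff _ (goodsAt_subset _ _)]
  ring

theorem bagC_disjoint {j k : ℕ} (hj : j ∈ Finset.Icc 1 J.agents.card)
    (hk : k ∈ Finset.Icc 1 J.agents.card) (hjk : j ≠ k) : Disjoint (J.bagC j) (J.bagC k) := by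
  refine goodsAt_disjoint (Finset.disjoint_left.2 fun p hp hp' => ?_)
  simp only [Finset.mem_Icc, Finset.mem_insert, Finset.mem_singleton] at hj hk hp hp'
  omega

theorem bagC_disjoint_laterGoods {k : ℕ} (hk : k ∈ Finset.Icc 1 J.agents.card) :
    Disjoint (J.bagC k) (laterGoods J) := by
  refine Finset.disjoint_left.2 fun g hg hg' => ?_
  have h1 := (mem_goodsAt.1 hg).2
  have h2 := (Finset.mem_filter.1 hg').2
  simp only [Finset.mem_Icc, Finset.mem_insert, Finset.mem_singleton] at hk h1
  omega

theorem pairwise_bagsC {R : Finset (Fin m) → Finset (Fin m) → Prop}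
    (h : ∀ j ∈ Finset.Icc 1 J.agents.card, ∀ k ∈ Finset.Icc 1 J.agents.card, j < k →
      R (J.bagC j) (J.bagC k)) : (bagsC J).Pairwise R := by
  rw [bagsC, List.pairwise_map]
  refine List.Pairwise.imp_of_mem ?_ List.pairwise_lt_range
  intro a b ha hb hab
  rw [List.mem_range] at ha hb
  exact h _ (Finset.mem_Icc.2 (by omega)) _ (Finset.mem_Icc.2 (by omega)) (by omega)

variable {u : Fin m → ℝ} {x : ℝ} {W : Weights x}

theorem le_posVal_of_mem_laterGoods (hu : OrderedOn u J.goods) {g : Fin m}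
    (hg : g ∈ laterGoods J) : u g ≤ posVal u J.goods (3 * J.agents.card + 1) := by
  obtain ⟨h1, h2⟩ := Finset.mem_filter.1 hg
  exact hu.le_posVal h1 (by omega) h2

/-- R₂ not applicable puts goods beyond 2d below β/3, so capping disappears and C_k weighs at most 2
`wE` + `wQ`. R₃ not applicable puts goods beyond 3d below β/4, as filling requires. -/
theorem RulesInv.exit {pri : Prop} (P : Finset (Fin n))
    (h : RulesInv W u J.goods J.agents.card) (hu : OrderedOn u J.goods)
    (hN : 0 < J.agents.card) (hR2 : value u (J.ruleGoods 2) < beta)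
    (hR3 : value u (J.ruleGoods 3) < beta) :
    FillInv u (fun g => W.wt (u g)) (fun _ => W.θ) (W.ex + W.κ₁) W.θ
      (fun D => value (fun g => W.wt (u g)) D ≤ W.θ ∧
      value (fun g => W.wt (u g)) D ≤ W.κ * value u D + 2 * W.lam) pri P J.agents (bagsC J)
      (laterGoods J) := by
  rw [value_ruleGoods_two _ _ hN] at hR2
  rw [value_ruleGoods_three _ _ hN] at hR3
  set d := J.agents.card with hd
  have h1 := hu.posVal_anti (p := 2 * d - 1) (q := 2 * d) (by omega) (by omega)
  have h2 := hu.posVal_anti (p := 2 * d) (q := 2 * d + 1) (by omega) (by omega)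
  have h3 := hu.posVal_anti (p := 3 * d - 2) (q := 3 * d + 1) (by omega) (by omega)
  have h4 := hu.posVal_anti (p := 3 * d - 1) (q := 3 * d + 1) (by omega) (by omega)
  have h5 := hu.posVal_anti (p := 3 * d) (q := 3 * d + 1) (by omega) (by omega)
  refine fillInv_of_weights W P (fun D hD => ?_) (fun g hg => ⟨hu.nonneg g
    (Finset.mem_filter.1 hg).1, (le_posVal_of_mem_laterGoods J hu hg).trans (by linarith)⟩) ?_
  · obtain ⟨k, hk, rfl⟩ := (mem_bagsC J).1 hD
    rw [value_bagC J _ hk, value_bagC J _ hk]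
    rw [Finset.mem_Icc] at hk
    rw [posVal_comp W.wt_zero (by omega), posVal_comp W.wt_zero (by omega),
      posVal_comp W.wt_zero (by omega), ← hd]
    have a1 := h.low.trans (hu.posVal_anti (p := k) (q := 2 * d) (by omega) (by omega))
    have a2 := h.low.trans (hu.posVal_anti (p := 2 * d - k + 1) (q := 2 * d) (by omega) (by omega))
    have a3 := hu.posVal_anti (p := 2 * d + 1) (q := 2 * d + k) (by omega) (by omega)
    have b1 := W.wt_le_wE _ (hu.posVal_nonneg k)
    have b2 := W.wt_le_wE _ (hu.posVal_nonneg (2 * d - k + 1))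
    have b3 := W.wt_le_wQ _ (hu.posVal_nonneg (2 * d + k)) (by linarith)
    have c1 := W.wt_le_mul_add _ a1
    have c2 := W.wt_le_mul_add _ a2
    have c3 := W.wt_le_mul _ (hu.posVal_nonneg (2 * d + k))
    have := W.wE_wQ
    refine ⟨by linarith, ?_⟩
    rw [mul_add, mul_add]
    linarith
  · have h6 := h.capped
    rw [W.capped_eq hu (by linarith)] at h6
    rwa [sum_bagsC J]

theorem priority_fillInv {pri : Prop} (P : Finset (Fin n)) (hpri : pri) (hu : OrderedOn u J.goods)
    (h1 : posVal u J.goods 1 ≤ beta) (h12 : posVal u J.goods 1 + posVal u J.goods 2 < beta)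
    (htot : ∑ j ∈ J.agents, (if j ∈ P then 4 * beta else 5 * beta / 4) ≤ value u J.goods) :
    FillInv u u (fun j => if j ∈ P then 4 * beta else 5 * beta / 4) 0 (5 * beta / 4)
      (fun D => value u D ≤ 4 * beta) pri P J.agents (bagsC J) (laterGoods J) := by
  have hb := beta_pos
  have hle : ∀ p, 1 ≤ p → posVal u J.goods p ≤ beta := fun p hp => (hu.posVal_anti le_rfl hp).trans h1
  refine fillInv_of_priority P hpri (fun D hD => ?_) (fun g hg => ?_) ?_ (by rwa [sum_bagsC J])
  · obtain ⟨k, hk, rfl⟩ := (mem_bagsC J).1 hD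
    rw [value_bagC J _ hk]
    rw [Finset.mem_Icc] at hk
    linarith [hle k hk.1, hle (2 * J.agents.card - k + 1) (by omega),
      hle (2 * J.agents.card + k) (by omega)]
  · exact (le_posVal_of_mem_laterGoods J hu hg).trans (hle _ (by omega))
  -- For j < k with C_j below β, C_k is at most 2 v_k + v_{2d+j}. Here v_k ≤ v_2 < β/2, while 2
  -- v_{2d+j} ≤ β - v_j ≤ β - v_k, which gives 3/2 v_k + β/2 ≤ 5β/4.
  · refine pairwise_bagsC J fun j hj k hk hjk hlt => ?_
    rw [value_bagC J _ hj] at hlt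
    rw [value_bagC J _ hk]
    rw [Finset.mem_Icc] at hj hk
    set d := J.agents.card
    have a1 := hu.posVal_anti (p := j) (q := k) (by omega) (by omega)
    have a2 := hu.posVal_anti (p := k) (q := 2 * d - k + 1) (by omega) (by omega)
    have a3 := hu.posVal_anti (p := 2 * d + j) (q := 2 * d + k) (by omega) (by omega)
    have a4 := hu.posVal_anti (p := 2 * d - j + 1) (q := 2 * d + j) (by omega) (by omega)
    have a5 := hu.posVal_anti (p := 2) (q := k) (by omega) (by omega)
    have a6 := hu.posVal_anti (p := 1) (q := 2) (by omega) (by omega)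
    linarith

end TripleBags


/-! ### The bags B_k and the goods outside them. -/

section Bags

variable {n m : ℕ} (H : Instance n m)

theorem value_bagB (f : Fin m → ℝ) {k : ℕ} (hk : k ∈ Finset.Icc 1 H.agents.card) :
    value f (H.bagB k) = posVal f H.goods k + posVal f H.goods (2 * H.agents.card - k + 1) := by
  rw [Finset.mem_Icc] at hk
  rw [Instance.bagB, value_goodsAt, Finset.sum_pair]
  omega

/-- The goods beyond position `2 * n`. -/
def restGoods : Finset (Fin m) := H.goods.filter fun g => 2 * H.agents.card < rank H.goods g

/-- The goods left when the bags `B_k` with `k ∈ K` remain. -/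
def goodsLeft (K : Finset ℕ) : Finset (Fin m) := K.biUnion H.bagB ∪ restGoods H

variable {H} {K : Finset ℕ} {u : Fin m → ℝ}

theorem bagB_disjoint {j k : ℕ} (hj : j ∈ Finset.Icc 1 H.agents.card)
    (hk : k ∈ Finset.Icc 1 H.agents.card) (hjk : j ≠ k) : Disjoint (H.bagB j) (H.bagB k) := by
  refine goodsAt_disjoint (Finset.disjoint_left.2 fun p hp hp' => ?_)
  simp only [Finset.mem_Icc, Finset.mem_insert, Finset.mem_singleton] at hj hk hp hp'
  omega

theorem bagB_disjoint_restGoods {k : ℕ} (hk : k ∈ Finset.Icc 1 H.agents.card) :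
    Disjoint (H.bagB k) (restGoods H) := by
  refine Finset.disjoint_left.2 fun g hg hg' => ?_
  have h1 := (mem_goodsAt.1 hg).2
  have h2 := (Finset.mem_filter.1 hg').2
  simp only [Finset.mem_Icc, Finset.mem_insert, Finset.mem_singleton] at hk h1
  omega

theorem biUnion_disjoint_restGoods (hK : K ⊆ Finset.Icc 1 H.agents.card) :
    Disjoint (K.biUnion H.bagB) (restGoods H) :=
  (Finset.disjoint_biUnion_left _ _ _).2 fun _ hk => bagB_disjoint_restGoods (hK hk)

theorem goodsLeft_all : goodsLeft H (Finset.Icc 1 H.agents.card) = H.goods := by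
  ext g
  simp only [goodsLeft, restGoods, Instance.bagB, Finset.mem_union, Finset.mem_biUnion,
    mem_goodsAt, Finset.mem_filter, Finset.mem_Icc, Finset.mem_insert, Finset.mem_singleton]
  constructor
  · rintro (⟨k, -, hg, -⟩ | ⟨hg, -⟩) <;> exact hg
  · intro hg
    have h1 := one_le_rank hg
    by_cases h2 : 2 * H.agents.card < rank H.goods g
    · exact Or.inr ⟨hg, h2⟩
    by_cases h3 : rank H.goods g ≤ H.agents.card
    · exact Or.inl ⟨_, ⟨h1, h3⟩, hg, Or.inl rfl⟩
    · exact Or.inl ⟨2 * H.agents.card + 1 - rank H.goods g, by omega, hg, Or.inr (by omega)⟩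

theorem goodsLeft_sdiff (hK : K ⊆ Finset.Icc 1 H.agents.card) {k : ℕ} (hk : k ∈ K) :
    goodsLeft H K \ H.bagB k = goodsLeft H (K.erase k) := by
  ext g
  simp only [goodsLeft, Finset.mem_sdiff, Finset.mem_union, Finset.mem_biUnion, Finset.mem_erase]
  constructor
  · rintro ⟨⟨j, hj, hg⟩ | hg, hgk⟩
    · exact Or.inl ⟨j, ⟨fun h => hgk (h ▸ hg), hj⟩, hg⟩
    · exact Or.inr hg
  · rintro (⟨j, ⟨hjk, hj⟩, hg⟩ | hg)
    · exact ⟨Or.inl ⟨j, hj, hg⟩,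
        Finset.disjoint_left.1 (bagB_disjoint (hK hj) (hK hk) hjk) hg⟩
    · exact ⟨Or.inr hg, Finset.disjoint_right.1 (bagB_disjoint_restGoods (hK hk)) hg⟩

theorem goodsLeft_sdiff_biUnion (hK : K ⊆ Finset.Icc 1 H.agents.card) :
    goodsLeft H K \ K.biUnion H.bagB = restGoods H :=
  Finset.union_sdiff_cancel_left (biUnion_disjoint_restGoods hK)

theorem value_goodsLeft (f : Fin m → ℝ) (hK : K ⊆ Finset.Icc 1 H.agents.card) :
    value f (goodsLeft H K) = ∑ k ∈ K, value f (H.bagB k) + value f (restGoods H) := by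
  rw [goodsLeft, value_union _ (biUnion_disjoint_restGoods hK), value, Finset.sum_biUnion]
  · rfl
  · intro a ha b hb hab
    exact bagB_disjoint (hK ha) (hK hb) hab

theorem value_restGoods (f : Fin m → ℝ) : value f (restGoods H)
    = ∑ p ∈ Finset.Icc (2 * H.agents.card + 1) H.goods.card, posVal f H.goods p := by
  rw [← value_goodsAt]
  congr 1
  ext g
  simp only [restGoods, Finset.mem_filter, mem_goodsAt, Finset.mem_Icc]
  exact ⟨fun h => ⟨h.1, h.2, rank_le_card _ _⟩, fun h => ⟨h.1, h.2.1⟩⟩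

theorem le_posVal_of_mem_restGoods (hu : OrderedOn u H.goods) {g : Fin m}
    (hg : g ∈ restGoods H) : u g ≤ posVal u H.goods (2 * H.agents.card + 1) := by
  obtain ⟨h1, h2⟩ := Finset.mem_filter.1 hg
  exact hu.le_posVal h1 (by omega) h2

theorem bagB_subset (k : ℕ) : H.bagB k ⊆ H.goods := goodsAt_subset _ _

theorem goodsLeft_subset : goodsLeft H K ⊆ H.goods :=
  Finset.union_subset (Finset.biUnion_subset.2 fun _ _ => bagB_subset _)
    (Finset.filter_subset _ _)

theorem card_biUnion_bagB (hK : K ⊆ Finset.Icc 1 H.agents.card)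
    (hc : 2 * H.agents.card ≤ H.goods.card) : (K.biUnion H.bagB).card = 2 * K.card := by
  rw [Finset.card_biUnion fun a ha b hb hab => bagB_disjoint (hK ha) (hK hb) hab,
    Finset.sum_congr rfl (g := fun _ => 2), Finset.sum_const, smul_eq_mul, mul_comm]
  intro k hk
  have hk := Finset.mem_Icc.1 (hK hk)
  rw [Instance.bagB, card_goodsAt, Finset.card_pair (by omega)]
  intro p hp
  simp only [Finset.mem_insert, Finset.mem_singleton] at hp
  rw [Finset.mem_Icc]; omega

/-- By counting: the 2|K| goods in the remaining bags are worth at least good 2n+1, and every other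
good left is worth at most as much, hence less than t. -/
theorem posVal_goodsLeft (hu : OrderedOn u H.goods) (hK : K ⊆ Finset.Icc 1 H.agents.card)
    (hK0 : 0 < K.card) (hx : 0 < posVal u H.goods (2 * H.agents.card + 1)) {t : ℝ}
    (ht : posVal u H.goods (2 * H.agents.card + 1) < t) :
    posVal u H.goods (2 * H.agents.card + 1) ≤ posVal u (goodsLeft H K) (2 * K.card) ∧
      posVal u (goodsLeft H K) (2 * K.card + 1) < t := by
  have hc := le_card_of_posVal_pos hx
  have hcard := card_biUnion_bagB hK (by omega)
  have ho := hu.mono (goodsLeft_subset (K := K))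
  constructor
  · refine (ho.le_posVal_iff hx (by omega)).2 ?_
    rw [← hcard]
    refine Finset.card_le_card fun g hg => Finset.mem_filter.2
      ⟨Finset.mem_union_left _ hg, ?_⟩
    obtain ⟨k, hk, hgk⟩ := Finset.mem_biUnion.1 hg
    have hk := Finset.mem_Icc.1 (hK hk)
    obtain ⟨h1, h2⟩ := mem_goodsAt.1 hgk
    refine hu.posVal_le h1 ?_
    simp only [Finset.mem_insert, Finset.mem_singleton] at h2
    omega
  · by_contra hcon
    have h1 := (ho.le_posVal_iff (hx.trans ht) (by omega)).1 (not_lt.1 hcon)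
    have h2 : (goodsLeft H K).filter (fun g => t ≤ u g) ⊆ K.biUnion H.bagB := fun g hg => by
      obtain ⟨h3, h4⟩ := Finset.mem_filter.1 hg
      rcases Finset.mem_union.1 h3 with h5 | h5
      · exact h5
      · exact absurd (le_posVal_of_mem_restGoods hu h5) (by linarith)
    have := Finset.card_le_card h2
    omega

end Bags

/-! ### Invariants of the run, and the case of few agents in `N11`. -/

section Agents

variable {n m : ℕ}

theorem MayReceive.lt {u : Fin n → Fin m → ℝ} {N : Finset (Fin n)} {β : ℝ} {P : Finset (Fin n)}
    {S : Finset (Fin m)} {i j : Fin n} (h : MayReceive u N β P S j) (hi : i ∈ N) (hiP : i ∈ P)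
    (hjP : j ∉ P) : value (u i) S < β :=
  h.2.2.elim (fun h => absurd h hjP) fun h => h i hi hiP

theorem exists_mayReceive {u : Fin n → Fin m → ℝ} {N : Finset (Fin n)} {β : ℝ}
    (P : Finset (Fin n)) {S : Finset (Fin m)} {i : Fin n} (hi : i ∈ N) (hv : β ≤ value (u i) S) :
    ∃ j, MayReceive u N β P S j := by
  by_cases h : ∃ j ∈ N, j ∈ P ∧ β ≤ value (u j) S
  · obtain ⟨j, hj, hjP, hjv⟩ := h
    exact ⟨j, hj, hjv, Or.inl hjP⟩
  · push Not at h
    exact ⟨i, hi, hv, Or.inr h⟩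

theorem sum_erase_le_value_sdiff {N : Finset (Fin n)} {τ : Fin n → ℝ} {u : Fin m → ℝ}
    {G S : Finset (Fin m)} (h : ∑ j ∈ N, τ j ≤ value u G) {j : Fin n} (hj : j ∈ N) (hS : S ⊆ G)
    (hτ : value u S ≤ τ j) : ∑ j ∈ N.erase j, τ j ≤ value u (G \ S) := by
  have h1 := Finset.add_sum_erase N τ hj
  rw [value_sdiff u hS]
  linarith

variable (c : Memory n m)

/-- The agents of the memory have the properties ensured by `reduce` and `normalize`. -/
def AllONI : Prop :=
  ∀ i ∈ c.hat.agents, IsONI (c.hat.val i) c.hat.goods c.hat.agents.card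

/-- The bundles `A` have been given to the agents outside `N`, and the goods in `G` are left. -/
structure RunInv (N : Finset (Fin n)) (G : Finset (Fin m)) (A : Alloc n m) : Prop where
  agents_subset : N ⊆ c.hat.agents
  goods_subset : G ⊆ c.hat.goods
  alloc : IsAllocOf (c.hat.agents \ N) (c.hat.goods \ G) A
  worth : ∀ i ∈ c.hat.agents \ N, beta ≤ value (c.hat.val i) (A i)

variable {c}

theorem RunInv.update {N : Finset (Fin n)} {G : Finset (Fin m)} {A : Alloc n m}
    (h : RunInv c N G A) {i : Fin n} {S : Finset (Fin m)} (hS : S ⊆ G)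
    (hi : beta ≤ value (c.hat.val i) S) :
    RunInv c (N.erase i) (G \ S) (Function.update A i S) where
  agents_subset := (Finset.erase_subset _ _).trans h.agents_subset
  goods_subset := Finset.sdiff_subset.trans h.goods_subset
  alloc := h.alloc.update hS h.goods_subset
  worth := worth_update h.worth hi

variable (c) in
/-- The invariant of the loop over the bags `B_k`. -/
structure BagsInv (J : Instance n m) (K : Finset ℕ) (A : Alloc n m) : Prop where
  run : RunInv c J.agents J.goods A
  val_eq : J.val = c.hat.val
  subset : K ⊆ Finset.Icc 1 c.hat.agents.card
  goods_eq : J.goods = goodsLeft c.hat K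
  card_eq : K.card = J.agents.card
  -- All admissible allotments are kept at once, since the one that suits the agent is chosen only
  -- after the loop.
  total : ∀ i ∈ J.agents, ∀ τ : Fin n → ℝ, (∀ k ∈ Finset.Icc 1 c.hat.agents.card, ∀ j,
    (i ∈ c.priority delta → j ∉ c.priority delta → value (c.hat.val i) (c.hat.bagB k) < beta) →
      value (c.hat.val i) (c.hat.bagB k) ≤ τ j) →
    ∑ j ∈ c.hat.agents, τ j ≤ c.hat.agents.card → ∑ j ∈ J.agents, τ j ≤ value (c.hat.val i) J.goods

theorem RunInv.start : RunInv c c.hat.agents c.hat.goods (fun _ => ∅) where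
  agents_subset := le_rfl
  goods_subset := le_rfl
  alloc := ⟨fun i hi => absurd hi (by simp), fun i hi => absurd hi (by simp)⟩
  worth := fun i hi => absurd hi (by simp)

theorem BagsInv.start (h : AllONI c) :
    BagsInv c c.hat (Finset.Icc 1 c.hat.agents.card) (fun _ => ∅) where
  run := RunInv.start
  val_eq := rfl
  subset := le_rfl
  goods_eq := goodsLeft_all.symm
  card_eq := by simp
  total i hi τ _ hτ := by rwa [(h i hi).total]

theorem BagsInv.give {J : Instance n m} {K : Finset ℕ} {A : Alloc n m} (h : BagsInv c J K A)
    {k : ℕ} {j : Fin n} (hk : k ∈ K)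
    (hj : MayReceive J.val J.agents beta (c.priority delta) (c.hat.bagB k) j) :
    BagsInv c (J.remove j (c.hat.bagB k)) (K.erase k) (Function.update A j (c.hat.bagB k)) := by
  have hsub : c.hat.bagB k ⊆ J.goods := by
    rw [h.goods_eq]
    exact (Finset.subset_biUnion_of_mem c.hat.bagB hk).trans Finset.subset_union_left
  rw [h.val_eq] at hj
  refine ⟨h.run.update hsub hj.2.1, h.val_eq, (Finset.erase_subset _ _).trans h.subset, ?_, ?_, ?_⟩
  · change J.goods \ c.hat.bagB k = _
    rw [h.goods_eq, goodsLeft_sdiff h.subset hk]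
  · change _ = (J.agents.erase j).card
    rw [Finset.card_erase_of_mem hk, Finset.card_erase_of_mem hj.1, h.card_eq]
  · intro i hi τ hτ htot
    have hiJ := Finset.mem_of_mem_erase hi
    exact sum_erase_le_value_sdiff (h.total i hiJ τ hτ htot) hj.1 hsub
      (hτ k (h.subset hk) j (hj.lt hiJ))

variable (c) in
/-- The invariant of the bag-filling loop. -/
structure FillConfigInv (N : Finset (Fin n)) (Q : List (Finset (Fin m))) (F : Finset (Fin m))
    (A : Alloc n m) : Prop where
  run : ∃ G, RunInv c N G A ∧ (∀ D ∈ Q, D ⊆ G) ∧ F ⊆ G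
  pairwise : Q.Pairwise Disjoint
  disjoint : ∀ D ∈ Q, Disjoint D F
  length : Q.length = N.card
  agent : ∀ i ∈ N, ∃ f τ ex σ S, FillInv (c.hat.val i) f τ ex σ S (i ∈ c.priority delta)
    (c.priority delta) N Q F

theorem FillConfigInv.add {N : Finset (Fin n)} {C : Finset (Fin m)}
    {Q : List (Finset (Fin m))} {F : Finset (Fin m)} {A : Alloc n m} (hc : AllONI c)
    (h : FillConfigInv c N (C :: Q) F A) (hlow : ∀ i ∈ N, value (c.hat.val i) C < beta)
    {g : Fin m} (hg : g ∈ F) : FillConfigInv c N (insert g C :: Q) (F.erase g) A := by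
  obtain ⟨G, hG, hQG, hFG⟩ := h.run
  have hgC : g ∉ C := Finset.disjoint_right.1 (h.disjoint C List.mem_cons_self) hg
  have hpw := List.pairwise_cons.1 h.pairwise
  refine ⟨⟨G, hG, fun D hD => ?_, (Finset.erase_subset _ _).trans hFG⟩, ?_, ?_, h.length, ?_⟩
  · rcases List.mem_cons.1 hD with rfl | hD
    · exact Finset.insert_subset (hFG hg) (hQG C List.mem_cons_self)
    · exact hQG D (List.mem_cons_of_mem _ hD)
  · refine List.pairwise_cons.2 ⟨fun D hD => ?_, hpw.2⟩
    exact Finset.disjoint_insert_left.2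
      ⟨Finset.disjoint_right.1 (h.disjoint D (List.mem_cons_of_mem _ hD)) hg, hpw.1 D hD⟩
  · intro D hD
    rcases List.mem_cons.1 hD with rfl | hD
    · exact Finset.disjoint_insert_left.2 ⟨Finset.notMem_erase _ _,
        (h.disjoint C List.mem_cons_self).mono_right (Finset.erase_subset _ _)⟩
    · exact (h.disjoint D (List.mem_cons_of_mem _ hD)).mono_right (Finset.erase_subset _ _)
  · intro i hi
    obtain ⟨f, τ, ex, σ, S, hi'⟩ := h.agent i hi
    exact ⟨f, τ, ex, σ, S, hi'.add (fun a ha => (hc i (hG.agents_subset hi)).ordered.nonneg a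
      (hG.goods_subset (hFG ha))) (hlow i hi) hg hgC⟩

theorem FillConfigInv.give {N : Finset (Fin n)} {C : Finset (Fin m)}
    {Q : List (Finset (Fin m))} {F : Finset (Fin m)} {A : Alloc n m}
    (h : FillConfigInv c N (C :: Q) F A) {j : Fin n}
    (hj : MayReceive c.hat.val N beta (c.priority delta) C j) :
    FillConfigInv c (N.erase j) Q F (Function.update A j C) := by
  obtain ⟨G, hG, hQG, hFG⟩ := h.run
  have hpw := List.pairwise_cons.1 h.pairwise
  refine ⟨⟨G \ C, hG.update (hQG C List.mem_cons_self) hj.2.1, fun D hD => ?_, ?_⟩, hpw.2,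
    fun D hD => h.disjoint D (List.mem_cons_of_mem _ hD), ?_, fun i hi => ?_⟩
  · exact Finset.subset_sdiff.2 ⟨hQG D (List.mem_cons_of_mem _ hD), (hpw.1 D hD).symm⟩
  · exact Finset.subset_sdiff.2 ⟨hFG, (h.disjoint C List.mem_cons_self).symm⟩
  · rw [Finset.card_erase_of_mem hj.1, ← h.length, List.length_cons, Nat.add_sub_cancel]
  · have hiN := Finset.mem_of_mem_erase hi
    obtain ⟨f, τ, ex, σ, S, hi'⟩ := h.agent i hiN
    exact ⟨f, τ, ex, σ, S, hi'.give hj.1 (hj.lt hiN)⟩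

theorem priority_of_few (h : c.hat.FewN11 delta) : c.priority delta = c.hat.N11 delta := by
  rw [Memory.priority, if_pos h]

theorem mem_N11 {H : Instance n m} {i : Fin n} : i ∈ H.N11 delta ↔ i ∈ H.agents ∧
    (∀ k ∈ Finset.Icc 1 H.agents.card,
      posVal (H.val i) H.goods k + posVal (H.val i) H.goods (2 * H.agents.card - k + 1) ≤ 1) ∧
    1 / 4 - 5 * delta ≤ posVal (H.val i) H.goods (2 * H.agents.card + 1) := by
  simp only [Instance.N11, Finset.mem_filter, posVal]
  refine and_congr_right fun _ => and_congr_left fun _ => forall₂_congr fun k hk => ?_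
  rw [value_bagB H _ hk, posVal, posVal]

theorem sum_ite_mem_agents (H : Instance n m) {P : Finset (Fin n)} (hP : P ⊆ H.agents)
    (a b : ℝ) : ∑ j ∈ H.agents, (if j ∈ P then a else b)
      = P.card * a + ((H.agents.card : ℝ) - P.card) * b := by
  rw [Finset.sum_ite, Finset.sum_const, Finset.sum_const, Finset.filter_mem_eq_inter,
    Finset.inter_eq_right.2 hP, Finset.filter_notMem_eq_sdiff, Finset.card_sdiff_of_subset hP,
    nsmul_eq_mul, nsmul_eq_mul, Nat.cast_sub (Finset.card_le_card hP)]

theorem N11_subset (H : Instance n m) : H.N11 delta ⊆ H.agents := fun _ hi =>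
  (mem_N11.1 hi).1

/-- The ratio 59/60 is (1 - β)/(β/3): it is the largest fraction of agents that may cost 4β/3 when
all others cost β and the average must not exceed 1. -/
theorem fewN11_iff {H : Instance n m} :
    H.FewN11 delta ↔ 60 * ((H.N11 delta).card : ℝ) ≤ 59 * H.agents.card := by
  rw [Instance.FewN11, delta_eq, le_div_iff₀ (by norm_num)]
  constructor <;> intro h <;> linarith

/-- Each agent picks her allotment so that it exceeds `beta` by at least the value of a good that
may be added, unless priority rules out an expensive bag for that recipient. -/
theorem BagsInv.exit_few {J : Instance n m} {K : Finset ℕ} {A : Alloc n m} (hc : AllONI c)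
    (h : BagsInv c J K A) (hfew : c.hat.FewN11 delta)
    (hexit : ∀ k ∈ K, ∀ i ∈ J.agents, value (J.val i) (c.hat.bagB k) < beta) {L : List ℕ}
    (hL : L.Nodup ∧ L.toFinset = K) :
    FillConfigInv c J.agents (L.map c.hat.bagB) (J.goods \ K.biUnion c.hat.bagB) A := by
  obtain ⟨hnd, rfl⟩ := hL
  rw [h.val_eq] at hexit
  have hmem : ∀ k ∈ L, k ∈ L.toFinset := fun k hk => List.mem_toFinset.2 hk
  have hF : J.goods \ L.toFinset.biUnion c.hat.bagB = restGoods c.hat := by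
    rw [h.goods_eq, goodsLeft_sdiff_biUnion h.subset]
  have hsum : ∀ f, ((L.map c.hat.bagB).map (value f)).sum + value f (restGoods c.hat)
      = value f J.goods := fun f => by
    rw [h.goods_eq, value_goodsLeft f h.subset, List.map_map, List.sum_toFinset _ hnd]; rfl
  rw [hF]
  refine ⟨⟨J.goods, h.run, fun D hD => ?_, ?_⟩, ?_, fun D hD => ?_, ?_, fun i hi => ?_⟩
  · obtain ⟨k, hk, rfl⟩ := List.mem_map.1 hD
    rw [h.goods_eq]
    exact (Finset.subset_biUnion_of_mem c.hat.bagB (hmem k hk)).trans Finset.subset_union_left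
  · rw [h.goods_eq]; exact Finset.subset_union_right
  · rw [List.pairwise_map]
    refine List.Pairwise.imp_of_mem ?_ hnd
    exact fun ha hb hab => bagB_disjoint (h.subset (hmem _ ha)) (h.subset (hmem _ hb)) hab
  · obtain ⟨k, hk, rfl⟩ := List.mem_map.1 hD
    exact bagB_disjoint_restGoods (h.subset (hmem k hk))
  · rw [List.length_map, ← List.toFinset_card_of_nodup hnd, h.card_eq]
  have hih := h.run.agents_subset hi
  have ho := hc i hih
  have hQ : ∀ D ∈ L.map c.hat.bagB, value (c.hat.val i) D < beta := fun D hD => by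
    obtain ⟨k, hk, rfl⟩ := List.mem_map.1 hD
    exact hexit k (hmem k hk) i hi
  have hFle : ∀ g ∈ restGoods c.hat, c.hat.val i g
      ≤ posVal (c.hat.val i) c.hat.goods (2 * c.hat.agents.card + 1) := fun g hg =>
    le_posVal_of_mem_restGoods ho.ordered hg
  have hx3 : posVal (c.hat.val i) c.hat.goods (2 * c.hat.agents.card + 1) < beta / 3 := by
    have h1 := ho.three
    have h0 := ho.pos
    have h2 := ho.ordered.posVal_anti (p := 2 * c.hat.agents.card - 1)
      (q := 2 * c.hat.agents.card + 1) (by omega) (by omega)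
    have h3 := ho.ordered.posVal_anti (p := 2 * c.hat.agents.card)
      (q := 2 * c.hat.agents.card + 1) (by omega) (by omega)
    linarith
  have hP := priority_of_few hfew
  have main : ∀ τ : Fin n → ℝ, ∑ j ∈ J.agents, τ j ≤ value (c.hat.val i) J.goods →
      (∀ j, beta ≤ τ j ∧ ((∀ g ∈ restGoods c.hat, c.hat.val i g ≤ τ j - beta) ∨
        (i ∈ c.priority delta ∧ j ∉ c.priority delta))) →
      ∃ f τ ex σ S, FillInv (c.hat.val i) f τ ex σ S (i ∈ c.priority delta)
        (c.priority delta) J.agents (L.map c.hat.bagB) (restGoods c.hat) := fun τ hτ hj =>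
    ⟨_, _, _, _, _, fillInv_of_small _ _ hQ ((hsum _).symm ▸ hτ) hj⟩
  have hb := beta_eq
  have hd := delta_eq
  by_cases hB : ∀ k ∈ Finset.Icc 1 c.hat.agents.card, posVal (c.hat.val i) c.hat.goods k
      + posVal (c.hat.val i) c.hat.goods (2 * c.hat.agents.card - k + 1) ≤ 1
  · by_cases hx : 1 / 4 - 5 * delta
        ≤ posVal (c.hat.val i) c.hat.goods (2 * c.hat.agents.card + 1)
    · have hi11 : i ∈ c.hat.N11 delta := mem_N11.2 ⟨hih, hB, hx⟩
      -- Good 2n+1 is below β/3, and 4β/3 = 240/239 covers the bags B_k, which are at most 1. Bags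
      -- that go to agents outside `N11` are below `beta`, because this agent has priority over
      -- them.
      refine main (fun j => if j ∈ c.hat.N11 delta then 4 * beta / 3 else beta)
        (h.total i hi _ (fun k hk j hj => ?_) ?_) fun j => ?_
      · split_ifs with hj11
        · rw [value_bagB _ _ hk]
          have := hB k hk
          linarith
        · rw [hP] at hj
          exact (hj hi11 hj11).le
      · rw [sum_ite_mem_agents _ (N11_subset _)]
        have := fewN11_iff.1 hfew
        rw [hb]
        linarith
      · split_ifs with hj11
        · refine ⟨by linarith, Or.inl fun g hg => ?_⟩
          have := hFle g hg
          linarith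
        · exact ⟨le_rfl, Or.inr (by rw [hP]; exact ⟨hi11, hj11⟩)⟩
    -- Added goods are below 1/4 - 5δ, while 1 - β = 1/4 - δ.
    · refine main (fun _ => 1) (h.total i hi _ (fun k hk j _ => ?_) ?_) fun j =>
        ⟨by linarith, Or.inl fun g hg => ?_⟩
      · rw [value_bagB _ _ hk]
        exact hB k hk
      · simp
      · have := hFle g hg
        rw [not_le] at hx
        linarith
  · push Not at hB
    obtain ⟨k₀, hk₀, hk₀'⟩ := hB
    obtain ⟨q, hq⟩ := ho.exists_unitBundles
    obtain ⟨h1, h2⟩ := hq.sum_bags_le hk₀ hk₀' ho.one ho.pair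
    -- This is β + (1/12 + δ), the bound for a bag below `beta` plus one good beyond position 2n.
    refine main (fun _ => 5 / 6 + 2 * delta) ?_ fun j => ⟨by linarith, Or.inl fun g hg => ?_⟩
    · have h3 := h2 L.toFinset h.subset fun k hk => by
        rw [← value_bagB _ _ (h.subset hk)]
        exact hexit k hk i hi
      have h4 := ho.total
      rw [← goodsLeft_all, value_goodsLeft _ le_rfl, ← Finset.sum_sdiff h.subset,
        Finset.sum_congr rfl fun k hk => value_bagB _ _ (Finset.mem_sdiff.1 hk).1] at h4
      rw [h.goods_eq, value_goodsLeft _ h.subset, Finset.sum_const, nsmul_eq_mul, ← h.card_eq]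
      linarith
    · have := hFle g hg
      linarith

end Agents


/-! ### The case of many agents in `N11`. -/

section ManyAgents

variable {n m : ℕ} (c : Memory n m)

/-- The bound on the remaining goods that is maintained for the agents with priority. -/
def PriorityInv (J : Instance n m) : Prop :=
  ∀ i ∈ J.agents, i ∈ c.priority delta →
    ∑ j ∈ J.agents, (if j ∈ c.priority delta then 4 * beta else 5 * beta / 4)
      ≤ value (c.hat.val i) J.goods

/-- The invariant of the loop that applies `R₅`. -/
structure PairsConfigInv (J : Instance n m) (A : Alloc n m) : Prop where
  run : RunInv c J.agents J.goods A
  val_eq : J.val = c.hat.val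
  priority : PriorityInv c J
  weight : ∀ i ∈ J.agents, i ∉ c.priority delta → ∃ x, 0 < x ∧ ∃ W : Weights x,
    PairsInv W (c.hat.val i) J.goods J.agents.card

/-- The invariant of the loop that applies `R₂` and `R₃`. -/
structure RulesConfigInv (J : Instance n m) (A : Alloc n m) : Prop where
  run : RunInv c J.agents J.goods A
  val_eq : J.val = c.hat.val
  priority : PriorityInv c J
  weight : ∀ i ∈ J.agents, i ∉ c.priority delta → ∃ x, ∃ W : Weights x,
    RulesInv W (c.hat.val i) J.goods J.agents.card
  pair : ∀ i ∈ J.agents, posVal (c.hat.val i) J.goods 1 + posVal (c.hat.val i) J.goods 2 < beta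

variable {c} {J : Instance n m} {A : Alloc n m}

theorem RunInv.orderedOn (hc : AllONI c) (h : RunInv c J.agents J.goods A) {i : Fin n}
    (hi : i ∈ J.agents) : OrderedOn (c.hat.val i) J.goods :=
  (hc i (h.agents_subset hi)).ordered.mono h.goods_subset

theorem RunInv.posVal_lt (hc : AllONI c) (h : RunInv c J.agents J.goods A) {i : Fin n}
    (hi : i ∈ J.agents) {p : ℕ} (hp : 1 ≤ p) : posVal (c.hat.val i) J.goods p < beta := by
  have ho := hc i (h.agents_subset hi)
  exact ((ho.ordered.posVal_subset h.goods_subset hp).trans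
    (ho.ordered.posVal_anti le_rfl hp)).trans_lt ho.one

/-- A rule hands out at most four goods, each below `beta`; if the recipient lacks priority, the
whole bundle is below `beta` for an agent with priority. -/
theorem PriorityInv.give (hc : AllONI c) (hr : RunInv c J.agents J.goods A)
    (h : PriorityInv c J) {S : Finset (Fin m)} (hS : S ⊆ J.goods) (hS4 : S.card ≤ 4) {j : Fin n}
    (hj : MayReceive c.hat.val J.agents beta (c.priority delta) S j) :
    PriorityInv c (J.remove j S) := by
  intro i hi hiP
  have hiJ := Finset.mem_of_mem_erase hi
  have hb := beta_pos
  refine sum_erase_le_value_sdiff (h i hiJ hiP) hj.1 hS ?_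
  split_ifs with hjP
  · have h1 : value (c.hat.val i) S ≤ S.card * beta := by
      rw [← nsmul_eq_mul]
      refine Finset.sum_le_card_nsmul _ _ _ fun g hg => ?_
      exact ((hr.orderedOn hc hiJ).le_posVal (hS hg) le_rfl (one_le_rank (hS hg))).trans
        (hr.posVal_lt hc hiJ le_rfl).le
    have h2 : (S.card : ℝ) ≤ 4 := by exact_mod_cast hS4
    have h3 : (S.card : ℝ) * beta ≤ 4 * beta := mul_le_mul_of_nonneg_right h2 hb.le
    linarith
  · have := hj.lt hiJ hiP hjP
    linarith

theorem card_ruleGoods_le (J : Instance n m) (k : ℕ) : (J.ruleGoods k).card ≤ 4 := by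
  unfold Instance.ruleGoods
  split
  · exact (card_goodsAt_le _ _).trans (by simp)
  · exact (card_goodsAt_le _ _).trans (Finset.card_le_three.trans (by norm_num))
  · exact (card_goodsAt_le _ _).trans Finset.card_le_four
  · exact (card_goodsAt_le _ _).trans (Finset.card_le_two.trans (by norm_num))
  · exact (card_goodsAt_le _ _).trans (Finset.card_le_two.trans (by norm_num))
  · simp

theorem priority_of_many (h : ¬ c.hat.FewN11 delta) :
    c.priority delta = c.hat.agents \ c.hat.N11 delta := by
  rw [Memory.priority, if_neg h]

/-- Fewer than n/60 agents have priority, so allotments of 4β for these and 5β/4 for the others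
average at most 5β/4 + (11/4)β/60 < 1. The agents without priority are those of `N11`, for whom
`exists_weights` applies. -/
theorem BagsInv.exit_many {K : Finset ℕ} (hc : AllONI c)
    (h : BagsInv c J K A) (hmany : ¬ c.hat.FewN11 delta)
    (hexit : ∀ k ∈ K, ∀ i ∈ J.agents, value (J.val i) (c.hat.bagB k) < beta) :
    PairsConfigInv c J A := by
  rw [h.val_eq] at hexit
  have hP := priority_of_many hmany
  have hb := beta_eq
  refine ⟨h.run, h.val_eq, fun i hi hiP => ?_, fun i hi hiP => ?_⟩
  · have ho := hc i (h.run.agents_subset hi)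
    refine h.total i hi _ (fun k hk j hj => ?_) ?_
    · split_ifs with hjP
      · rw [value_bagB _ _ hk]
        rw [Finset.mem_Icc] at hk
        have h1 := ho.one
        have h2 := ho.ordered.posVal_anti (p := 1) (q := k) le_rfl hk.1
        have h3 := ho.ordered.posVal_anti (p := 1) (q := 2 * c.hat.agents.card - k + 1) le_rfl
          (by omega)
        linarith
      · have := hj hiP hjP
        linarith
    · rw [sum_ite_mem_agents _ (hP ▸ Finset.sdiff_subset)]
      have h1 : ((c.priority delta).card : ℝ)
          = c.hat.agents.card - (c.hat.N11 delta).card := by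
        rw [hP, Finset.card_sdiff_of_subset (N11_subset _),
          Nat.cast_sub (Finset.card_le_card (N11_subset _))]
      have h2 := not_le.1 (mt fewN11_iff.2 hmany)
      rw [h1, hb]
      have h3 : (0 : ℝ) ≤ c.hat.agents.card := Nat.cast_nonneg _
      linarith
  · have hih := h.run.agents_subset hi
    have ho := hc i hih
    have hi11 : i ∈ c.hat.N11 delta := by
      by_contra hcon
      exact hiP (hP ▸ Finset.mem_sdiff.2 ⟨hih, hcon⟩)
    obtain ⟨-, hB, hx⟩ := mem_N11.1 hi11
    obtain ⟨W, hW⟩ := exists_weights ho hB hx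
    have hx0 : 0 < posVal (c.hat.val i) c.hat.goods (2 * c.hat.agents.card + 1) := by
      rw [delta_eq] at hx; linarith
    have hx3 : posVal (c.hat.val i) c.hat.goods (2 * c.hat.agents.card + 1) < beta / 3 := by
      have h1 := ho.three
      have h0 := ho.pos
      have h2 := ho.ordered.posVal_anti (p := 2 * c.hat.agents.card - 1)
        (q := 2 * c.hat.agents.card + 1) (by omega) (by omega)
      have h3 := ho.ordered.posVal_anti (p := 2 * c.hat.agents.card)
        (q := 2 * c.hat.agents.card + 1) (by omega) (by omega)
      linarith
    have hK0 : 0 < K.card := by rw [h.card_eq]; exact Finset.card_pos.2 ⟨i, hi⟩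
    have hpos := posVal_goodsLeft ho.ordered h.subset hK0 hx0 hx3
    refine ⟨_, hx0, W, ?_⟩
    rw [← h.card_eq, h.goods_eq]
    refine ⟨?_, hpos.1, hpos.2⟩
    have h4 := hW K h.subset fun k hk => by
      rw [← value_bagB _ _ (h.subset hk)]
      exact hexit k hk i hi
    refine h4.trans (le_of_eq ?_)
    rw [value_goodsLeft _ h.subset, value_restGoods]
    congr 1
    · refine Finset.sum_congr rfl fun k hk => ?_
      rw [value_bagB _ _ (h.subset hk)]
      have := Finset.mem_Icc.1 (h.subset hk)
      rw [posVal_comp W.w_zero (by omega), posVal_comp W.w_zero (by omega)]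
    · refine Finset.sum_congr rfl fun p hp => ?_
      have := (Finset.mem_Icc.1 hp).1
      rw [posVal_comp W.w_zero (by omega)]

theorem PairsConfigInv.give (hc : AllONI c) (h : PairsConfigInv c J A) {j : Fin n}
    (hj : J.CanApply beta (c.priority delta) 5 j) :
    PairsConfigInv c (J.remove j (J.ruleGoods 5)) (Function.update A j (J.ruleGoods 5)) := by
  have hj' : MayReceive c.hat.val J.agents beta (c.priority delta) (J.ruleGoods 5) j :=
    h.val_eq ▸ hj
  refine ⟨h.run.update (ruleGoods_subset J 5) hj'.2.1, h.val_eq,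
    h.priority.give hc h.run (ruleGoods_subset J 5) (card_ruleGoods_le J 5) hj',
    fun i hi hiP => ?_⟩
  obtain ⟨x, hx, W, hW⟩ := h.weight i (Finset.mem_of_mem_erase hi) hiP
  rw [← Finset.card_erase_add_one hj.1] at hW
  exact ⟨x, hx, W, hW.give hx (Finset.card_pos.2 ⟨i, hi⟩)⟩

theorem PairsConfigInv.exit (hc : AllONI c) (h : PairsConfigInv c J A)
    (hexit : ¬ J.Applicable beta 5) : RulesConfigInv c J A := by
  have hpair : ∀ i ∈ J.agents,
      posVal (c.hat.val i) J.goods 1 + posVal (c.hat.val i) J.goods 2 < beta := fun i hi => by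
    simp only [Instance.Applicable, not_exists, not_and, not_le] at hexit
    have := hexit i hi
    rwa [value_ruleGoods_five, h.val_eq] at this
  refine ⟨h.run, h.val_eq, h.priority, fun i hi hiP => ?_, hpair⟩
  obtain ⟨x, -, W, hW⟩ := h.weight i hi hiP
  exact ⟨x, W, hW.exit (h.run.orderedOn hc hi) (hpair i hi)⟩

theorem RulesConfigInv.give (hc : AllONI c) (h : RulesConfigInv c J A) {k : ℕ} {j : Fin n}
    (hk : k ∈ Finset.Icc 2 3) (hmin : ∀ l ∈ Finset.Ico 2 k, ¬ J.Applicable beta l)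
    (hj : J.CanApply beta (c.priority delta) k j) :
    RulesConfigInv c (J.remove j (J.ruleGoods k)) (Function.update A j (J.ruleGoods k)) := by
  have hj' : MayReceive c.hat.val J.agents beta (c.priority delta) (J.ruleGoods k) j :=
    h.val_eq ▸ hj
  refine ⟨h.run.update (ruleGoods_subset J k) hj'.2.1, h.val_eq,
    h.priority.give hc h.run (ruleGoods_subset J k) (card_ruleGoods_le J k) hj',
    fun i hi hiP => ?_, fun i hi => ?_⟩
  · have hiJ := Finset.mem_of_mem_erase hi
    have ho := h.run.orderedOn hc hiJ
    have hd : 0 < (J.agents.erase j).card := Finset.card_pos.2 ⟨i, hi⟩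
    have hd1 := Finset.card_erase_add_one hj.1
    have hd0 : 0 < J.agents.card := by omega
    obtain ⟨x, W, hW⟩ := h.weight i hiJ hiP
    rw [← hd1] at hW
    refine ⟨x, W, ?_⟩
    change RulesInv W _ (J.goods \ J.ruleGoods k) (J.agents.erase j).card
    obtain ⟨hk2, hk3⟩ := Finset.mem_Icc.1 hk
    obtain rfl | rfl : k = 2 ∨ k = 3 := by omega
    · rw [ruleGoods_two_eq J hd0, ← hd1]
      exact hW.two ho hd
    · have h2 := hmin 2 (by simp)
      simp only [Instance.Applicable, not_exists, not_and, not_le] at h2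
      have h3 := h2 i hiJ
      rw [value_ruleGoods_two _ _ hd0, h.val_eq, ← hd1] at h3
      rw [ruleGoods_three_eq J hd0, ← hd1]
      exact hW.three ho hd h3
  · have hiJ := Finset.mem_of_mem_erase hi
    have ho := h.run.orderedOn hc hiJ
    have h1 := ho.posVal_subset (Finset.sdiff_subset (s := J.goods) (t := J.ruleGoods k))
      (p := 1) le_rfl
    have h2 := ho.posVal_subset (Finset.sdiff_subset (s := J.goods) (t := J.ruleGoods k))
      (p := 2) (by norm_num)
    have h3 := h.pair i hiJ
    change posVal _ (J.goods \ J.ruleGoods k) 1 + posVal _ (J.goods \ J.ruleGoods k) 2 < beta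
    linarith

theorem RulesConfigInv.exit (hc : AllONI c) (h : RulesConfigInv c J A)
    (hexit : ∀ k ∈ Finset.Icc 2 3, ¬ J.Applicable beta k) :
    FillConfigInv c J.agents (bagsC J) (laterGoods J) A := by
  refine ⟨⟨J.goods, h.run, fun D hD => ?_, Finset.filter_subset _ _⟩, ?_, fun D hD => ?_, ?_,
    fun i hi => ?_⟩
  · obtain ⟨k, -, rfl⟩ := (mem_bagsC J).1 hD
    exact goodsAt_subset _ _
  · exact pairwise_bagsC J fun j hj k hk hjk => bagC_disjoint J hj hk hjk.ne
  · obtain ⟨k, hk, rfl⟩ := (mem_bagsC J).1 hD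
    exact bagC_disjoint_laterGoods J hk
  · simp [bagsC]
  · have ho := h.run.orderedOn hc hi
    by_cases hiP : i ∈ c.priority delta
    · exact ⟨_, _, _, _, _, priority_fillInv J _ hiP ho (h.run.posVal_lt hc hi le_rfl).le
        (h.pair i hi) (h.priority i hi hiP)⟩
    · obtain ⟨x, W, hW⟩ := h.weight i hi hiP
      have h1 : ∀ k ∈ Finset.Icc 2 3, value (c.hat.val i) (J.ruleGoods k) < beta := fun k hk => by
        have h2 := hexit k hk
        simp only [Instance.Applicable, not_exists, not_and, not_le] at h2
        rw [← h.val_eq]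
        exact h2 i hi
      exact ⟨_, _, _, _, _, RulesInv.exit J _ hW ho (Finset.card_pos.2 ⟨i, hi⟩)
        (h1 2 (by simp)) (h1 3 (by simp))⟩

end ManyAgents


/-! ### The invariant of the algorithm, progress and termination. -/

section Correctness

variable {n m : ℕ} (I : Instance n m)

/-- The instance with which the loop of `reduce` starts. -/
noncomputable def initial : Instance n m := I.dropZero.order.scale

variable {I}

theorem mem_initial_agents {i : Fin n} : i ∈ (initial I).agents ↔ i ∈ I.agents ∧ 0 < I.share i :=
  Finset.mem_filter

/-- Ordering preserves the bundles up to a permutation of values, and with fewer agents some bundles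
are simply dropped. Scaling by the new share therefore never weakens the guarantee. -/
theorem share_le (hval : ∀ i ∈ I.agents, ∀ g ∈ I.goods, 0 ≤ I.val i g) {i : Fin n}
    (hi : i ∈ (initial I).agents) : I.share i ≤ I.dropZero.order.share i := by
  have hiI := (mem_initial_agents.1 hi).1
  have h1 := I.hasParts_order (hasParts_mms (I.val i) (Finset.card_pos.2 ⟨i, hiI⟩) I.goods)
  exact (h1.mono_card (Finset.card_le_card (Finset.filter_subset _ _))).le_mms
    (Finset.card_pos.2 ⟨i, hi⟩) (I.order_orderedOn (hval i hiI)).nonneg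

theorem initial_orderedOn (hval : ∀ i ∈ I.agents, ∀ g ∈ I.goods, 0 ≤ I.val i g) {i : Fin n}
    (hi : i ∈ (initial I).agents) : OrderedOn ((initial I).val i) (initial I).goods := by
  obtain ⟨hiI, hpos⟩ := mem_initial_agents.1 hi
  have h1 := (hpos.trans_le (share_le hval hi)).le
  have h2 := I.order_orderedOn (hval i hiI)
  exact ⟨fun a ha b hb hab => div_le_div_of_nonneg_right (h2.anti ha hb hab) h1,
    fun g hg => div_nonneg (h2.nonneg g hg) h1⟩

theorem value_initial (i : Fin n) (S : Finset (Fin m)) :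
    value ((initial I).val i) S = value (I.order.val i) S / I.dropZero.order.share i :=
  (Finset.sum_div _ _ _).symm

theorem initial_hasParts (hval : ∀ i ∈ I.agents, ∀ g ∈ I.goods, 0 ≤ I.val i g) {i : Fin n}
    (hi : i ∈ (initial I).agents) :
    HasParts ((initial I).val i) (initial I).goods (initial I).agents.card 1 := by
  obtain ⟨hiI, hpos⟩ := mem_initial_agents.1 hi
  have h1 := hpos.trans_le (share_le hval hi)
  obtain ⟨P, K, hK, hP⟩ := hasParts_mms (I.dropZero.order.val i)
    (Finset.card_pos.2 ⟨i, hi⟩) I.dropZero.order.goods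
  refine ⟨P, K, hK, fun j hj => ?_⟩
  rw [value_initial, le_div_iff₀ h1, one_mul]
  exact hP j hj

variable (I) in
/-- What is known about the result of `reduce` and `normalize`. -/
structure MemoryInv (α : ℝ) (c : Memory n m) : Prop where
  goods_subset : c.base.goods ⊆ (initial I).goods
  oni : AllONI c
  value_le : ∀ i ∈ c.base.agents, ∀ S ⊆ c.base.goods,
    956 / 959 * value (c.base.val i) S ≤ value ((initial I).val i) S
  alloc : IsAllocOf ((initial I).agents \ c.base.agents) ((initial I).goods \ c.base.goods) c.given
  worth : ∀ i ∈ (initial I).agents \ c.base.agents, α ≤ value ((initial I).val i) (c.given i)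
  empty : ∀ i, i ∉ (initial I).agents → c.given i = ∅

theorem ReduceInv.memoryInv {α : ℝ} {J B : Instance n m} {A : Alloc n m}
    (hval : ∀ i ∈ I.agents, ∀ g ∈ I.goods, 0 ≤ I.val i g) (hα : α ≤ 720 / 959)
    (h : ReduceInv (initial I) α J A) (hexit : ∀ k ∈ Finset.Icc 1 4, ¬ J.Applicable α k)
    (hB : J.IsNormalization B) : MemoryInv I α ⟨B, A⟩ := by
  have h1 := fun i (hi : i ∈ B.agents) =>
    h.exit (fun i hi => initial_orderedOn hval hi) hα hexit hB hi
  have hBa := hB.1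
  have hBg := hB.2.1
  refine ⟨?_, fun i hi => (h1 i hi).1, fun i hi => (h1 i hi).2, ?_, ?_, h.empty⟩
  · rw [hBg]; exact h.goods_subset
  · rw [hBa, hBg]; exact h.alloc
  · rw [hBa]; exact h.worth

/-- For agents served by bag filling, `beta` in the normalized instance becomes 956/959 · 180/239 =
720/959 in the scaled one. -/
theorem MemoryInv.combine {α : ℝ} {c : Memory n m} (h : MemoryInv I α c) (hα : α ≤ 720 / 959)
    {A B : Alloc n m} (hA : IsAllocOf c.base.agents c.base.goods A)
    (hw : ∀ i ∈ c.base.agents, beta ≤ value (c.hat.val i) (A i)) (hB : c.base.IsPicking A B) :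
    IsAllocOf I.agents I.goods (c.combine B) ∧
      ∀ i ∈ (initial I).agents, α ≤ value ((initial I).val i) (c.combine B i) := by
  obtain ⟨hBa, hBv⟩ := hB.isAllocOf hA
  have hin : ∀ i ∈ c.base.agents, c.combine B i = B i := fun i hi => if_pos hi
  have hout : ∀ i ∉ c.base.agents, c.combine B i = c.given i := fun i hi => if_neg hi
  have hgiven : ∀ i ∉ c.base.agents, c.given i ⊆ (initial I).goods \ c.base.goods := fun i hi => by
    by_cases hi' : i ∈ (initial I).agents
    · exact h.alloc.subset i (Finset.mem_sdiff.2 ⟨hi', hi⟩)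
    · rw [h.empty i hi']; exact Finset.empty_subset _
  have hmix : ∀ i ∈ c.base.agents, ∀ j ∉ c.base.agents, Disjoint (B i) (c.given j) :=
    fun i hi j hj => Finset.disjoint_left.2 fun g hg hg' =>
      (Finset.mem_sdiff.1 (hgiven j hj hg')).2 (hBa.subset i hi hg)
  refine ⟨⟨fun i _ => ?_, fun i _ j _ hij => ?_⟩, fun i hi => ?_⟩
  · by_cases hi : i ∈ c.base.agents
    · rw [hin i hi]; exact (hBa.subset i hi).trans h.goods_subset
    · rw [hout i hi]; exact (hgiven i hi).trans Finset.sdiff_subset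
  · by_cases hi : i ∈ c.base.agents <;> by_cases hj : j ∈ c.base.agents
    · rw [hin i hi, hin j hj]; exact hBa.disjoint i hi j hj hij
    · rw [hin i hi, hout j hj]; exact hmix i hi j hj
    · rw [hout i hi, hin j hj]; exact (hmix j hj i hi).symm
    · rw [hout i hi, hout j hj]
      by_cases hi' : i ∈ (initial I).agents
      · by_cases hj' : j ∈ (initial I).agents
        · exact h.alloc.disjoint i (Finset.mem_sdiff.2 ⟨hi', hi⟩) j
            (Finset.mem_sdiff.2 ⟨hj', hj⟩) hij
        · rw [h.empty j hj']; exact Finset.disjoint_empty_right _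
      · rw [h.empty i hi']; exact Finset.disjoint_empty_left _
  · by_cases hib : i ∈ c.base.agents
    · rw [hin i hib]
      have h1 := h.value_le i hib (B i) (hBa.subset i hib)
      have h2 := hBv i hib
      have h3 : beta ≤ value (c.base.order.val i) (A i) := hw i hib
      rw [beta_eq] at h3
      linarith
    · rw [hout i hib]; exact h.worth i (Finset.mem_sdiff.2 ⟨hi, hib⟩)

theorem isApproxMMS_of_isPicking {α : ℝ} (hα : 0 < α)
    (hval : ∀ i ∈ I.agents, ∀ g ∈ I.goods, 0 ≤ I.val i g) {A E : Alloc n m}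
    (hA : IsAllocOf I.agents I.goods A)
    (hw : ∀ i ∈ (initial I).agents, α ≤ value ((initial I).val i) (A i))
    (hE : I.IsPicking A E) : I.IsApproxMMS α E := by
  obtain ⟨hEa, hEv⟩ := hE.isAllocOf hA
  refine ⟨hEa.subset, hEa.disjoint, fun i hi => ?_⟩
  by_cases hpos : 0 < I.share i
  · have hi' := mem_initial_agents.2 ⟨hi, hpos⟩
    have h1 := share_le hval hi'
    have h2 := hw i hi'
    rw [value_initial, le_div_iff₀ (hpos.trans_le h1)] at h2
    exact ((mul_le_mul_of_nonneg_left h1 hα.le).trans h2).trans (hEv i hi)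
  · exact (mul_nonpos_of_nonneg_of_nonpos hα.le (not_lt.1 hpos)).trans
      (value_nonneg fun g hg => hval i hi g (hEa.subset i hi hg))

variable (I) in
/-- The invariant of `mainApproxMMS`. -/
def ConfigInv (α : ℝ) : Config n m → Prop
  | .reduce J A => ReduceInv (initial I) α J A
  | .bags c J K A => MemoryInv I α c ∧ BagsInv c J K A
  | .pairs c J A => MemoryInv I α c ∧ PairsConfigInv c J A
  | .rules c J A => MemoryInv I α c ∧ RulesConfigInv c J A
  | .fill c N Q F A => MemoryInv I α c ∧ FillConfigInv c N Q F A
  | .done A => I.IsApproxMMS α A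

theorem configInv_start (α : ℝ) (hval : ∀ i ∈ I.agents, ∀ g ∈ I.goods, 0 ≤ I.val i g) :
    ConfigInv I α (start I) :=
  ReduceInv.start α (fun _ hi => initial_orderedOn hval hi) fun _ hi => initial_hasParts hval hi

theorem FillConfigInv.nil {c : Memory n m} {N : Finset (Fin n)} {F : Finset (Fin m)}
    {A : Alloc n m} (h : FillConfigInv c N [] F A) :
    IsAllocOf c.base.agents c.base.goods A ∧
      ∀ i ∈ c.base.agents, beta ≤ value (c.hat.val i) (A i) := by
  have hN : N = ∅ := Finset.card_eq_zero.1 h.length.symm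
  subst hN
  obtain ⟨G, hG, -, -⟩ := h.run
  have h1 := hG.alloc
  have h2 := hG.worth
  rw [Finset.sdiff_empty] at h1 h2
  exact ⟨⟨fun i hi => (h1.subset i hi).trans Finset.sdiff_subset, h1.disjoint⟩, h2⟩

theorem ConfigInv.step {α : ℝ} (hα : 0 < α) (hα' : α ≤ 720 / 959)
    (hval : ∀ i ∈ I.agents, ∀ g ∈ I.goods, 0 ≤ I.val i g) {x y : Config n m}
    (hxy : Step I α x y) (hx : ConfigInv I α x) : ConfigInv I α y := by
  cases hxy with
  | reduceRule k i hk hmin hi =>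
    exact ReduceInv.rule hx (fun _ hi => initial_orderedOn hval hi) hα' hk hmin hi
  | reduceExit B hexit hB =>
    have h1 := ReduceInv.memoryInv hval hα' hx hexit hB
    exact ⟨h1, BagsInv.start h1.oni⟩
  | bagGive k i hk hi => exact ⟨hx.1, hx.2.give hk hi⟩
  | bagExitFew L hfew hexit hL => exact ⟨hx.1, hx.2.exit_few hx.1.oni hfew hexit hL⟩
  | bagExitMany hmany hexit => exact ⟨hx.1, hx.2.exit_many hx.1.oni hmany hexit⟩
  | pairGive i hi => exact ⟨hx.1, hx.2.give hx.1.oni hi⟩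
  | pairExit hexit => exact ⟨hx.1, hx.2.exit hx.1.oni hexit⟩
  | ruleGive k i hk hmin hi => exact ⟨hx.1, hx.2.give hx.1.oni hk hmin hi⟩
  | ruleExit hexit => exact ⟨hx.1, hx.2.exit hx.1.oni hexit⟩
  | fillAdd g hlow hg => exact ⟨hx.1, hx.2.add hx.1.oni hlow hg⟩
  | fillGive i hi => exact ⟨hx.1, hx.2.give hi⟩
  | fillExit B E hB hE =>
    obtain ⟨h1, h2⟩ := hx.2.nil
    obtain ⟨h3, h4⟩ := hx.1.combine hα' h1 h2 hB
    exact isApproxMMS_of_isPicking hα hval h3 h4 hE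

theorem exists_first_applicable (J : Instance n m) (β : ℝ) (P : Finset (Fin n)) {a b : ℕ}
    (h : ∃ k ∈ Finset.Icc a b, J.Applicable β k) :
    ∃ k ∈ Finset.Icc a b, (∀ l ∈ Finset.Ico a k, ¬ J.Applicable β l) ∧
      ∃ i, J.CanApply β P k i := by
  classical
  obtain ⟨hk, i, hi, hv⟩ := Nat.find_spec h
  obtain ⟨j, hj⟩ := exists_mayReceive P hi hv
  refine ⟨Nat.find h, hk, fun l hl hlapp => ?_, j, hj⟩
  rw [Finset.mem_Ico] at hl
  rw [Finset.mem_Icc] at hk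
  exact Nat.find_min h hl.2 ⟨Finset.mem_Icc.2 ⟨hl.1, by omega⟩, hlapp⟩

/-- Every loop either continues or meets its exit condition. The only danger is a bag that satisfies
nobody when no goods are left, and the budget of any remaining agent excludes it. -/
theorem ConfigInv.progress {α : ℝ} (hα' : α ≤ 720 / 959) {x : Config n m} (hx : ConfigInv I α x) :
    (∃ A, x = .done A) ∨ ∃ y, Step I α x y := by
  classical
  cases x with
  | reduce J A =>
    right
    by_cases h : ∃ k ∈ Finset.Icc 1 4, J.Applicable α k
    · obtain ⟨k, hk, hmin, i, hi⟩ := exists_first_applicable J α ∅ h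
      exact ⟨_, .reduceRule k i hk hmin hi⟩
    · push Not at h
      obtain ⟨B, hB⟩ := exists_isNormalization J
      exact ⟨_, .reduceExit B h hB⟩
  | bags c J K A =>
    right
    by_cases h : ∃ k ∈ K, ∃ i ∈ J.agents, beta ≤ value (J.val i) (c.hat.bagB k)
    · obtain ⟨k, hk, i, hi, hv⟩ := h
      obtain ⟨j, hj⟩ := exists_mayReceive (c.priority delta) hi hv
      exact ⟨_, .bagGive k j hk hj⟩
    · push Not at h
      by_cases hfew : c.hat.FewN11 delta
      · exact ⟨_, .bagExitFew K.toList hfew h ⟨K.nodup_toList, K.toList_toFinset⟩⟩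
      · exact ⟨_, .bagExitMany hfew h⟩
  | pairs c J A =>
    right
    by_cases h : J.Applicable beta 5
    · obtain ⟨i, hi, hv⟩ := h
      obtain ⟨j, hj⟩ := exists_mayReceive (c.priority delta) hi hv
      exact ⟨_, .pairGive j hj⟩
    · exact ⟨_, .pairExit h⟩
  | rules c J A =>
    right
    by_cases h : ∃ k ∈ Finset.Icc 2 3, J.Applicable beta k
    · obtain ⟨k, hk, hmin, i, hi⟩ := exists_first_applicable J beta (c.priority delta) h
      exact ⟨_, .ruleGive k i hk hmin hi⟩
    · push Not at h
      exact ⟨_, .ruleExit h⟩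
  | fill c N Q F A =>
    right
    obtain ⟨hM, hF⟩ := hx
    cases Q with
    | nil =>
      obtain ⟨h1, h2⟩ := hF.nil
      obtain ⟨B, hB⟩ := c.base.exists_isPicking h1
      obtain ⟨E, hE⟩ := I.exists_isPicking (hM.combine hα' h1 h2 hB).1
      exact ⟨_, .fillExit B E hB hE⟩
    | cons C Q =>
      by_cases h : ∃ i ∈ N, beta ≤ value (c.hat.val i) C
      · obtain ⟨i, hi, hv⟩ := h
        obtain ⟨j, hj⟩ := exists_mayReceive (c.priority delta) hi hv
        exact ⟨_, .fillGive j hj⟩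
      · push Not at h
        have hN : 0 < N.card := by
          rw [← hF.length, List.length_cons]; omega
        obtain ⟨i, hi⟩ := Finset.card_pos.1 hN
        obtain ⟨f, τ, ex, σ, S, hi'⟩ := hF.agent i hi
        obtain ⟨g, hg⟩ := hi'.nonempty (h i hi) hF.length
        exact ⟨_, .fillAdd g h hg⟩
  | done A => exact Or.inl ⟨A, rfl⟩

/-- A measure that decreases lexicographically with every step. -/
def stepMeasure : Config n m → ℕ × ℕ
  | .reduce J _ => (5, J.agents.card)
  | .bags _ J _ _ => (4, J.agents.card)
  | .pairs _ J _ => (3, J.agents.card)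
  | .rules _ J _ => (2, J.agents.card)
  | .fill _ _ Q F _ => (1, Q.length + F.card)
  | .done _ => (0, 0)

theorem stepMeasure_lt {α : ℝ} {x y : Config n m} (h : Step I α x y) :
    Prod.Lex (· < ·) (· < ·) (stepMeasure y) (stepMeasure x) := by
  cases h with
  | reduceRule k i hk hmin hi => exact Prod.Lex.right _ (Finset.card_erase_lt_of_mem hi.1)
  | reduceExit B hexit hB => exact Prod.Lex.left _ _ (by norm_num)
  | bagGive k i hk hi => exact Prod.Lex.right _ (Finset.card_erase_lt_of_mem hi.1)
  | bagExitFew L hfew hexit hL => exact Prod.Lex.left _ _ (by norm_num)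
  | bagExitMany hmany hexit => exact Prod.Lex.left _ _ (by norm_num)
  | pairGive i hi => exact Prod.Lex.right _ (Finset.card_erase_lt_of_mem hi.1)
  | pairExit hexit => exact Prod.Lex.left _ _ (by norm_num)
  | ruleGive k i hk hmin hi => exact Prod.Lex.right _ (Finset.card_erase_lt_of_mem hi.1)
  | ruleExit hexit => exact Prod.Lex.left _ _ (by norm_num)
  | fillAdd g hlow hg =>
    exact Prod.Lex.right _ (Nat.add_lt_add_left (Finset.card_erase_lt_of_mem hg) _)
  | fillGive i hi =>
    exact Prod.Lex.right _ (Nat.add_lt_add_right (Nat.lt_succ_self _) _)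
  | fillExit B E hB hE => exact Prod.Lex.left _ _ (by norm_num)

theorem wellFounded_step (I : Instance n m) (α : ℝ) :
    WellFounded fun y x : Config n m => Step I α x y :=
  Subrelation.wf (fun h => stepMeasure_lt h)
    (InvImage.wf stepMeasure (WellFounded.prod_lex wellFounded_lt wellFounded_lt))

theorem mainApproxMMSReturns {α : ℝ} (hα : 0 < α) (hα' : α ≤ 720 / 959)
    (hval : ∀ i ∈ I.agents, ∀ g ∈ I.goods, 0 ≤ I.val i g) :
    MainApproxMMSReturns I α (fun A => I.IsApproxMMS α A) := by
  refine ⟨by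
    rintro ⟨r, -, hr⟩
    exact (wellFounded_iff_isEmpty_descending_chain.1 (wellFounded_step I α)).false ⟨r, hr⟩,
    fun x hx hstuck => ?_⟩
  · have hinv : ConfigInv I α x := by
      clear hstuck
      induction hx with
      | refl => exact configInv_start α hval
      | tail _ h ih =>
        exact ConfigInv.step hα hα' hval h ih
    rcases hinv.progress hα' with ⟨A, rfl⟩ | ⟨y, hy⟩
    · exact ⟨A, rfl, hinv⟩
    · exact absurd hy (hstuck y)

/-- The goods that are left over can be given to any agent. -/
theorem exists_isApproxMMS_complete {α : ℝ} (hN : I.agents.Nonempty)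
    (hval : ∀ i ∈ I.agents, ∀ g ∈ I.goods, 0 ≤ I.val i g) {A : Alloc n m}
    (hA : I.IsApproxMMS α A) :
    ∃ A, I.IsApproxMMS α A ∧ ∀ g ∈ I.goods, ∃ i ∈ I.agents, g ∈ A i := by
  classical
  obtain ⟨i₀, hi₀⟩ := hN
  obtain ⟨hsub, hdis, hv⟩ := hA
  set R := I.goods \ I.agents.biUnion A with hR
  have hRdis : ∀ i ∈ I.agents, Disjoint R (A i) := fun i hi => Finset.disjoint_left.2
    fun g hg hg' => (Finset.mem_sdiff.1 hg).2 (Finset.mem_biUnion.2 ⟨i, hi, hg'⟩)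
  have hupd : ∀ i, i ≠ i₀ → Function.update A i₀ (A i₀ ∪ R) i = A i := fun i hi =>
    Function.update_of_ne hi _ _
  have hself : Function.update A i₀ (A i₀ ∪ R) i₀ = A i₀ ∪ R := Function.update_self _ _ _
  have hsub' : ∀ i ∈ I.agents, Function.update A i₀ (A i₀ ∪ R) i ⊆ I.goods := fun i hi => by
    by_cases h : i = i₀
    · subst h; rw [hself]; exact Finset.union_subset (hsub i hi) Finset.sdiff_subset
    · rw [hupd i h]; exact hsub i hi
  refine ⟨Function.update A i₀ (A i₀ ∪ R), ⟨hsub', fun i hi j hj hij => ?_, fun i hi => ?_⟩,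
    fun g hg => ?_⟩
  · by_cases h : i = i₀
    · subst h
      rw [hself, hupd j (Ne.symm hij)]
      exact Finset.disjoint_union_left.2 ⟨hdis i hi j hj hij, hRdis j hj⟩
    · rw [hupd i h]
      by_cases h' : j = i₀
      · subst h'
        rw [hself]
        exact Finset.disjoint_union_right.2 ⟨hdis i hi j hj hij, (hRdis i hi).symm⟩
      · rw [hupd j h']; exact hdis i hi j hj hij
  · refine (hv i hi).trans (value_mono (fun g hg => hval i hi g (hsub' i hi hg)) ?_)
    by_cases h : i = i₀
    · subst h; rw [hself]; exact Finset.subset_union_left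
    · rw [hupd i h]
  · by_cases h : g ∈ I.agents.biUnion A
    · obtain ⟨i, hi, hgi⟩ := Finset.mem_biUnion.1 h
      refine ⟨i, hi, ?_⟩
      by_cases h' : i = i₀
      · subst h'; rw [hself]; exact Finset.mem_union_left _ hgi
      · rwa [hupd i h']
    · refine ⟨i₀, hi₀, ?_⟩
      rw [hself]
      exact Finset.mem_union_right _ (Finset.mem_sdiff.2 ⟨hg, h⟩)

/-- A reachable configuration that is minimal for the well-founded step relation cannot be
continued, so it has returned an allocation. -/
theorem exists_isApproxMMS {α : ℝ} (h : MainApproxMMSReturns I α fun A => I.IsApproxMMS α A) :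
    ∃ A, I.IsApproxMMS α A := by
  obtain ⟨x, hx, hmin⟩ := (wellFounded_step I α).has_min
    {x | Relation.ReflTransGen (Step I α) (start I) x} ⟨_, Relation.ReflTransGen.refl⟩
  obtain ⟨A, -, hA⟩ := h.2 x hx fun y hy => hmin y (Relation.ReflTransGen.tail hx hy) hy
  exact ⟨A, hA⟩

end Correctness

end FairDivision

theorem mainTheorem1 {n m : ℕ} (I : FairDivision.Instance n m) (hN : I.agents.Nonempty)
    (hval : ∀ i ∈ I.agents, ∀ g ∈ I.goods, 0 ≤ I.val i g) :
    (∀ α : ℝ, 0 < α → α ≤ 3 / 4 + 3 / 3836 →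
      FairDivision.MainApproxMMSReturns I α (fun A => I.IsApproxMMS α A)) ∧
    (∃ A : FairDivision.Alloc n m, I.IsApproxMMS (3 / 4 + 3 / 3836) A ∧
      ∀ g ∈ I.goods, ∃ i ∈ I.agents, g ∈ A i) := by
  have key : ∀ α : ℝ, 0 < α → α ≤ 3 / 4 + 3 / 3836 →
      FairDivision.MainApproxMMSReturns I α (fun A => I.IsApproxMMS α A) := fun α hα hα' =>
    -- The bound 3/4 + 3/3836 equals 720/959.
    FairDivision.mainApproxMMSReturns hα (hα'.trans (by norm_num)) hval
  obtain ⟨A, hA⟩ := FairDivision.exists_isApproxMMS (key (3 / 4 + 3 / 3836) (by norm_num) le_rfl)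
  exact ⟨key, FairDivision.exists_isApproxMMS_complete hN hval hA⟩
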